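/- Let $d\ge 1$ and let $\mu$ be the uniform probability measure on the unit sphere $\mathbb S^d\subset\mathbb R^{d+1}$; $L^2(\mathbb S^d)$ means $L^2(\mu)$. For $\ell\ge 0$ let $\lambda_\ell=\ell(\ell+d-1)$, and let $\{Y_{\ell,m}: m=1,\dots,M_{d,\ell}\}$ be an $L^2(\mathbb S^d)$-orthonormal basis of the space of real spherical harmonics of degree $\ell$ (restrictions to $\mathbb S^d$ of harmonic homogeneous polynomials of degree $\ell$), where $M_{d,\ell}$ is the dimension of that space. Let $\alpha>d/2$, $0<\beta\le\alpha$, $\kappa>0$, $\sigma>0$, and let $f_0\in H^\beta(\mathbb S^d)$, that is, $f_0\in L^2(\mathbb S^d)$ is real-valued and $\sum_{\ell\ge0}(1+\lambda_\ell)^\beta\sum_{m}\langle f_0,Y_{\ell,m}\rangle_{L^2(\mathbb S^d)}^2<\infty$. *Data.* For each $n$ observe independent pairs $(x_i,y_i)$, $i=1,\dots,n$, with $y_i=f_0(x_i)+\varepsilon_i$, where $x_i\sim\mu$ and $\varepsilon_i\sim\mathcal N(0,\sigma^2)$ are all independent ($\sigma$ known). Write $\mathbb E^{(n)}_{f_0}$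 for expectation under this law, $\boldsymbol x=(x_1,\dots,x_n)$ and $\boldsymbol y=(y_1,\dots,y_n)$. *Prior.* Let $L_n\in\mathbb N$ satisfy $L_n\simeq n^{1/(2\alpha+d)}$, i.e. $c_1n^{1/(2\alpha+d)}\le L_n\le c_2n^{1/(2\alpha+d)}$ for some constants $c_1,c_2>0$ and all large $n$. The spherical Matérn prior truncated at $L_n$ is the law of $f=\sum_{\ell\le L_n}\sum_{m=1}^{M_{d,\ell}}a_{\ell,m}Y_{\ell,m}$ with independent $a_{\ell,m}\sim\mathcal N\big(0,(\kappa^2+\lambda_\ell)^{-\alpha}\big)$. *Posterior.* Let $\varphi(\cdot;t,v)$ be the density of $\mathcal N(t,v)$, and let $\Pi(\cdot\mid\boldsymbol y,\boldsymbol x)$ be the posterior distribution given by Bayes' formula (density with respect to the prior proportional to the likelihood) with either 1. the regression likelihood $\prod_{i=1}^n\varphi(y_i;f(x_i),\sigma^2)$, or 2. the harmonic-domain likelihood $\prod_{\ell\le L_n}\prod_{m}\varphi(\hat a_{\ell,m};a_{\ell,m},\sigma^2/n)$, where $\hat a_{\ell,m}=\frac1n\sum_{i=1}^n y_iY_{\ell,m}(x_i)$.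 Then, in each of the two cases, the posterior contracts around $f_0$ in $L^2(\mathbb S^d)$ at rate $\rho_n=n^{-\beta/(2\alpha+d)}$: there is $M_0>0$ such that for every $M\ge M_0$ $$\mathbb E^{(n)}_{f_0}\Big[\Pi\big(f:\|f-f_0\|_{L^2(\mathbb S^d)}>M\rho_n\,\big|\,\boldsymbol y,\boldsymbol x\big)\Big]\longrightarrow0\qquad(n\to\infty).$$ -/

import Mathlib

open MeasureTheory ProbabilityTheory Filter Topology Asymptotics
open scoped ENNReal NNReal

namespace SphereMatern

/-- The unit sphere `S^d = {x ∈ ℝ^{d+1} : ‖x‖ = 1}` (Euclidean norm). -/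
abbrev Sph (d : ℕ) : Type := Metric.sphere (0 : EuclideanSpace ℝ (Fin (d + 1))) 1

/-- The uniform probability measure on `S^d`: the surface measure, normalized. -/
noncomputable def unif (d : ℕ) : Measure (Sph d) :=
  ((volume : Measure (EuclideanSpace ℝ (Fin (d + 1)))).toSphere Set.univ)⁻¹ •
    (volume : Measure (EuclideanSpace ℝ (Fin (d + 1)))).toSphere

instance instIsProbabilityMeasureUnif (d : ℕ) : IsProbabilityMeasure (unif d) := by
  refine ⟨?_⟩
  have h0 : (volume : Measure (EuclideanSpace ℝ (Fin (d + 1)))).toSphere Set.univ ≠ 0 := by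
    rw [Ne, Measure.measure_univ_eq_zero]
    exact Measure.toSphere_ne_zero _
  simp only [unif, Measure.smul_apply, smul_eq_mul]
  exact ENNReal.inv_mul_cancel h0 (measure_ne_top _ _)

/-- The space of (real) spherical harmonics of degree `ℓ` on `S^d`: restrictions to the sphere of
the homogeneous polynomials of degree `ℓ` in `d + 1` variables whose Laplacian vanishes. -/
noncomputable def sphericalHarmonics (d ℓ : ℕ) : Submodule ℝ (Sph d → ℝ) where
  carrier := {f | ∃ p : MvPolynomial (Fin (d + 1)) ℝ, p.IsHomogeneous ℓ ∧
    ∑ i, MvPolynomial.pderiv i (MvPolynomial.pderiv i p) = 0 ∧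
    ∀ x : Sph d, f x = MvPolynomial.eval (fun i => x.1 i) p}
  zero_mem' := ⟨0, MvPolynomial.isHomogeneous_zero _ _ _, by simp, by simp⟩
  add_mem' := by
    rintro f g ⟨p, hp, hp0, hpf⟩ ⟨q, hq, hq0, hqg⟩
    refine ⟨p + q, hp.add hq, ?_, fun x => by simp [hpf x, hqg x]⟩
    simp only [map_add, Finset.sum_add_distrib, hp0, hq0, add_zero]
  smul_mem' := by
    rintro c f ⟨p, hp, hp0, hpf⟩
    refine ⟨c • p, (MvPolynomial.homogeneousSubmodule _ ℝ ℓ).smul_mem c hp, ?_,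
      fun x => by simp [hpf x]⟩
    simp only [Derivation.map_smul, ← Finset.smul_sum, hp0, smul_zero]

/-- The multiplicity `M_{d,ℓ}`: the dimension of the space of spherical harmonics of degree `ℓ`. -/
noncomputable def mult (d ℓ : ℕ) : ℕ := Module.finrank ℝ (sphericalHarmonics d ℓ)

/-- The Laplace–Beltrami eigenvalue `λ_ℓ = ℓ (ℓ + d - 1)` of `S^d` (a real number). -/
def lam (d ℓ : ℕ) : ℝ := (ℓ : ℝ) * ((ℓ : ℝ) + (d : ℝ) - 1)

/-- A choice of real spherical harmonics `Y_{ℓ,m}`, `ℓ ≥ 0`, `m = 1, …, M_{d,ℓ}`: for each `ℓ` an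
orthonormal family of `M_{d,ℓ}` elements, hence an orthonormal basis, of the space of spherical
harmonics of degree `ℓ`, for the inner product of `L²` of the uniform probability measure. -/
structure HarmonicBasis (d : ℕ) where
  Y : (ℓ : ℕ) → Fin (mult d ℓ) → Sph d → ℝ
  mem : ∀ ℓ m, Y ℓ m ∈ sphericalHarmonics d ℓ
  orthonormal : ∀ ℓ m m', ∫ x, Y ℓ m x * Y ℓ m' x ∂(unif d) = if m = m' then 1 else 0

theorem continuous_of_mem {d ℓ : ℕ} {f : Sph d → ℝ} (hf : f ∈ sphericalHarmonics d ℓ) :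
    Continuous f := by
  obtain ⟨p, -, -, h⟩ := hf
  rw [funext h]
  have : Continuous fun v : Fin (d + 1) → ℝ => MvPolynomial.eval v p := p.continuous_eval
  exact this.comp (continuous_pi fun i => by fun_prop)

/-- Spherical harmonics `Y_{ℓ,m}` as above exist. -/
theorem nonempty_harmonicBasis (d : ℕ) : Nonempty (HarmonicBasis d) := by
  have hop : (unif d).IsOpenPosMeasure := by
    unfold unif
    refine Measure.isOpenPosMeasure_smul _ ?_
    exact ENNReal.inv_ne_zero.mpr (measure_ne_top _ _)
  have key : ∀ ℓ, ∃ Y : Fin (mult d ℓ) → Sph d → ℝ, (∀ m, Y m ∈ sphericalHarmonics d ℓ) ∧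
      ∀ m m', ∫ x, Y m x * Y m' x ∂(unif d) = if m = m' then 1 else 0 := by
    intro ℓ
    by_cases hfin : Module.Finite ℝ (sphericalHarmonics d ℓ)
    swap
    · have h0 : mult d ℓ = 0 := Module.finrank_of_not_finite hfin
      have he : IsEmpty (Fin (mult d ℓ)) := by rw [h0]; infer_instance
      exact ⟨fun m => he.elim m, fun m => he.elim m, fun m => he.elim m⟩
    let T₀ : sphericalHarmonics d ℓ →ₗ[ℝ] C(Sph d, ℝ) :=
      { toFun := fun f => ⟨f.1, continuous_of_mem f.2⟩
        map_add' := fun _ _ => rfl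
        map_smul' := fun _ _ => rfl }
    let T : sphericalHarmonics d ℓ →ₗ[ℝ] Lp ℝ 2 (unif d) :=
      (ContinuousMap.toLp 2 (unif d) ℝ).toLinearMap ∘ₗ T₀
    have hT : Function.Injective T := by
      refine (ContinuousMap.toLp_injective (p := 2) (𝕜 := ℝ) (E := ℝ) (unif d)).comp ?_
      intro f g h
      exact Subtype.ext (congrArg (fun u : C(Sph d, ℝ) => (u : Sph d → ℝ)) h)
    let e := LinearEquiv.ofInjective T hT
    have hfr : Module.finrank ℝ (LinearMap.range T) = mult d ℓ := e.finrank_eq.symm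
    let b := (stdOrthonormalBasis ℝ (LinearMap.range T)).reindex (finCongr hfr)
    refine ⟨fun m => (e.symm (b m)).1, fun m => (e.symm (b m)).2, fun m m' => ?_⟩
    have hb := orthonormal_iff_ite.mp b.orthonormal m m'
    rw [← hb, Submodule.coe_inner, L2.inner_def]
    have hm : ∀ m, ((b m : Lp ℝ 2 (unif d)) : Sph d → ℝ) =ᵐ[unif d] (e.symm (b m)).1 := by
      intro m
      have h1 : (b m : Lp ℝ 2 (unif d)) = T (e.symm (b m)) := by
        conv_lhs => rw [← e.apply_symm_apply (b m)]
        rfl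
      rw [h1]
      exact ContinuousMap.coeFn_toLp (p := 2) (𝕜 := ℝ) (unif d) (T₀ (e.symm (b m)))
    refine integral_congr_ae ?_
    filter_upwards [hm m, hm m'] with x h1 h2
    rw [h1, h2]
    exact mul_comm _ _
  choose Y h1 h2 using key
  exact ⟨⟨Y, h1, h2⟩⟩

/-- The harmonic coefficient `⟨f, Y_{ℓ,m}⟩` in `L²(S^d)`. -/
noncomputable def coeff {d : ℕ} (B : HarmonicBasis d) (f : Sph d → ℝ) (ℓ : ℕ)
    (m : Fin (mult d ℓ)) : ℝ :=
  ∫ x, f x * B.Y ℓ m x ∂(unif d)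

/-- `f ∈ H^β(S^d)`: `f ∈ L²(S^d)` and `∑_ℓ (1 + λ_ℓ)^β ∑_m ⟨f, Y_{ℓ,m}⟩² < ∞`. -/
def InSobolev {d : ℕ} (B : HarmonicBasis d) (β : ℝ) (f : Sph d → ℝ) : Prop :=
  MemLp f 2 (unif d) ∧
    Summable (fun ℓ : ℕ => (1 + lam d ℓ) ^ β * ∑ m, coeff B f ℓ m ^ 2)

/-- The indices `(ℓ, m)` with `0 ≤ ℓ ≤ L` and `1 ≤ m ≤ M_{d,ℓ}`. -/
abbrev Idx (d L : ℕ) : Type := (ℓ : Fin (L + 1)) × Fin (mult d ℓ)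

/-- The function `f_a = ∑_{ℓ ≤ L} ∑_m a_{ℓ,m} Y_{ℓ,m}` with coefficient vector `a`
(so that the coefficients of degree `ℓ > L` are zero). -/
noncomputable def synth {d : ℕ} (B : HarmonicBasis d) {L : ℕ} (a : Idx d L → ℝ) (x : Sph d) : ℝ :=
  ∑ j : Idx d L, a j * B.Y j.1 j.2 x

/-- The spherical Matérn prior truncated at level `L`, as a law of the coefficient vector: the
`a_{ℓ,m}`, `ℓ ≤ L`, are independent `N(0, (κ² + λ_ℓ)^{-α})`. -/
noncomputable def maternPrior (d : ℕ) (κ α : ℝ) (L : ℕ) : Measure (Idx d L → ℝ) :=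
  Measure.pi fun j => gaussianReal 0 ((κ ^ 2 + lam d j.1) ^ (-α)).toNNReal

/-- Samples `((x_1, y_1), …, (x_n, y_n))`. -/
abbrev Data (d n : ℕ) : Type := Fin n → Sph d × ℝ

/-- The law of `n` i.i.d. pairs `(x_i, y_i)` with `y_i = f₀(x_i) + ε_i`, where `x_i` is uniform on
`S^d` and `ε_i ~ N(0, σ²)` is independent of `x_i`. -/
noncomputable def dataLaw {d : ℕ} (f₀ : Sph d → ℝ) (σ : ℝ) (n : ℕ) : Measure (Data d n) :=
  Measure.pi fun _ =>
    ((unif d).prod (gaussianReal 0 (σ ^ 2).toNNReal)).map fun p => (p.1, f₀ p.1 + p.2)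

/-- The likelihood of the regression model at `a`: the density `∏_i φ(y_i; f_a(x_i), σ²)` of the
responses given the design, where `φ(·; μ, v)` is the density of `N(μ, v)`. -/
noncomputable def regressionLik {d : ℕ} (B : HarmonicBasis d) (σ : ℝ) {n : ℕ} (D : Data d n)
    {L : ℕ} (a : Idx d L → ℝ) : ℝ≥0∞ :=
  ∏ i, gaussianPDF (synth B a (D i).1) (σ ^ 2).toNNReal (D i).2

/-- The empirical harmonic coefficient `â_{ℓ,m} = n⁻¹ ∑_i y_i Y_{ℓ,m}(x_i)`. -/
noncomputable def empCoeff {d : ℕ} (B : HarmonicBasis d) {n : ℕ} (D : Data d n) (ℓ : ℕ)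
    (m : Fin (mult d ℓ)) : ℝ :=
  (n : ℝ)⁻¹ * ∑ i, (D i).2 * B.Y ℓ m (D i).1

/-- The harmonic-domain (Gaussian sequence) likelihood at `a`, restricted to the retained modes:
`∏_{ℓ ≤ L} ∏_m φ(â_{ℓ,m}; a_{ℓ,m}, σ²/n)`. -/
noncomputable def harmonicLik {d : ℕ} (B : HarmonicBasis d) (σ : ℝ) {n : ℕ} (D : Data d n)
    {L : ℕ} (a : Idx d L → ℝ) : ℝ≥0∞ :=
  ∏ j : Idx d L, gaussianPDF (a j) (σ ^ 2 / n).toNNReal (empCoeff B D j.1 j.2)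

/-- Bayes' formula: the probability measure with density proportional to the likelihood `lik` with
respect to the prior `P`. -/
noncomputable def bayes {Θ : Type*} [MeasurableSpace Θ] (P : Measure Θ) (lik : Θ → ℝ≥0∞) :
    Measure Θ :=
  (∫⁻ a, lik a ∂P)⁻¹ • P.withDensity lik

/-- The event `{a : ‖f_a - f₀‖_{L²(S^d)} > r}`. -/
def farSet {d : ℕ} (B : HarmonicBasis d) (f₀ : Sph d → ℝ) (L : ℕ) (r : ℝ) : Set (Idx d L → ℝ) :=
  {a | ENNReal.ofReal r < eLpNorm (fun x => synth B a x - f₀ x) 2 (unif d)}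

/-- A sequence of random measures `post n` on coefficient vectors, depending on the data of size `n`,
contracts around `f₀` at rate `ρ n` in `L²(S^d)`: for every sufficiently large `M`, the expectation
under `f₀` of `post n {f : ‖f - f₀‖ > M ρ_n}` tends to zero. -/
def Contracts {d : ℕ} (B : HarmonicBasis d) (f₀ : Sph d → ℝ) (σ : ℝ) (L : ℕ → ℕ)
    (post : (n : ℕ) → Data d n → Measure (Idx d (L n) → ℝ)) (ρ : ℕ → ℝ) : Prop :=
  ∃ M₀ : ℝ, 0 < M₀ ∧ ∀ M : ℝ, M₀ ≤ M →
    Tendsto (fun n => ∫⁻ D, post n D (farSet B f₀ (L n) (M * ρ n)) ∂(dataLaw f₀ σ n)) atTop (𝓝 0)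

end SphereMatern

namespace SphereMatern

/-! ### Orthogonality of harmonics of different degrees, via the Gaussian weight. -/

section GaussianWeight

/-! Split `f₀ = f_{a₀} + h`, where `a₀` collects the coefficients of degree at most `L n` and `h` is
orthogonal to all retained modes. In the coordinate `b = a - a₀` both posteriors have a density
proportional to `exp (-q(b)/2 + ⟨g, b⟩)`. The quadratic form `q` is the prior precision plus the
empirical Gram form over `σ²` (regression) or plus `n/σ²` times the identity (harmonic domain). The
linear term is `g = S/σ² - a₀/v`, where `v` are the prior variances and `S` is the sum over the
sample of the centred products of a response with the basis functions; in regression the response is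
the residual `h(x) + ε`.

If `q(b) ≥ A|b|²` and `|g| ≤ A r / 8`, the posterior mass of `|b| > r` is at most `√2 ^ J * exp (-A
r²/8)`, with `J` the number of modes (`bayes_tail_le`). No Gaussian integral is evaluated: only the
homogeneity of `q` and a symmetrization enter. By Pythagoras (`farSet_subset`) the theorem reduces
to size comparisons for `A = n/(2σ²)` and `r = Mρ_n/2`.

Let `N = n^{d/(2α+d)}`. Then `J ≲ N ≤ n ρ_n²` because `β ≤ α`; the truncation error `‖h‖²` is of
order at most `ρ_n²`; and the prior bias satisfies `|a₀/v| ≲ n ρ_n`. Two random events must also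
have probability tending to one.

The Gram form must be at least `n/2` times the identity: the squared Frobenius norm of its deviation
has mean at most `n J²`, and `J²/n → 0` because `α > d/2` (`measure_gram_gt_le`).

Also `|S|² ≤ K n N` must hold for a fixed `K`. Markov's inequality would leave a fixed failure
probability, so Chebyshev's inequality is applied to `|S|²`. This requires a bounded signal, whereas
`f₀` is merely in `L²`; a bounded approximation is split off and the small remainder is treated by
Markov (`tendsto_measure_response_gt`).

The analysis on the sphere comes from polynomials: orthogonality between degrees, the decomposition
of homogeneous polynomials into harmonics, completeness by Stone–Weierstrass, the pointwise identity
`∑ Y² = J` by rotation invariance, and the bound `J ≤ 2 (L+1)^d`. -/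

theorem integrable_pow_mul_exp_neg_half_sq (k : ℕ) :
    Integrable fun x : ℝ => x ^ k * Real.exp (-(x ^ 2) / 2) := by
  have h := integrable_rpow_mul_exp_neg_mul_sq (b := 1 / 2) (by norm_num) (s := (k : ℝ))
    (by have : (0 : ℝ) ≤ k := k.cast_nonneg
        linarith)
  refine h.congr (ae_of_all _ fun x => ?_)
  simp only [Real.rpow_natCast]
  congr 2
  ring

/-- The moments of the weight `exp (-x² / 2)`. -/
noncomputable def halfSqMoment (k : ℕ) : ℝ := ∫ x : ℝ, x ^ k * Real.exp (-(x ^ 2) / 2)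

/-- Integration by parts. For `k = 0` the truncated index `k - 1` is harmless, since its factor
vanishes. -/
theorem halfSqMoment_succ (k : ℕ) : halfSqMoment (k + 1) = k * halfSqMoment (k - 1) := by
  have hd : ∀ x : ℝ, HasDerivAt (fun x : ℝ => x ^ k * Real.exp (-(x ^ 2) / 2))
      ((k : ℝ) * (x ^ (k - 1) * Real.exp (-(x ^ 2) / 2))
        - x ^ (k + 1) * Real.exp (-(x ^ 2) / 2)) x := by
    intro x
    have h1 := (((hasDerivAt_pow 2 x).neg.div_const 2).exp)
    have h2 := (hasDerivAt_pow k x).mul h1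
    refine h2.congr_deriv ?_
    simp only [Nat.cast_ofNat, Nat.add_one_sub_one, pow_one, Pi.neg_apply]
    ring
  have hint : Integrable fun x : ℝ => (k : ℝ) * (x ^ (k - 1) * Real.exp (-(x ^ 2) / 2))
        - x ^ (k + 1) * Real.exp (-(x ^ 2) / 2) :=
    ((integrable_pow_mul_exp_neg_half_sq _).const_mul _).sub
      (integrable_pow_mul_exp_neg_half_sq _)
  have h := integral_eq_zero_of_hasDerivAt_of_integrable hd hint
    (integrable_pow_mul_exp_neg_half_sq k)
  rw [integral_sub ((integrable_pow_mul_exp_neg_half_sq _).const_mul _)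
      (integrable_pow_mul_exp_neg_half_sq _), integral_const_mul] at h
  unfold halfSqMoment
  linarith

variable {n : ℕ}

theorem eval_monomial_mul_exp (a : Fin n →₀ ℕ) (c : ℝ) (x : Fin n → ℝ) :
    MvPolynomial.eval x (MvPolynomial.monomial a c) * Real.exp (-(∑ i, x i ^ 2) / 2)
      = c * ∏ i, (x i ^ a i * Real.exp (-(x i ^ 2) / 2)) := by
  rw [MvPolynomial.eval_monomial, Finsupp.prod_fintype _ _ (by simp), Finset.prod_mul_distrib,
    ← Real.exp_sum, ← Finset.sum_div, Finset.sum_neg_distrib, mul_assoc]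

theorem integrable_eval_mul_exp (p : MvPolynomial (Fin n) ℝ) :
    Integrable fun x : Fin n → ℝ =>
      MvPolynomial.eval x p * Real.exp (-(∑ i, x i ^ 2) / 2) := by
  induction p using MvPolynomial.induction_on' with
  | monomial a c =>
    simp only [eval_monomial_mul_exp]
    exact (Integrable.fintype_prod
      (f := fun i (y : ℝ) => y ^ a i * Real.exp (-(y ^ 2) / 2))
      (fun i => integrable_pow_mul_exp_neg_half_sq (a i))).const_mul c
  | add p q hp hq =>
    simp only [map_add, add_mul]
    exact hp.add hq

/-- Integration of a polynomial against the weight `exp (-|x|² / 2)`. -/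
noncomputable def weightIntegral (p : MvPolynomial (Fin n) ℝ) : ℝ :=
  ∫ x : Fin n → ℝ, MvPolynomial.eval x p * Real.exp (-(∑ i, x i ^ 2) / 2)

theorem weightIntegral_add (p q : MvPolynomial (Fin n) ℝ) :
    weightIntegral (p + q) = weightIntegral p + weightIntegral q := by
  simp only [weightIntegral, map_add, add_mul]
  exact integral_add (integrable_eval_mul_exp p) (integrable_eval_mul_exp q)

theorem weightIntegral_smul (c : ℝ) (p : MvPolynomial (Fin n) ℝ) :
    weightIntegral (c • p) = c * weightIntegral p := by
  simp only [weightIntegral, MvPolynomial.smul_eval, mul_assoc]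
  exact integral_const_mul _ _

theorem weightIntegral_zero : weightIntegral (0 : MvPolynomial (Fin n) ℝ) = 0 := by
  simp [weightIntegral]

theorem weightIntegral_sum {ι : Type*} (s : Finset ι) (p : ι → MvPolynomial (Fin n) ℝ) :
    weightIntegral (∑ i ∈ s, p i) = ∑ i ∈ s, weightIntegral (p i) := by
  classical
  induction s using Finset.induction_on with
  | empty => simp [weightIntegral_zero]
  | insert i s hi ih => rw [Finset.sum_insert hi, Finset.sum_insert hi, weightIntegral_add, ih]

theorem weightIntegral_monomial (a : Fin n →₀ ℕ) (c : ℝ) :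
    weightIntegral (MvPolynomial.monomial a c) = c * ∏ i, halfSqMoment (a i) := by
  simp only [weightIntegral, eval_monomial_mul_exp, integral_const_mul]
  congr 1
  exact integral_fintype_prod_volume_eq_prod
    (fun i (y : ℝ) => y ^ a i * Real.exp (-(y ^ 2) / 2))

/-- Multiplication by `x_i` is dual to differentiation under the Gaussian weight; on monomials this
is the one-variable moment recursion. -/
theorem weightIntegral_pderiv (i : Fin n) (p : MvPolynomial (Fin n) ℝ) :
    weightIntegral (MvPolynomial.pderiv i p) = weightIntegral (MvPolynomial.X i * p) := by
  classical
  induction p using MvPolynomial.induction_on' with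
  | monomial a c =>
    rw [MvPolynomial.pderiv_monomial, MvPolynomial.X, MvPolynomial.monomial_mul,
      weightIntegral_monomial, weightIntegral_monomial,
      ← Finset.mul_prod_erase Finset.univ _ (Finset.mem_univ i),
      ← Finset.mul_prod_erase Finset.univ (fun k => halfSqMoment _) (Finset.mem_univ i)]
    have h : ∀ k ∈ Finset.univ.erase i, halfSqMoment ((a - Finsupp.single i 1 : Fin n →₀ ℕ) k)
        = halfSqMoment ((Finsupp.single i 1 + a : Fin n →₀ ℕ) k) := by
      intro k hk
      have : i ≠ k := (Finset.ne_of_mem_erase hk).symm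
      simp [this]
    rw [Finset.prod_congr rfl h]
    simp only [Finsupp.coe_tsub, Pi.sub_apply, Finsupp.single_eq_same, Finsupp.coe_add,
      Pi.add_apply, add_comm 1 (a i), halfSqMoment_succ, one_mul]
    ring
  | add p q hp hq => rw [map_add, weightIntegral_add, mul_add, weightIntegral_add, hp, hq]

/-- By Euler's identity `l p q = ∑ x_i p ∂_i q`. Integration by parts turns this into `∑ ∂_i (p ∂_i
q) = ∇p·∇q + p Δq`, whose last term vanishes. The right side is symmetric in `p` and `q`, so two
harmonic polynomials of different degrees must be orthogonal. -/
theorem weightIntegral_mul_of_harmonic {l : ℕ} {p q : MvPolynomial (Fin n) ℝ}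
    (hq : q.IsHomogeneous l)
    (hq0 : ∑ i, MvPolynomial.pderiv i (MvPolynomial.pderiv i q) = 0) :
    (l : ℝ) * weightIntegral (p * q)
      = weightIntegral (∑ i, MvPolynomial.pderiv i p * MvPolynomial.pderiv i q) := by
  have h1 : ∑ i, MvPolynomial.pderiv i p * MvPolynomial.pderiv i q
      = ∑ i, MvPolynomial.pderiv i (p * MvPolynomial.pderiv i q) := by
    simp only [MvPolynomial.pderiv_mul, Finset.sum_add_distrib, ← Finset.mul_sum, hq0, mul_zero,
      add_zero]
  have h2 : ∑ i, MvPolynomial.X i * (p * MvPolynomial.pderiv i q) = (l : ℝ) • (p * q) := by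
    have := hq.sum_X_mul_pderiv
    calc ∑ i, MvPolynomial.X i * (p * MvPolynomial.pderiv i q)
        = p * ∑ i, MvPolynomial.X i * MvPolynomial.pderiv i q := by
          rw [Finset.mul_sum]
          exact Finset.sum_congr rfl fun i _ => by ring
      _ = (l : ℝ) • (p * q) := by
          rw [this, ← Nat.cast_smul_eq_nsmul ℝ, mul_smul_comm]
  rw [h1, weightIntegral_sum]
  simp only [weightIntegral_pderiv]
  rw [← weightIntegral_sum, h2, weightIntegral_smul]

theorem weightIntegral_mul_eq_zero {k l : ℕ} (hkl : k ≠ l) {p q : MvPolynomial (Fin n) ℝ}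
    (hp : p.IsHomogeneous k) (hq : q.IsHomogeneous l)
    (hp0 : ∑ i, MvPolynomial.pderiv i (MvPolynomial.pderiv i p) = 0)
    (hq0 : ∑ i, MvPolynomial.pderiv i (MvPolynomial.pderiv i q) = 0) :
    weightIntegral (p * q) = 0 := by
  have h1 := weightIntegral_mul_of_harmonic (p := p) hq hq0
  have h2 := weightIntegral_mul_of_harmonic (p := q) hp hp0
  simp only [mul_comm q p, mul_comm (MvPolynomial.pderiv _ q)] at h2
  have h3 : ((l : ℝ) - k) * weightIntegral (p * q) = 0 := by linarith
  rcases mul_eq_zero.mp h3 with h | h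
  · exact absurd (by exact_mod_cast (sub_eq_zero.mp h).symm) hkl
  · exact h

end GaussianWeight

/-! ### Polar coordinates: transfer of orthogonality to the sphere. -/

section Polar

variable {d : ℕ}

/-- Evaluation of a polynomial on the sphere. -/
noncomputable def restr (d : ℕ) : MvPolynomial (Fin (d + 1)) ℝ →ₗ[ℝ] (Sph d → ℝ) where
  toFun p := fun x => MvPolynomial.eval (fun i => x.1 i) p
  map_add' p q := by ext x; simp
  map_smul' c p := by ext x; simp

theorem restr_apply (p : MvPolynomial (Fin (d + 1)) ℝ) (x : Sph d) :
    restr d p x = MvPolynomial.eval (fun i => x.1 i) p := rfl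

theorem eval_smul_of_isHomogeneous {n k : ℕ} {p : MvPolynomial (Fin n) ℝ}
    (hp : p.IsHomogeneous k) (r : ℝ) (x : Fin n → ℝ) :
    MvPolynomial.eval (fun i => r * x i) p = r ^ k * MvPolynomial.eval x p := by
  rw [MvPolynomial.eval_eq', MvPolynomial.eval_eq', Finset.mul_sum]
  refine Finset.sum_congr rfl fun a ha => ?_
  have hdeg : ∑ i, a i = k := by
    have := hp (MvPolynomial.mem_support_iff.mp ha)
    rw [Finsupp.weight_apply, Finsupp.sum_fintype _ _ (by simp)] at this
    simpa using this
  simp only [mul_pow, Finset.prod_mul_distrib]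
  rw [Finset.prod_pow_eq_pow_sum, hdeg]
  ring

/-- Homogeneity separates the angular and the radial factor in polar coordinates. The radial factor
is positive, so a vanishing Gaussian integral forces a vanishing spherical integral. -/
theorem weightIntegral_eq_integral_toSphere {k : ℕ} {p : MvPolynomial (Fin (d + 1)) ℝ}
    (hp : p.IsHomogeneous k) :
    weightIntegral p =
      (∫ x, restr d p x ∂(volume : Measure (EuclideanSpace ℝ (Fin (d + 1)))).toSphere) *
        ∫ r : Set.Ioi (0 : ℝ), r.1 ^ k * Real.exp (-(r.1 ^ 2) / 2)
          ∂(Measure.volumeIoiPow d) := by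
  have h1 : weightIntegral p
      = ∫ x : EuclideanSpace ℝ (Fin (d + 1)), MvPolynomial.eval (fun i => x i) p * Real.exp (-(‖x‖ ^ 2) / 2) := by
    rw [weightIntegral, ← (PiLp.volume_preserving_ofLp (Fin (d + 1))).integral_comp
      (MeasurableEquiv.toLp 2 (Fin (d + 1) → ℝ)).symm.measurableEmbedding]
    refine integral_congr_ae (ae_of_all _ fun x => ?_)
    change _ = MvPolynomial.eval x.ofLp p * Real.exp (-(‖x‖ ^ 2) / 2)
    rw [EuclideanSpace.real_norm_sq_eq]
  have h2 : ∫ x : EuclideanSpace ℝ (Fin (d + 1)), MvPolynomial.eval (fun i => x i) p * Real.exp (-(‖x‖ ^ 2) / 2)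
      = ∫ x : ({0}ᶜ : Set (EuclideanSpace ℝ (Fin (d + 1)))), MvPolynomial.eval (fun i => x.1 i) p
          * Real.exp (-(‖x.1‖ ^ 2) / 2) ∂(volume.comap Subtype.val) := by
    have hs : MeasurableSet ({0}ᶜ : Set (EuclideanSpace ℝ (Fin (d + 1)))) :=
      isOpen_compl_singleton.measurableSet
    rw [integral_subtype_comap hs
      (fun x : EuclideanSpace ℝ (Fin (d + 1)) => MvPolynomial.eval (fun i => x i) p * Real.exp (-(‖x‖ ^ 2) / 2)),
      restrict_compl_singleton]
  have hfr : Module.finrank ℝ (EuclideanSpace ℝ (Fin (d + 1))) - 1 = d := by simp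
  have hmp := (volume : Measure (EuclideanSpace ℝ (Fin (d + 1)))).measurePreserving_homeomorphUnitSphereProd
  rw [hfr] at hmp
  rw [h1, h2, ← integral_prod_mul, ← hmp.integral_comp (Homeomorph.measurableEmbedding _)]
  refine integral_congr_ae (ae_of_all _ fun x => ?_)
  have hx : ‖x.1‖ ≠ 0 := norm_ne_zero_iff.mpr x.2
  simp only [homeomorphUnitSphereProd_apply_snd_coe, restr_apply,
    homeomorphUnitSphereProd_apply_fst_coe]
  rw [← mul_assoc, mul_comm _ (‖x.1‖ ^ k), ← eval_smul_of_isHomogeneous hp]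
  congr 3
  ext i
  simp [hx]

theorem integral_unif (f : Sph d → ℝ) :
    ∫ x, f x ∂(unif d) =
      ((volume : Measure (EuclideanSpace ℝ (Fin (d + 1)))).toSphere Set.univ)⁻¹.toReal *
        ∫ x, f x ∂(volume : Measure (EuclideanSpace ℝ (Fin (d + 1)))).toSphere := by
  rw [unif, integral_smul_measure, smul_eq_mul]

theorem radial_integral_pos (d k : ℕ) :
    0 < ∫ r : Set.Ioi (0 : ℝ), r.1 ^ k * Real.exp (-(r.1 ^ 2) / 2)
          ∂(Measure.volumeIoiPow d) := by
  rw [Measure.volumeIoiPow, integral_withDensity_eq_integral_toReal_smul (by fun_prop) (by simp)]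
  have h0 : ∀ r : Set.Ioi (0 : ℝ), (ENNReal.ofReal (r.1 ^ d)).toReal •
      (r.1 ^ k * Real.exp (-(r.1 ^ 2) / 2)) = r.1 ^ (d + k) * Real.exp (-(r.1 ^ 2) / 2) := by
    intro r
    rw [ENNReal.toReal_ofReal (pow_nonneg r.2.le _), smul_eq_mul]
    ring
  simp only [h0]
  rw [integral_subtype_comap measurableSet_Ioi
    (fun r : ℝ => r ^ (d + k) * Real.exp (-(r ^ 2) / 2))]
  rw [setIntegral_pos_iff_support_of_nonneg_ae]
  · refine lt_of_lt_of_le (b := volume (Set.Ioi (0 : ℝ))) (by simp) (measure_mono ?_)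
    intro r hr
    have hr' : (0 : ℝ) < r := hr
    refine ⟨?_, hr⟩
    simp only [Function.mem_support]
    positivity
  · filter_upwards [ae_restrict_mem measurableSet_Ioi] with r hr
    have hr' : (0 : ℝ) < r := hr
    simp only [Pi.zero_apply]
    positivity
  · exact (integrable_pow_mul_exp_neg_half_sq _).integrableOn

/-- Spherical harmonics of different degrees are orthogonal. -/
theorem integral_mul_eq_zero_of_ne {k l : ℕ} (hkl : k ≠ l) {f g : Sph d → ℝ}
    (hf : f ∈ sphericalHarmonics d k) (hg : g ∈ sphericalHarmonics d l) :
    ∫ x, f x * g x ∂(unif d) = 0 := by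
  obtain ⟨p, hp, hp0, hpf⟩ := hf
  obtain ⟨q, hq, hq0, hqg⟩ := hg
  have h := weightIntegral_mul_eq_zero hkl hp hq hp0 hq0
  rw [weightIntegral_eq_integral_toSphere (hp.mul hq)] at h
  have h2 := (mul_eq_zero.mp h).resolve_right (radial_integral_pos d (k + l)).ne'
  rw [integral_unif]
  have h3 : (fun x => f x * g x) = restr d (p * q) := by
    ext x
    rw [hpf, hqg, restr_apply, map_mul]
  simp only [h3, h2, mul_zero]

end Polar

end SphereMatern

namespace SphereMatern

/-! ### Homogeneous polynomials on the sphere as sums of harmonics. -/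

section Decomposition

variable {d : ℕ}

theorem mem_sphericalHarmonics_iff {ℓ : ℕ} {f : Sph d → ℝ} :
    f ∈ sphericalHarmonics d ℓ ↔ ∃ p : MvPolynomial (Fin (d + 1)) ℝ, p.IsHomogeneous ℓ ∧
      ∑ i, MvPolynomial.pderiv i (MvPolynomial.pderiv i p) = 0 ∧ f = restr d p := by
  constructor
  · rintro ⟨p, hp, hp0, h⟩
    exact ⟨p, hp, hp0, funext h⟩
  · rintro ⟨p, hp, hp0, rfl⟩
    exact ⟨p, hp, hp0, fun x => rfl⟩

theorem integrable_of_continuous {f : Sph d → ℝ} (hf : Continuous f) :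
    Integrable f (unif d) := by
  have : Integrable (fun x => f x) (unif d) := by
    rw [← integrableOn_univ]
    exact hf.continuousOn.integrableOn_compact isCompact_univ
  exact this

theorem integrable_mul_of_continuous {f g : Sph d → ℝ} (hf : Continuous f) (hg : Continuous g) :
    Integrable (fun x => f x * g x) (unif d) := integrable_of_continuous (hf.mul hg)

instance instIsOpenPosMeasureUnif (d : ℕ) : (unif d).IsOpenPosMeasure := by
  unfold unif
  refine Measure.isOpenPosMeasure_smul _ ?_
  exact ENNReal.inv_ne_zero.mpr (measure_ne_top _ _)

theorem eq_zero_of_integral_sq_eq_zero {f : Sph d → ℝ} (hf : Continuous f)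
    (h : ∫ x, f x * f x ∂(unif d) = 0) : f = 0 := by
  have h1 := (integral_eq_zero_iff_of_nonneg (μ := unif d) (f := fun x => f x * f x)
    (fun x => mul_self_nonneg _) (integrable_of_continuous (hf.mul hf))).mp h
  have h2 := (hf.mul hf).ae_eq_iff_eq (unif d) continuous_const |>.mp h1
  ext x
  exact mul_self_eq_zero.mp (congrFun h2 x)

/-- The span of the spherical harmonics of degree at most `L`. -/
noncomputable def harmonicSpan (d L : ℕ) : Submodule ℝ (Sph d → ℝ) :=
  Submodule.span ℝ {f | ∃ k ≤ L, f ∈ sphericalHarmonics d k}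

theorem harmonicSpan_mono {L L' : ℕ} (h : L ≤ L') : harmonicSpan d L ≤ harmonicSpan d L' :=
  Submodule.span_mono fun _ ⟨k, hk, hf⟩ => ⟨k, hk.trans h, hf⟩

theorem integral_mul_harmonicSpan_eq_zero {k L : ℕ} (hL : L < k) {f g : Sph d → ℝ}
    (hf : f ∈ sphericalHarmonics d k) (hg : g ∈ harmonicSpan d L) :
    Continuous g ∧ ∫ x, f x * g x ∂(unif d) = 0 := by
  have hfc := continuous_of_mem hf
  induction hg using Submodule.span_induction with
  | mem g hg =>
    obtain ⟨l, hl, hg⟩ := hg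
    exact ⟨continuous_of_mem hg, integral_mul_eq_zero_of_ne (by omega) hf hg⟩
  | zero => exact ⟨continuous_zero, by simp⟩
  | add u v _ _ hu hv =>
    refine ⟨hu.1.add hv.1, ?_⟩
    simp only [Pi.add_apply, mul_add]
    rw [integral_add (integrable_mul_of_continuous hfc hu.1)
      (integrable_mul_of_continuous hfc hv.1), hu.2, hv.2, add_zero]
  | smul c u _ hu =>
    refine ⟨hu.1.const_smul c, ?_⟩
    simp only [Pi.smul_apply, smul_eq_mul, mul_left_comm _ c]
    rw [integral_const_mul, hu.2, mul_zero]

/-- The Laplacian on polynomials. -/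
noncomputable def lap (n : ℕ) : MvPolynomial (Fin n) ℝ →ₗ[ℝ] MvPolynomial (Fin n) ℝ :=
  ∑ i, (MvPolynomial.pderiv i).toLinearMap ∘ₗ (MvPolynomial.pderiv i).toLinearMap

theorem lap_apply {n : ℕ} (p : MvPolynomial (Fin n) ℝ) :
    lap n p = ∑ i, MvPolynomial.pderiv i (MvPolynomial.pderiv i p) := by
  simp [lap]

theorem lap_isHomogeneous {n ℓ : ℕ} {p : MvPolynomial (Fin n) ℝ} (hp : p.IsHomogeneous ℓ) :
    (lap n p).IsHomogeneous (ℓ - 2) := by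
  rw [lap_apply]
  exact MvPolynomial.IsHomogeneous.sum _ _ _ fun i _ => hp.pderiv.pderiv

theorem lap_eq_zero_of_lt_two {n ℓ : ℕ} {p : MvPolynomial (Fin n) ℝ} (hp : p.IsHomogeneous ℓ)
    (hℓ : ℓ < 2) : lap n p = 0 := by
  rw [lap_apply]
  refine Finset.sum_eq_zero fun i _ => ?_
  have h : (MvPolynomial.pderiv i p).IsHomogeneous 0 := by
    have := hp.pderiv (i := i)
    rwa [show ℓ - 1 = 0 by omega] at this
  rw [← MvPolynomial.totalDegree_zero_iff_isHomogeneous,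
    MvPolynomial.totalDegree_eq_zero_iff_eq_C] at h
  rw [h, MvPolynomial.pderiv_C]

/-- The polynomial `|x|²`. -/
noncomputable def normSqPoly (n : ℕ) : MvPolynomial (Fin n) ℝ := ∑ i, MvPolynomial.X i ^ 2

theorem normSqPoly_isHomogeneous (n : ℕ) : (normSqPoly n).IsHomogeneous 2 :=
  MvPolynomial.IsHomogeneous.sum _ _ _ fun i _ => by
    simpa using (MvPolynomial.isHomogeneous_X ℝ i).pow 2

theorem eval_normSqPoly {n : ℕ} (x : Fin n → ℝ) :
    MvPolynomial.eval x (normSqPoly n) = ∑ i, x i ^ 2 := by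
  simp [normSqPoly]

theorem sum_sq_eq_one (x : Sph d) : ∑ i, x.1 i ^ 2 = 1 := by
  rw [← EuclideanSpace.real_norm_sq_eq, norm_eq_of_mem_sphere, one_pow]

theorem restr_normSqPoly_mul (p : MvPolynomial (Fin (d + 1)) ℝ) :
    restr d (normSqPoly (d + 1) * p) = restr d p := by
  ext x
  rw [restr_apply, map_mul, eval_normSqPoly, sum_sq_eq_one, one_mul, restr_apply]

/-- By homogeneity `q` vanishes off the origin. The factor `|x|²` takes care of the origin, and is
cancelled at the end in the polynomial ring. -/
theorem normSqPoly_mul_eq_zero_of_restr {m : ℕ} {q : MvPolynomial (Fin (d + 1)) ℝ}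
    (hq : q.IsHomogeneous m) (h : restr d q = 0) : q = 0 := by
  have h0 : normSqPoly (d + 1) * q = 0 := by
    refine MvPolynomial.funext fun x => ?_
    rw [map_mul, eval_normSqPoly, map_zero]
    by_cases hx : ∑ i, x i ^ 2 = 0
    · rw [hx, zero_mul]
    · let v : EuclideanSpace ℝ (Fin (d + 1)) := WithLp.toLp 2 x
      have hv : ‖v‖ ^ 2 = ∑ i, x i ^ 2 := EuclideanSpace.real_norm_sq_eq v
      have hv0 : ‖v‖ ≠ 0 := fun h => hx (by rw [← hv, h]; norm_num)
      let y : Sph d := ⟨‖v‖⁻¹ • v, by simp [norm_smul, hv0]⟩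
      have hy := congrFun h y
      rw [restr_apply] at hy
      have hxy : x = fun i => ‖v‖ * y.1 i := by
        ext i
        simp [y, v, hv0]
      rw [hxy, eval_smul_of_isHomogeneous hq, hy]
      simp
  refine (mul_eq_zero.mp h0).resolve_left fun hN => ?_
  have := congrArg (MvPolynomial.eval fun _ => (1 : ℝ)) hN
  rw [eval_normSqPoly, map_zero] at this
  simp at this
  linarith [(d.cast_nonneg : (0 : ℝ) ≤ d)]

/-- One seeks `q` of degree `ℓ - 2` with `p - |x|² q` harmonic; on the sphere `|x|² q` equals `q`,
which is covered by induction. Such a `q` exists if `q ↦ Δ(|x|² q)` is surjective on a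
finite-dimensional space, hence if it is injective. -/
theorem restr_mem_harmonicSpan {ℓ : ℕ} {p : MvPolynomial (Fin (d + 1)) ℝ}
    (hp : p.IsHomogeneous ℓ) : restr d p ∈ harmonicSpan d ℓ := by
  induction ℓ using Nat.strong_induction_on generalizing p with
  | _ ℓ ih =>
    by_cases hℓ : ℓ < 2
    · refine Submodule.subset_span ⟨ℓ, le_rfl, mem_sphericalHarmonics_iff.mpr ⟨p, hp, ?_, rfl⟩⟩
      rw [← lap_apply]
      exact lap_eq_zero_of_lt_two hp hℓ
    · obtain ⟨m, rfl⟩ : ∃ m, ℓ = m + 2 := ⟨ℓ - 2, by omega⟩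
      have hN : ∀ {q : MvPolynomial (Fin (d + 1)) ℝ}, q.IsHomogeneous m →
          (normSqPoly (d + 1) * q).IsHomogeneous (m + 2) := by
        intro q hq
        rw [add_comm m 2]
        exact (normSqPoly_isHomogeneous _).mul hq
      let T : MvPolynomial.homogeneousSubmodule (Fin (d + 1)) ℝ m →ₗ[ℝ]
          MvPolynomial.homogeneousSubmodule (Fin (d + 1)) ℝ m :=
        (lap (d + 1) ∘ₗ LinearMap.mulLeft ℝ (normSqPoly (d + 1))).restrict
          (fun q hq => lap_isHomogeneous (hN hq))
      have hfin : Module.Finite ℝ (MvPolynomial.homogeneousSubmodule (Fin (d + 1)) ℝ m) :=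
        Module.Finite.iff_fg.mpr (MvPolynomial.homogeneousSubmodule_fg (Fin (d + 1)) ℝ m)
      have hT : Function.Injective T := by
        rw [← LinearMap.ker_eq_bot, LinearMap.ker_eq_bot']
        rintro ⟨q, hq⟩ hTq
        have hq' : q.IsHomogeneous m := hq
        have h0 : lap (d + 1) (normSqPoly (d + 1) * q) = 0 := congrArg Subtype.val hTq
        -- A kernel element restricts both to a harmonic of degree `m + 2` and, by induction, to a
        -- sum of harmonics of degree at most `m`. It is therefore orthogonal to itself.
        have hmem : restr d q ∈ sphericalHarmonics d (m + 2) := by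
          refine mem_sphericalHarmonics_iff.mpr
            ⟨normSqPoly (d + 1) * q, hN hq', ?_, (restr_normSqPoly_mul q).symm⟩
          rw [← lap_apply, h0]
        have h1 := integral_mul_harmonicSpan_eq_zero (show m < m + 2 by omega) hmem
          (ih m (by omega) hq')
        have h2 := eq_zero_of_integral_sq_eq_zero h1.1 h1.2
        exact Subtype.ext (normSqPoly_mul_eq_zero_of_restr hq' h2)
      obtain ⟨⟨q, hq⟩, hTq⟩ := LinearMap.surjective_of_injective hT
        ⟨lap (d + 1) p, lap_isHomogeneous hp⟩
      have hTq' : lap (d + 1) (normSqPoly (d + 1) * q) = lap (d + 1) p :=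
        congrArg Subtype.val hTq
      have hdec : restr d p = restr d (p - normSqPoly (d + 1) * q) + restr d q := by
        rw [map_sub, restr_normSqPoly_mul, sub_add_cancel]
      rw [hdec]
      refine Submodule.add_mem _ (Submodule.subset_span ⟨m + 2, le_rfl,
        mem_sphericalHarmonics_iff.mpr ⟨_, hp.sub (hN hq), ?_, rfl⟩⟩)
        (harmonicSpan_mono (by omega) (ih m (by omega) hq))
      rw [← lap_apply, map_sub, hTq', sub_self]

end Decomposition

/-! ### The orthonormal system and finite expansions. -/

section Basis

variable {d : ℕ}

/-- Finite dimension guarantees that `mult`, a `finrank`, is the true dimension and not the default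
value `0`. -/
instance instFiniteSphericalHarmonics (d ℓ : ℕ) :
    Module.Finite ℝ (sphericalHarmonics d ℓ) := by
  have hfin : Module.Finite ℝ (MvPolynomial.homogeneousSubmodule (Fin (d + 1)) ℝ ℓ) :=
    Module.Finite.iff_fg.mpr (MvPolynomial.homogeneousSubmodule_fg (Fin (d + 1)) ℝ ℓ)
  have hle : sphericalHarmonics d ℓ ≤
      (MvPolynomial.homogeneousSubmodule (Fin (d + 1)) ℝ ℓ).map (restr d) := by
    intro f hf
    obtain ⟨p, hp, -, rfl⟩ := mem_sphericalHarmonics_iff.mp hf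
    exact ⟨p, hp, rfl⟩
  exact Submodule.finiteDimensional_of_le hle

theorem linearIndependent_of_orthonormal {ι : Type*} [Fintype ι] [DecidableEq ι]
    {g : ι → Sph d → ℝ} (hc : ∀ i, Continuous (g i))
    (h : ∀ i j, ∫ x, g i x * g j x ∂(unif d) = if i = j then 1 else 0) :
    LinearIndependent ℝ g := by
  rw [Fintype.linearIndependent_iff]
  intro c hc0 j
  have h1 : ∫ x, (∑ i, c i • g i) x * g j x ∂(unif d) = c j := by
    simp only [Finset.sum_apply, Pi.smul_apply, smul_eq_mul, Finset.sum_mul, mul_assoc]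
    rw [integral_finsetSum _ fun i _ =>
      (integrable_mul_of_continuous (hc i) (hc j)).const_mul (c i)]
    simp [integral_const_mul, h]
  rw [← h1, hc0]
  simp

/-- An orthonormal family is independent, and this one has as many elements as the dimension. -/
theorem span_range_Y (B : HarmonicBasis d) (ℓ : ℕ) :
    Submodule.span ℝ (Set.range (B.Y ℓ)) = sphericalHarmonics d ℓ := by
  have hli := linearIndependent_of_orthonormal (fun m => continuous_of_mem (B.mem ℓ m))
    (B.orthonormal ℓ)
  refine Submodule.eq_of_le_of_finrank_eq ?_ ?_
  · rw [Submodule.span_le]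
    rintro _ ⟨m, rfl⟩
    exact B.mem ℓ m
  · rw [finrank_span_eq_card hli, Fintype.card_fin, mult]

theorem continuous_Y (B : HarmonicBasis d) (ℓ : ℕ) (m : Fin (mult d ℓ)) :
    Continuous (B.Y ℓ m) := continuous_of_mem (B.mem ℓ m)

theorem integral_Y_mul_Y (B : HarmonicBasis d) {L : ℕ} (j k : Idx d L) :
    ∫ x, B.Y j.1 j.2 x * B.Y k.1 k.2 x ∂(unif d) = if j = k then 1 else 0 := by
  obtain ⟨⟨a, ha⟩, m⟩ := j
  obtain ⟨⟨b, hb⟩, m'⟩ := k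
  by_cases hab : a = b
  · subst hab
    rw [B.orthonormal]
    simp
  · rw [integral_mul_eq_zero_of_ne hab (B.mem _ _) (B.mem _ _), if_neg]
    intro h
    simp only [Sigma.mk.injEq, Fin.mk.injEq] at h
    exact hab h.1

theorem continuous_synth (B : HarmonicBasis d) {L : ℕ} (a : Idx d L → ℝ) :
    Continuous (synth B a) := by
  unfold synth
  exact continuous_finsetSum _ fun j _ => (continuous_Y B _ _).const_mul _

theorem integral_synth_mul_synth (B : HarmonicBasis d) {L : ℕ} (a b : Idx d L → ℝ) :
    ∫ x, synth B a x * synth B b x ∂(unif d) = ∑ j, a j * b j := by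
  have h : ∀ x, synth B a x * synth B b x
      = ∑ j, ∑ k, (a j * b k) * (B.Y j.1 j.2 x * B.Y k.1 k.2 x) := by
    intro x
    simp only [synth, Finset.sum_mul_sum]
    exact Finset.sum_congr rfl fun j _ => Finset.sum_congr rfl fun k _ => by ring
  simp only [h]
  have hi : ∀ j k : Idx d L, Integrable
      (fun x => (a j * b k) * (B.Y j.1 j.2 x * B.Y k.1 k.2 x)) (unif d) := fun j k =>
    (integrable_mul_of_continuous (continuous_Y B _ _) (continuous_Y B _ _)).const_mul _
  rw [integral_finsetSum _ fun j _ => integrable_finsetSum _ fun k _ => hi j k]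
  refine Finset.sum_congr rfl fun j _ => ?_
  rw [integral_finsetSum _ fun k _ => hi j k]
  simp [integral_const_mul, integral_Y_mul_Y]

/-- `synth` as a linear map. -/
noncomputable def synthLin (B : HarmonicBasis d) (L : ℕ) : (Idx d L → ℝ) →ₗ[ℝ] (Sph d → ℝ) where
  toFun a := synth B a
  map_add' a b := by ext x; simp [synth, add_mul, Finset.sum_add_distrib]
  map_smul' c a := by ext x; simp [synth, mul_assoc, Finset.mul_sum]

theorem synth_add (B : HarmonicBasis d) {L : ℕ} (a b : Idx d L → ℝ) (x : Sph d) :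
    synth B (a + b) x = synth B a x + synth B b x := congrFun ((synthLin B L).map_add a b) x

theorem synth_smul (B : HarmonicBasis d) {L : ℕ} (c : ℝ) (a : Idx d L → ℝ) (x : Sph d) :
    synth B (c • a) x = c * synth B a x := congrFun ((synthLin B L).map_smul c a) x

theorem harmonicSpan_le_range (B : HarmonicBasis d) (L : ℕ) :
    harmonicSpan d L ≤ LinearMap.range (synthLin B L) := by
  classical
  rw [harmonicSpan, Submodule.span_le]
  rintro f ⟨k, hk, hf⟩
  rw [← span_range_Y B k] at hf
  refine Submodule.span_le.mpr ?_ hf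
  rintro _ ⟨m, rfl⟩
  refine ⟨Pi.single ⟨⟨k, by omega⟩, m⟩ 1, ?_⟩
  ext x
  change synth B _ x = _
  rw [synth, Finset.sum_eq_single ⟨⟨k, by omega⟩, m⟩]
  · simp
  · intro j _ hj
    rw [Pi.single_eq_of_ne hj, zero_mul]
  · simp

theorem exists_synth_eq (B : HarmonicBasis d) {L : ℕ} {f : Sph d → ℝ}
    (hf : f ∈ harmonicSpan d L) : ∃ a : Idx d L → ℝ, synth B a = f :=
  harmonicSpan_le_range B L hf

end Basis

end SphereMatern

namespace SphereMatern

/-! ### Rotation invariance and the addition theorem. -/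

section Rotation

variable {d : ℕ}

/-- The action of a linear isometry on the sphere. -/
noncomputable def rot (e : EuclideanSpace ℝ (Fin (d + 1)) ≃ₗᵢ[ℝ] EuclideanSpace ℝ (Fin (d + 1))) (x : Sph d) :
    Sph d := ⟨e x.1, by simp⟩

theorem continuous_rot
    (e : EuclideanSpace ℝ (Fin (d + 1)) ≃ₗᵢ[ℝ] EuclideanSpace ℝ (Fin (d + 1))) :
    Continuous (rot e) :=
  Continuous.subtype_mk (e.continuous.comp continuous_subtype_val) _

open scoped Pointwise in
theorem measurePreserving_rot
    (e : EuclideanSpace ℝ (Fin (d + 1)) ≃ₗᵢ[ℝ] EuclideanSpace ℝ (Fin (d + 1))) :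
    MeasurePreserving (rot e) (unif d) (unif d) := by
  refine ⟨(continuous_rot e).measurable, ?_⟩
  rw [unif, Measure.map_smul]
  congr 1
  ext s hs
  rw [Measure.map_apply (continuous_rot e).measurable hs, Measure.toSphere_apply' _ hs,
    Measure.toSphere_apply' _ ((continuous_rot e).measurable hs)]
  congr 1
  rw [← (LinearIsometryEquiv.measurePreserving e).measure_preimage_equiv
    (f := e.toHomeomorph.toMeasurableEquiv)
    (Set.Ioo (0 : ℝ) 1 • (Subtype.val '' s))]
  congr 1
  ext v
  simp only [Set.mem_smul, Set.mem_image, Set.mem_preimage]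
  constructor
  · rintro ⟨r, hr, _, ⟨x, hx, rfl⟩, rfl⟩
    exact ⟨r, hr, _, ⟨_, hx, rfl⟩, (e.map_smul r x.1).symm⟩
  · rintro ⟨r, hr, _, ⟨x, hx, rfl⟩, hv⟩
    refine ⟨r, hr, e.symm x.1, ⟨rot e.symm x, ?_, rfl⟩, ?_⟩
    · have : rot e (rot e.symm x) = x := Subtype.ext (e.apply_symm_apply x.1)
      rwa [this]
    · apply e.injective
      rw [e.map_smul, e.apply_symm_apply]
      exact hv

theorem integral_comp_rot
    (e : EuclideanSpace ℝ (Fin (d + 1)) ≃ₗᵢ[ℝ] EuclideanSpace ℝ (Fin (d + 1))) {f : Sph d → ℝ}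
    (hf : Continuous f) : ∫ x, f (rot e x) ∂(unif d) = ∫ x, f x ∂(unif d) := by
  have h := measurePreserving_rot e
  conv_rhs => rw [← h.map_eq]
  rw [integral_map h.aemeasurable hf.aestronglyMeasurable]

/-- The reflection in the hyperplane orthogonal to `x - y` exchanges two vectors of equal norm. -/
theorem exists_rot_eq (x y : Sph d) :
    ∃ e : EuclideanSpace ℝ (Fin (d + 1)) ≃ₗᵢ[ℝ] EuclideanSpace ℝ (Fin (d + 1)), rot e x = y := by
  refine ⟨(Submodule.span ℝ {x.1 - y.1})ᗮ.reflection, Subtype.ext ?_⟩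
  exact Submodule.reflection_sub (by simp)

/-- Linear substitution preserves homogeneity, and every homogeneous polynomial restricts into the
span. Invariance of the Laplacian is thus not needed. -/
theorem comp_rot_mem_harmonicSpan
    (e : EuclideanSpace ℝ (Fin (d + 1)) ≃ₗᵢ[ℝ] EuclideanSpace ℝ (Fin (d + 1))) {L : ℕ}
    {f : Sph d → ℝ} (hf : f ∈ harmonicSpan d L) : (fun x => f (rot e x)) ∈ harmonicSpan d L := by
  classical
  induction hf using Submodule.span_induction with
  | mem f hf =>
    obtain ⟨k, hk, hf⟩ := hf
    obtain ⟨p, hp, -, rfl⟩ := mem_sphericalHarmonics_iff.mp hf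
    let lin : Fin (d + 1) → MvPolynomial (Fin (d + 1)) ℝ := fun i =>
      ∑ j, MvPolynomial.C (e (EuclideanSpace.single j 1) i) * MvPolynomial.X j
    have hlin : ∀ i, (lin i).IsHomogeneous 1 := fun i =>
      MvPolynomial.IsHomogeneous.sum _ _ _ fun j _ => by
        simpa using (MvPolynomial.isHomogeneous_C (Fin (d + 1)) _).mul
          (MvPolynomial.isHomogeneous_X ℝ j)
    have hlin' : ∀ (x : Sph d) i, MvPolynomial.eval (fun k => x.1 k) (lin i) = (e x.1) i := by
      intro x i
      have hx : x.1 = ∑ j, x.1 j • EuclideanSpace.single j (1 : ℝ) := by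
        ext i
        simp [Finset.sum_apply, Pi.single_apply]
      conv_rhs => rw [hx, map_sum]
      simp [lin, mul_comm]
    have hq : (MvPolynomial.aeval lin p).IsHomogeneous k := by
      simpa using hp.aeval lin hlin
    refine harmonicSpan_mono hk ?_
    convert restr_mem_harmonicSpan hq using 1
    ext x
    rw [restr_apply, restr_apply, MvPolynomial.aeval_def, MvPolynomial.eval_eval₂]
    simp only [hlin']
    rw [MvPolynomial.eval, MvPolynomial.coe_eval₂Hom]
    congr 1
    ext
    simp
  | zero => exact Submodule.zero_mem _
  | add u v _ _ hu hv => exact Submodule.add_mem _ hu hv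
  | smul c u _ hu => exact Submodule.smul_mem _ c hu

theorem Y_mem_harmonicSpan (B : HarmonicBasis d) {L : ℕ} (j : Idx d L) :
    B.Y j.1 j.2 ∈ harmonicSpan d L :=
  Submodule.subset_span ⟨j.1, by omega, B.mem _ _⟩

theorem synth_mem_harmonicSpan (B : HarmonicBasis d) {L : ℕ} (a : Idx d L → ℝ) :
    synth B a ∈ harmonicSpan d L := by
  have : synth B a = ∑ j : Idx d L, a j • B.Y j.1 j.2 := by
    ext x
    simp [synth]
  rw [this]
  exact Submodule.sum_mem _ fun j _ => Submodule.smul_mem _ _ (Y_mem_harmonicSpan B j)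

/-- The function with coefficients `Y_j(y)` is the reproducing kernel at `y`, and its value there is
`∑ Y_j(y)²`. Its rotated copy has the same `L²` norm and takes that value at `x`; Cauchy–Schwarz for
its expansion at `x` gives the inequality. -/
theorem sum_Y_sq_le (B : HarmonicBasis d) {L : ℕ} (x y : Sph d) :
    ∑ j : Idx d L, B.Y j.1 j.2 y ^ 2 ≤ ∑ j : Idx d L, B.Y j.1 j.2 x ^ 2 := by
  obtain ⟨e, rfl⟩ := exists_rot_eq x y
  let b : Idx d L → ℝ := fun j => B.Y j.1 j.2 (rot e x)
  obtain ⟨a, ha⟩ := exists_synth_eq B (comp_rot_mem_harmonicSpan e (synth_mem_harmonicSpan B b))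
  have hb : synth B b (rot e x) = ∑ j, b j ^ 2 := by
    simp only [synth, b, sq]
  have hab : ∑ j, a j ^ 2 = ∑ j, b j ^ 2 := by
    simp only [sq]
    rw [← integral_synth_mul_synth B a a, ← integral_synth_mul_synth B b b, ha]
    exact integral_comp_rot e ((continuous_synth B b).mul (continuous_synth B b))
  have hcs : (∑ j, b j ^ 2) ^ 2 ≤ (∑ j, b j ^ 2) * ∑ j : Idx d L, B.Y j.1 j.2 x ^ 2 := by
    rw [← hab]
    conv_lhs => rw [hab, ← hb, ← congrFun ha x]
    exact Finset.sum_mul_sq_le_sq_mul_sq _ _ _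
  change ∑ j, b j ^ 2 ≤ _
  have h0 : 0 ≤ ∑ j, b j ^ 2 := Finset.sum_nonneg fun j _ => sq_nonneg _
  rcases h0.eq_or_lt with h | h
  · rw [← h]
    exact Finset.sum_nonneg fun j _ => sq_nonneg _
  · rw [sq] at hcs
    exact le_of_mul_le_mul_left hcs h

/-- The addition theorem on the diagonal, summed over degrees. -/
theorem sum_Y_sq (B : HarmonicBasis d) (L : ℕ) (x : Sph d) :
    ∑ j : Idx d L, B.Y j.1 j.2 x ^ 2 = Fintype.card (Idx d L) := by
  have h1 : ∫ y, ∑ j : Idx d L, B.Y j.1 j.2 y ^ 2 ∂(unif d)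
      = ∑ j : Idx d L, B.Y j.1 j.2 x ^ 2 := by
    rw [integral_congr_ae (g := fun _ => ∑ j : Idx d L, B.Y j.1 j.2 x ^ 2)
      (ae_of_all _ fun y => le_antisymm (sum_Y_sq_le B x y) (sum_Y_sq_le B y x))]
    simp
  rw [← h1]
  simp only [sq]
  rw [integral_finsetSum _ fun j _ =>
    integrable_mul_of_continuous (continuous_Y B _ _) (continuous_Y B _ _)]
  simp [integral_Y_mul_Y]

end Rotation

/-! ### Counting the retained modes. -/

section Dimension

variable {d : ℕ}

/-- The monomial `x₀ ^ s * ∏ x_{i+1} ^ b_i` on the sphere. -/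
def sphMonomial (s : ℕ) (b : Fin d → ℕ) (x : Sph d) : ℝ :=
  x.1 0 ^ s * ∏ i : Fin d, x.1 i.succ ^ b i

/-- The monomials of degree at most one in `x₀` and at most `L` in each other variable. -/
def reducedMonomials (d L : ℕ) (k : Fin 2 × (Fin d → Fin (L + 1))) : Sph d → ℝ :=
  sphMonomial k.1 (fun i => k.2 i)

theorem sphMonomial_mem (L : ℕ) (s : ℕ) (b : Fin d → ℕ) (h : s + ∑ i, b i ≤ L) :
    sphMonomial s b ∈ Submodule.span ℝ (Set.range (reducedMonomials d L)) := by
  classical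
  induction s using Nat.strong_induction_on generalizing b with
  | _ s ih =>
    by_cases hs : s < 2
    · have hb : ∀ i, b i < L + 1 := fun i => by
        have := Finset.single_le_sum (f := b) (fun _ _ => Nat.zero_le _) (Finset.mem_univ i)
        omega
      exact Submodule.subset_span ⟨(⟨s, hs⟩, fun i => ⟨b i, hb i⟩), rfl⟩
    · obtain ⟨c, rfl⟩ : ∃ c, s = c + 2 := ⟨s - 2, by omega⟩
      -- On the sphere `x₀² = 1 - ∑ x_{i+1}²`. The substitution lowers the power of `x₀` by two
      -- without raising the total degree.
      have hdec : sphMonomial (c + 2) b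
          = sphMonomial c b - ∑ i, sphMonomial c (b + Pi.single i 2) := by
        ext x
        have hx := sum_sq_eq_one x
        rw [Fin.sum_univ_succ] at hx
        have hm : ∀ i, sphMonomial c (b + Pi.single i 2) x
            = x.1 i.succ ^ 2 * sphMonomial c b x := by
          intro i
          simp only [sphMonomial, Pi.add_apply, pow_add, Finset.prod_mul_distrib]
          have : ∏ k : Fin d, x.1 k.succ ^ ((Pi.single i 2 : Fin d → ℕ) k) = x.1 i.succ ^ 2 := by
            rw [Finset.prod_eq_single i]
            · simp
            · intro k _ hk
              simp [Pi.single_eq_of_ne hk]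
            · simp
          rw [this]
          ring
        simp only [Pi.sub_apply, Finset.sum_apply, hm, ← Finset.sum_mul]
        have h2 : sphMonomial (c + 2) b x = x.1 0 ^ 2 * sphMonomial c b x := by
          simp only [sphMonomial]
          ring
        rw [h2]
        linear_combination (sphMonomial c b x) * hx
      rw [hdec]
      refine Submodule.sub_mem _ (ih c (by omega) b (by omega))
        (Submodule.sum_mem _ fun i _ => ih c (by omega) _ ?_)
      simp only [Pi.add_apply, Finset.sum_add_distrib, Finset.sum_pi_single', Finset.mem_univ,
        if_true]
      omega

theorem harmonicSpan_le_span_reducedMonomials (d L : ℕ) :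
    harmonicSpan d L ≤ Submodule.span ℝ (Set.range (reducedMonomials d L)) := by
  rw [harmonicSpan, Submodule.span_le]
  rintro f ⟨k, hk, hf⟩
  obtain ⟨p, hp, -, rfl⟩ := mem_sphericalHarmonics_iff.mp hf
  have h : restr d p = ∑ a ∈ p.support, p.coeff a • sphMonomial (a 0) (fun i => a i.succ) := by
    ext x
    rw [restr_apply, MvPolynomial.eval_eq']
    simp [sphMonomial, Fin.prod_univ_succ]
  rw [h]
  refine Submodule.sum_mem _ fun a ha => Submodule.smul_mem _ _ (sphMonomial_mem L _ _ ?_)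
  have hdeg : ∑ i, a i = k := by
    have := hp (MvPolynomial.mem_support_iff.mp ha)
    rw [Finsupp.weight_apply, Finsupp.sum_fintype _ _ (by simp)] at this
    simpa using this
  rw [← Fin.sum_univ_succ, hdeg]
  exact hk

/-- The basis functions are independent and lie in the span of `2 (L+1)^d` monomials. Only the order
`L^d` matters for the rates. -/
theorem card_Idx_le (B : HarmonicBasis d) (L : ℕ) :
    Fintype.card (Idx d L) ≤ 2 * (L + 1) ^ d := by
  have hli := linearIndependent_of_orthonormal (g := fun j : Idx d L => B.Y j.1 j.2)
    (fun j => continuous_Y B _ _) (fun i j => integral_Y_mul_Y B i j)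
  have h1 : Submodule.span ℝ (Set.range fun j : Idx d L => B.Y j.1 j.2)
      ≤ Submodule.span ℝ (Set.range (reducedMonomials d L)) := by
    rw [Submodule.span_le]
    rintro _ ⟨j, rfl⟩
    exact harmonicSpan_le_span_reducedMonomials d L (Y_mem_harmonicSpan B j)
  have hfd : FiniteDimensional ℝ (Submodule.span ℝ (Set.range (reducedMonomials d L))) :=
    FiniteDimensional.span_of_finite ℝ (Set.finite_range _)
  have h2 := Submodule.finrank_mono h1
  rw [finrank_span_eq_card hli] at h2
  refine h2.trans ((finrank_range_le_card _).trans ?_)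
  simp

end Dimension

end SphereMatern

namespace SphereMatern

/-! ### Completeness of the harmonics and truncation error. -/

section Approximation

variable {d : ℕ}

theorem memLp_of_continuous {f : Sph d → ℝ} (hf : Continuous f) (p : ℝ≥0∞) :
    MemLp f p (unif d) := by
  obtain ⟨C, hC⟩ := isCompact_univ.exists_bound_of_continuousOn hf.continuousOn
  exact MemLp.of_bound hf.aestronglyMeasurable C (ae_of_all _ fun x => hC x (Set.mem_univ x))

/-- The vector of the harmonic coefficients of degree at most `L`. -/
noncomputable def coeffVec (B : HarmonicBasis d) (f : Sph d → ℝ) (L : ℕ) : Idx d L → ℝ :=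
  fun j => coeff B f j.1 j.2

theorem integral_mul_synth (B : HarmonicBasis d) {f : Sph d → ℝ} (hf : MemLp f 2 (unif d))
    {L : ℕ} (a : Idx d L → ℝ) :
    ∫ x, f x * synth B a x ∂(unif d) = ∑ j, a j * coeffVec B f L j := by
  have hi : ∀ j : Idx d L, Integrable (fun x => a j * (f x * B.Y j.1 j.2 x)) (unif d) := fun j =>
    (hf.integrable_mul (memLp_of_continuous (continuous_Y B _ _) 2)).const_mul _
  have h : ∀ x, f x * synth B a x = ∑ j, a j * (f x * B.Y j.1 j.2 x) := fun x => by
    simp only [synth, Finset.mul_sum]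
    exact Finset.sum_congr rfl fun j _ => by ring
  simp only [h]
  rw [integral_finsetSum _ fun j _ => hi j]
  simp only [integral_const_mul]
  rfl

/-- Pythagoras: the squared error is the truncation error plus the squared distance of the
coefficient vectors. It also yields Bessel's inequality and the reduction of posterior balls to
coefficient balls. -/
theorem integral_sub_synth_sq (B : HarmonicBasis d) {f : Sph d → ℝ} (hf : MemLp f 2 (unif d))
    {L : ℕ} (a : Idx d L → ℝ) :
    ∫ x, (f x - synth B a x) ^ 2 ∂(unif d)
      = ∫ x, f x ^ 2 ∂(unif d) - ∑ j, coeffVec B f L j ^ 2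
        + ∑ j, (a j - coeffVec B f L j) ^ 2 := by
  have hs := memLp_of_continuous (continuous_synth B a) 2
  have h : ∀ x, (f x - synth B a x) ^ 2
      = (f x ^ 2 - 2 * (f x * synth B a x)) + synth B a x * synth B a x := fun x => by ring
  have i1 := hf.integrable_sq
  have i2 : Integrable (fun x => 2 * (f x * synth B a x)) (unif d) :=
    (hf.integrable_mul hs).const_mul 2
  have i3 : Integrable (fun x => synth B a x * synth B a x) (unif d) := hs.integrable_mul hs
  have i4 : Integrable (fun x => f x ^ 2 - 2 * (f x * synth B a x)) (unif d) := i1.sub i2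
  simp only [h]
  rw [integral_add i4 i3, integral_sub i1 i2, integral_const_mul,
    integral_mul_synth B hf, integral_synth_mul_synth, Finset.mul_sum, sub_add, sub_add,
    ← Finset.sum_sub_distrib, ← Finset.sum_sub_distrib]
  congr 1
  exact Finset.sum_congr rfl fun j _ => by ring

/-- Stone–Weierstrass for the algebra generated by the coordinate functions. -/
theorem exists_restr_near {g : Sph d → ℝ} (hg : Continuous g) {ε : ℝ} (hε : 0 < ε) :
    ∃ p : MvPolynomial (Fin (d + 1)) ℝ, ∀ x, |restr d p x - g x| < ε := by
  let coord : Fin (d + 1) → C(Sph d, ℝ) := fun i => ⟨fun x => x.1 i, by fun_prop⟩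
  let A : Subalgebra ℝ C(Sph d, ℝ) := (MvPolynomial.aeval coord).range
  have hA : A.SeparatesPoints := by
    intro x y hxy
    have : ∃ i, x.1 i ≠ y.1 i := by
      by_contra! h
      exact hxy (Subtype.ext (by ext i; exact h i))
    obtain ⟨i, hi⟩ := this
    exact ⟨coord i, ⟨coord i, ⟨MvPolynomial.X i, by simp⟩, rfl⟩, hi⟩
  obtain ⟨⟨_, p, rfl⟩, hq⟩ :=
    ContinuousMap.exists_mem_subalgebra_near_continuous_of_separatesPoints A hA g hg ε hε
  refine ⟨p, fun x => ?_⟩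
  have h := hq x
  have hev : (MvPolynomial.aeval coord p : C(Sph d, ℝ)) x = restr d p x := by
    rw [restr_apply]
    clear hq h
    induction p using MvPolynomial.induction_on with
    | C c => simp
    | add p q hp hq => simp [hp, hq]
    | mul_X p i hp => simp [hp, coord]
  rw [← hev]
  exact h

theorem restr_mem_of_totalDegree (p : MvPolynomial (Fin (d + 1)) ℝ) :
    restr d p ∈ harmonicSpan d p.totalDegree := by
  have h : restr d p = ∑ i ∈ Finset.range (p.totalDegree + 1),
      restr d (MvPolynomial.homogeneousComponent i p) := by
    rw [← map_sum, MvPolynomial.sum_homogeneousComponent]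
  rw [h]
  refine Submodule.sum_mem _ fun i hi => ?_
  exact harmonicSpan_mono (by simpa [Nat.lt_succ_iff] using hi)
    (restr_mem_harmonicSpan (MvPolynomial.homogeneousComponent_isHomogeneous i p))

theorem eLpNorm_two_le_iff {Ω : Type*} [MeasurableSpace Ω] {μ : Measure Ω} {f : Ω → ℝ}
    (hf : MemLp f 2 μ) {r : ℝ} (hr : 0 ≤ r) :
    eLpNorm f 2 μ ≤ ENNReal.ofReal r ↔ ∫ x, f x ^ 2 ∂μ ≤ r ^ 2 := by
  rw [hf.eLpNorm_eq_integral_rpow_norm (by norm_num) (by norm_num),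
    ENNReal.ofReal_le_ofReal_iff hr]
  have h : ∀ x, ‖f x‖ ^ (2 : ℝ≥0∞).toReal = f x ^ 2 := fun x => by
    rw [ENNReal.toReal_ofNat, Real.rpow_ofNat, Real.norm_eq_abs, sq_abs]
  simp only [h]
  rw [ENNReal.toReal_ofNat]
  have h0 : 0 ≤ ∫ x, f x ^ 2 ∂μ := integral_nonneg fun x => sq_nonneg _
  rw [show (2 : ℝ)⁻¹ = 1 / 2 by norm_num, ← Real.sqrt_eq_rpow, Real.sqrt_le_left hr]

/-- Completeness of the spherical harmonics in `L²`. -/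
theorem exists_integral_sub_synth_sq_le (B : HarmonicBasis d) {f : Sph d → ℝ}
    (hf : MemLp f 2 (unif d)) {ε : ℝ} (hε : 0 < ε) :
    ∃ L, ∃ a : Idx d L → ℝ, ∫ x, (f x - synth B a x) ^ 2 ∂(unif d) ≤ ε := by
  have hδ : 0 < Real.sqrt ε / 2 := by positivity
  obtain ⟨g, hg, -⟩ := hf.exists_boundedContinuous_eLpNorm_sub_le (by norm_num)
    (ε := ENNReal.ofReal (Real.sqrt ε / 2)) (by simpa using hε)
  obtain ⟨p, hp⟩ := exists_restr_near g.continuous hδ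
  obtain ⟨a, ha⟩ := exists_synth_eq B (restr_mem_of_totalDegree p)
  refine ⟨_, a, ?_⟩
  have hm : MemLp (fun x => f x - synth B a x) 2 (unif d) :=
    hf.sub (memLp_of_continuous (continuous_synth B a) 2)
  rw [← Real.sq_sqrt hε.le, ← eLpNorm_two_le_iff hm (Real.sqrt_nonneg _)]
  have h1 : (fun x => f x - synth B a x) = (f - ⇑g) + (fun x => g x - synth B a x) := by
    ext x
    simp
  have hgm : MemLp (fun x => g x - synth B a x) 2 (unif d) :=
    memLp_of_continuous (g.continuous.sub (continuous_synth B a)) 2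
  have h2 : eLpNorm (fun x => g x - synth B a x) 2 (unif d)
      ≤ ENNReal.ofReal (Real.sqrt ε / 2) := by
    rw [eLpNorm_two_le_iff hgm hδ.le]
    refine (integral_mono hgm.integrable_sq (integrable_const ((Real.sqrt ε / 2) ^ 2))
      fun x => ?_).trans (by simp)
    have := hp x
    rw [← ha, abs_sub_comm] at this
    exact sq_le_sq' (by linarith [neg_abs_le (g x - synth B a x)])
      (by linarith [le_abs_self (g x - synth B a x)])
  rw [h1]
  refine (eLpNorm_add_le (hf.sub (memLp_of_continuous g.continuous 2)).1 hgm.1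
    (by norm_num)).trans ((add_le_add hg h2).trans_eq ?_)
  rw [← ENNReal.ofReal_add hδ.le hδ.le, add_halves]

theorem sum_coeffVec (B : HarmonicBasis d) (f : Sph d → ℝ) (L : ℕ) (w : ℕ → ℝ) :
    ∑ j : Idx d L, w j.1 * coeffVec B f L j ^ 2
      = ∑ ℓ ∈ Finset.range (L + 1), w ℓ * ∑ m, coeff B f ℓ m ^ 2 := by
  rw [Fintype.sum_sigma, ← Fin.sum_univ_eq_sum_range]
  exact Finset.sum_congr rfl fun ℓ _ => by rw [Finset.mul_sum]; rfl

theorem lam_nonneg (hd : 1 ≤ d) (ℓ : ℕ) : 0 ≤ lam d ℓ := by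
  have : (1 : ℝ) ≤ d := by exact_mod_cast hd
  have h0 : (0 : ℝ) ≤ ℓ := ℓ.cast_nonneg
  exact mul_nonneg h0 (by linarith)

theorem sq_le_lam (hd : 1 ≤ d) (ℓ : ℕ) : (ℓ : ℝ) ^ 2 ≤ lam d ℓ := by
  have : (1 : ℝ) ≤ d := by exact_mod_cast hd
  have h0 : (0 : ℝ) ≤ ℓ := ℓ.cast_nonneg
  rw [lam]
  nlinarith

theorem lam_mono (hd : 1 ≤ d) {k ℓ : ℕ} (h : k ≤ ℓ) : lam d k ≤ lam d ℓ := by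
  have : (1 : ℝ) ≤ d := by exact_mod_cast hd
  have h0 : (0 : ℝ) ≤ k := k.cast_nonneg
  have h1 : (k : ℝ) ≤ ℓ := by exact_mod_cast h
  exact mul_le_mul h1 (by linarith) (by linarith) (by linarith)

/-- The squared Sobolev norm. -/
noncomputable def sobolevSq (B : HarmonicBasis d) (β : ℝ) (f : Sph d → ℝ) : ℝ :=
  ∑' ℓ : ℕ, (1 + lam d ℓ) ^ β * ∑ m, coeff B f ℓ m ^ 2

theorem sobolev_term_nonneg (hd : 1 ≤ d) (B : HarmonicBasis d) (β : ℝ) (f : Sph d → ℝ) (ℓ : ℕ) :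
    0 ≤ (1 + lam d ℓ) ^ β * ∑ m, coeff B f ℓ m ^ 2 :=
  mul_nonneg (Real.rpow_nonneg (by linarith [lam_nonneg hd ℓ]) _)
    (Finset.sum_nonneg fun m _ => sq_nonneg _)

theorem sobolevSq_nonneg (hd : 1 ≤ d) (B : HarmonicBasis d) (β : ℝ) (f : Sph d → ℝ) :
    0 ≤ sobolevSq B β f := tsum_nonneg fun ℓ => sobolev_term_nonneg hd B β f ℓ

theorem sum_weighted_coeffVec_le (hd : 1 ≤ d) (B : HarmonicBasis d) {β : ℝ} {f : Sph d → ℝ}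
    (hf : InSobolev B β f) (L : ℕ) :
    ∑ j : Idx d L, (1 + lam d j.1) ^ β * coeffVec B f L j ^ 2 ≤ sobolevSq B β f := by
  rw [sum_coeffVec B f L fun ℓ => (1 + lam d ℓ) ^ β]
  exact hf.2.sum_le_tsum _ fun ℓ _ => sobolev_term_nonneg hd B β f ℓ

/-- The truncation error of a Sobolev function. -/
theorem integral_truncation_sq_le (hd : 1 ≤ d) (B : HarmonicBasis d) {β : ℝ} (hβ : 0 < β)
    {f : Sph d → ℝ} (hf : InSobolev B β f) (L : ℕ) :
    ∫ x, (f x - synth B (coeffVec B f L) x) ^ 2 ∂(unif d)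
      ≤ (((L : ℝ) + 1) ^ 2) ^ (-β) * sobolevSq B β f := by
  refine le_of_forall_pos_le_add fun ε hε => ?_
  -- Completeness supplies some degree `L₁`, unrelated to `L`, at which the error is at most `ε`.
  -- The energy between `L` and `max L L₁` is then bounded by the Sobolev sum.
  obtain ⟨L₁, a, ha⟩ := exists_integral_sub_synth_sq_le B hf.1 hε
  rw [integral_sub_synth_sq B hf.1] at ha ⊢
  have hs := fun L => sum_coeffVec B f L fun _ => 1
  simp only [one_mul] at hs
  rw [hs] at ha ⊢
  have h0 : 0 ≤ ∑ j, (a j - coeffVec B f L₁ j) ^ 2 := Finset.sum_nonneg fun j _ => sq_nonneg _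
  let t : ℕ → ℝ := fun ℓ => ∑ m, coeff B f ℓ m ^ 2
  have ht : ∀ ℓ, 0 ≤ t ℓ := fun ℓ => Finset.sum_nonneg fun m _ => sq_nonneg _
  let K := max L L₁
  have h1 : ∑ ℓ ∈ Finset.range (L₁ + 1), t ℓ ≤ ∑ ℓ ∈ Finset.range (K + 1), t ℓ :=
    Finset.sum_le_sum_of_subset_of_nonneg (Finset.range_mono (by omega)) fun ℓ _ _ => ht ℓ
  have h2 : ∑ ℓ ∈ Finset.range (K + 1), t ℓ = ∑ ℓ ∈ Finset.range (L + 1), t ℓ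
      + ∑ ℓ ∈ Finset.Ico (L + 1) (K + 1), t ℓ :=
    (Finset.sum_range_add_sum_Ico _ (by omega)).symm
  have h3 : ∑ ℓ ∈ Finset.Ico (L + 1) (K + 1), t ℓ
      ≤ (((L : ℝ) + 1) ^ 2) ^ (-β) * sobolevSq B β f := by
    have hw : ∀ ℓ ∈ Finset.Ico (L + 1) (K + 1),
        t ℓ ≤ (((L : ℝ) + 1) ^ 2) ^ (-β) * ((1 + lam d ℓ) ^ β * t ℓ) := by
      intro ℓ hℓ
      rw [Finset.mem_Ico] at hℓ
      have hL0 : (0 : ℝ) ≤ L := L.cast_nonneg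
      have hpos : (0 : ℝ) < ((L : ℝ) + 1) ^ 2 := by positivity
      -- The first discarded degree is `L + 1`, and `ℓ² ≤ λ_ℓ`.
      have hLℓ : ((L : ℝ) + 1) ^ 2 ≤ 1 + lam d ℓ := by
        have h4 : (L : ℝ) + 1 ≤ ℓ := by exact_mod_cast hℓ.1
        have h5 := sq_le_lam hd ℓ
        nlinarith
      have h6 := Real.rpow_le_rpow hpos.le hLℓ hβ.le
      have h7 : (((L : ℝ) + 1) ^ 2) ^ (-β) * (((L : ℝ) + 1) ^ 2) ^ β = 1 := by
        rw [← Real.rpow_add hpos, neg_add_cancel, Real.rpow_zero]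
      rw [← mul_assoc]
      refine le_mul_of_one_le_left (ht ℓ) ?_
      refine h7.symm.le.trans ?_
      exact mul_le_mul_of_nonneg_left h6 (Real.rpow_nonneg hpos.le _)
    refine (Finset.sum_le_sum hw).trans ?_
    rw [← Finset.mul_sum]
    refine mul_le_mul_of_nonneg_left ?_ (Real.rpow_nonneg (by positivity) _)
    exact hf.2.sum_le_tsum _ fun ℓ _ => sobolev_term_nonneg hd B β f ℓ
  have h4 : ∑ j, (coeffVec B f L j - coeffVec B f L j) ^ 2 = 0 := by simp
  rw [h4]
  change _ - ∑ ℓ ∈ Finset.range (L + 1), t ℓ + 0 ≤ _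
  change _ - ∑ ℓ ∈ Finset.range (L₁ + 1), t ℓ + _ ≤ _ at ha
  linarith

end Approximation

end SphereMatern

namespace SphereMatern

/-! ### Tail bound for densities with a quadratic exponent. -/

section Posterior

variable {ι : Type*} [Fintype ι]

theorem pi_withDensity_ofReal {g : ι → ℝ → ℝ} (hg : ∀ i x, 0 ≤ g i x)
    (hi : ∀ i, Integrable (g i)) :
    Measure.pi (fun i => (volume : Measure ℝ).withDensity fun x => ENNReal.ofReal (g i x))
      = (volume : Measure (ι → ℝ)).withDensity fun x => ∏ i, ENNReal.ofReal (g i (x i)) := by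
  have hfin : ∀ i, IsFiniteMeasure
      ((volume : Measure ℝ).withDensity fun x => ENNReal.ofReal (g i x)) := fun i =>
    isFiniteMeasure_withDensity_ofReal (hi i).2
  refine Measure.pi_eq fun s hs => ?_
  rw [withDensity_apply _ (MeasurableSet.univ_pi hs), volume_pi, Measure.restrict_pi_pi]
  have h1 : ∀ x : ι → ℝ, ∏ i, ENNReal.ofReal (g i (x i)) = ENNReal.ofReal (∏ i, g i (x i)) :=
    fun x => (ENNReal.ofReal_prod_of_nonneg fun i _ => hg i _).symm
  simp only [h1]
  rw [← ofReal_integral_eq_lintegral_ofReal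
    (Integrable.fintype_prod fun i => (hi i).restrict)
    (ae_of_all _ fun x => Finset.prod_nonneg fun i _ => hg i _),
    integral_fintype_prod_eq_prod g, ENNReal.ofReal_prod_of_nonneg
    fun i _ => integral_nonneg fun x => hg i x]
  refine Finset.prod_congr rfl fun i _ => ?_
  rw [withDensity_apply _ (hs i), ofReal_integral_eq_lintegral_ofReal (hi i).restrict
    (ae_of_all _ fun x => hg i x)]

theorem lintegral_comp_smul_pi {F : (ι → ℝ) → ℝ≥0∞} (hF : Measurable F) {s : ℝ} (hs : 0 < s) :
    ∫⁻ b, F (s • b) = ENNReal.ofReal ((s ^ Fintype.card ι)⁻¹) * ∫⁻ b, F b := by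
  have h := Measure.map_addHaar_smul (volume : Measure (ι → ℝ)) hs.ne'
  rw [Module.finrank_fintype_fun_eq_card, abs_of_pos (by positivity)] at h
  rw [← lintegral_map hF (measurable_const_smul s), h, lintegral_smul_measure, smul_eq_mul]

/-- An inequality in `ℝ≥0∞` suffices, so the evidence may even be zero or infinite. -/
theorem bayes_apply_le_one {Θ : Type*} [MeasurableSpace Θ] (P : Measure Θ) [SFinite P]
    (lik : Θ → ℝ≥0∞) (s : Set Θ) : bayes P lik s ≤ 1 := by
  rw [bayes, Measure.smul_apply, smul_eq_mul, withDensity_apply']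
  exact (mul_le_mul_right (setLIntegral_le_lintegral _ _) _).trans (ENNReal.inv_mul_le_one _)

/-- On the tail the linear term is absorbed by half of the quadratic one, leaving `exp (-q/4)` and
the small factor. Since `q/4` is `q(b/√2)/2`, rescaling costs `√2` per dimension. Symmetrization
puts the linear term back into the normalizing integral. -/
theorem lintegral_gibbs_tail_le {q : (ι → ℝ) → ℝ} (hqm : Measurable q)
    (hscale : ∀ (s : ℝ) b, q (s • b) = s ^ 2 * q b) {A r : ℝ} (hA : 0 < A)
    (hqA : ∀ b, A * ∑ j, b j ^ 2 ≤ q b) {g : ι → ℝ} (hg : ∑ j, g j ^ 2 ≤ (A * r / 8) ^ 2) :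
    ∫⁻ b in {b : ι → ℝ | r ^ 2 < ∑ j, b j ^ 2},
        ENNReal.ofReal (Real.exp (-q b / 2 + ∑ j, g j * b j))
      ≤ ENNReal.ofReal (Real.sqrt 2 ^ Fintype.card ι * Real.exp (-(A * r ^ 2 / 8))) *
        ∫⁻ b, ENNReal.ofReal (Real.exp (-q b / 2 + ∑ j, g j * b j)) := by
  have hS : MeasurableSet {b : ι → ℝ | r ^ 2 < ∑ j, b j ^ 2} :=
    measurableSet_lt measurable_const (by fun_prop)
  have hG : Measurable fun b : ι → ℝ => ENNReal.ofReal (Real.exp (-q b / 2)) := by fun_prop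
  have hF : Measurable fun b : ι → ℝ =>
    ENNReal.ofReal (Real.exp (-q b / 2 + ∑ j, g j * b j)) := by fun_prop
  have h1 : ∫⁻ b in {b : ι → ℝ | r ^ 2 < ∑ j, b j ^ 2},
        ENNReal.ofReal (Real.exp (-q b / 2 + ∑ j, g j * b j))
      ≤ ENNReal.ofReal (Real.exp (-(A * r ^ 2 / 8))) *
        ∫⁻ b, ENNReal.ofReal (Real.exp (-q ((Real.sqrt 2)⁻¹ • b) / 2)) := by
    have hG' : Measurable fun b : ι → ℝ =>
        ENNReal.ofReal (Real.exp (-q ((Real.sqrt 2)⁻¹ • b) / 2)) :=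
      hG.comp (measurable_const_smul _)
    rw [← lintegral_const_mul _ hG']
    refine (setLIntegral_mono' hS fun b hb => ?_).trans (setLIntegral_le_lintegral _ _)
    rw [← ENNReal.ofReal_mul (Real.exp_pos _).le, ← Real.exp_add, hscale, inv_pow,
      Real.sq_sqrt zero_le_two]
    refine ENNReal.ofReal_le_ofReal (Real.exp_le_exp.mpr ?_)
    have hb' : r ^ 2 < ∑ j, b j ^ 2 := hb
    set t := ∑ j, b j ^ 2 with ht
    have ht0 : 0 ≤ t := (sq_nonneg r).trans hb'.le
    -- Where `|b| > r`, one has `|⟨g, b⟩| ≤ (A r / 8)|b| ≤ A|b|²/8`, while `q/4 ≥ A|b|²/4`; a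
    -- surplus of `A r²/8` remains.
    have hcs : (∑ j, g j * b j) ^ 2 ≤ (A * t / 8) ^ 2 := by
      refine (Finset.sum_mul_sq_le_sq_mul_sq _ _ _).trans
        ((mul_le_mul_of_nonneg_right hg ht0).trans ?_)
      have : (A * r / 8) ^ 2 * t = (A / 8) ^ 2 * t * r ^ 2 := by ring
      rw [this, show (A * t / 8) ^ 2 = (A / 8) ^ 2 * t * t by ring]
      exact mul_le_mul_of_nonneg_left hb'.le (by positivity)
    have h2 := abs_le_of_sq_le_sq hcs (by positivity)
    have h3 := hqA b
    rw [← ht] at h3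
    nlinarith [(abs_le.mp h2).2, mul_lt_mul_of_pos_left hb' hA]
  have hsc := lintegral_comp_smul_pi hG (s := (Real.sqrt 2)⁻¹) (by positivity)
  rw [hsc] at h1
  -- As `q` is even, averaging over `b` and `-b` replaces `exp ⟨g, b⟩` by a hyperbolic cosine, which
  -- is at least one.
  have h2 : ∫⁻ b, ENNReal.ofReal (Real.exp (-q b / 2))
      ≤ ∫⁻ b, ENNReal.ofReal (Real.exp (-q b / 2 + ∑ j, g j * b j)) := by
    have hneg : ∀ b, q (-b) = q b := fun b => by
      have := hscale (-1) b
      simpa using this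
    have h3 : ∫⁻ b, ENNReal.ofReal (Real.exp (-q b / 2 + ∑ j, g j * b j))
        = ∫⁻ b, ENNReal.ofReal (Real.exp (-q b / 2 - ∑ j, g j * b j)) := by
      rw [← lintegral_neg_eq_self]
      refine lintegral_congr fun b => ?_
      simp [hneg, sub_eq_add_neg]
    have h4 : 2 * ∫⁻ b, ENNReal.ofReal (Real.exp (-q b / 2))
        ≤ 2 * ∫⁻ b, ENNReal.ofReal (Real.exp (-q b / 2 + ∑ j, g j * b j)) := by
      conv_rhs => rw [two_mul]
      conv_rhs => arg 2; rw [h3]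
      rw [← lintegral_add_left hF, ← lintegral_const_mul _ hG]
      refine lintegral_mono fun b => ?_
      rw [← ENNReal.ofReal_add (Real.exp_pos _).le (Real.exp_pos _).le,
        show (2 : ℝ≥0∞) = ENNReal.ofReal 2 by simp, ← ENNReal.ofReal_mul zero_le_two]
      refine ENNReal.ofReal_le_ofReal ?_
      rw [sub_eq_add_neg, Real.exp_add, Real.exp_add, ← mul_add, mul_comm]
      refine mul_le_mul_of_nonneg_left ?_ (Real.exp_pos _).le
      have := Real.one_le_cosh (∑ j, g j * b j)
      rw [Real.cosh_eq] at this
      linarith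
    exact (ENNReal.mul_le_mul_iff_right (by simp) (by simp)).mp h4
  refine h1.trans ?_
  rw [← mul_assoc, ← ENNReal.ofReal_mul (Real.exp_pos _).le, inv_pow, inv_inv, mul_comm (Real.exp _)]
  exact mul_le_mul_right h2 _

/-- Translation by `a₀` and cancellation of the constant `c`, which may be any element of `ℝ≥0∞`
since only `x⁻¹ * x ≤ 1` is used. -/
theorem bayes_tail_le {p lik : (ι → ℝ) → ℝ≥0∞} (hp : Measurable p) (hlik : Measurable lik)
    {a₀ : ι → ℝ} {c : ℝ≥0∞} {q : (ι → ℝ) → ℝ} (hqm : Measurable q)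
    (hscale : ∀ (s : ℝ) b, q (s • b) = s ^ 2 * q b) {A r : ℝ} (hA : 0 < A)
    (hqA : ∀ b, A * ∑ j, b j ^ 2 ≤ q b) {g : ι → ℝ} (hg : ∑ j, g j ^ 2 ≤ (A * r / 8) ^ 2)
    (hdens : ∀ b, p (a₀ + b) * lik (a₀ + b)
      = c * ENNReal.ofReal (Real.exp (-q b / 2 + ∑ j, g j * b j))) :
    bayes (volume.withDensity p) lik {a | r ^ 2 < ∑ j, (a j - a₀ j) ^ 2}
      ≤ ENNReal.ofReal (Real.sqrt 2 ^ Fintype.card ι * Real.exp (-(A * r ^ 2 / 8))) := by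
  have hF : Measurable fun b : ι → ℝ =>
    ENNReal.ofReal (Real.exp (-q b / 2 + ∑ j, g j * b j)) := by fun_prop
  have hS : MeasurableSet {b : ι → ℝ | r ^ 2 < ∑ j, b j ^ 2} :=
    measurableSet_lt measurable_const (by fun_prop)
  have hS' : MeasurableSet {a : ι → ℝ | r ^ 2 < ∑ j, (a j - a₀ j) ^ 2} :=
    measurableSet_lt measurable_const (by fun_prop)
  have hZ : ∫⁻ a, lik a ∂(volume.withDensity p)
      = c * ∫⁻ b, ENNReal.ofReal (Real.exp (-q b / 2 + ∑ j, g j * b j)) := by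
    rw [lintegral_withDensity_eq_lintegral_mul _ hp hlik, ← lintegral_const_mul _ hF,
      ← lintegral_add_left_eq_self _ a₀]
    exact lintegral_congr fun b => hdens b
  have hN : ((volume.withDensity p).withDensity lik) {a | r ^ 2 < ∑ j, (a j - a₀ j) ^ 2}
      = c * ∫⁻ b in {b : ι → ℝ | r ^ 2 < ∑ j, b j ^ 2},
        ENNReal.ofReal (Real.exp (-q b / 2 + ∑ j, g j * b j)) := by
    rw [← withDensity_mul _ hp hlik, withDensity_apply _ hS', ← lintegral_const_mul _ hF,
      ← lintegral_indicator hS', ← lintegral_indicator hS, ← lintegral_add_left_eq_self _ a₀]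
    refine lintegral_congr fun b => ?_
    by_cases hb : r ^ 2 < ∑ j, b j ^ 2
    · rw [Set.indicator_of_mem (by simpa using hb), Set.indicator_of_mem (by simpa using hb)]
      exact hdens b
    · rw [Set.indicator_of_notMem (by simpa using hb), Set.indicator_of_notMem (by simpa using hb)]
  rw [bayes, Measure.smul_apply, smul_eq_mul, hN, hZ]
  set δ := ENNReal.ofReal (Real.sqrt 2 ^ Fintype.card ι * Real.exp (-(A * r ^ 2 / 8)))
  set Z := ∫⁻ b, ENNReal.ofReal (Real.exp (-q b / 2 + ∑ j, g j * b j))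
  calc _ ≤ (c * Z)⁻¹ * (c * (δ * Z)) := by
        gcongr
        exact lintegral_gibbs_tail_le hqm hscale hA hqA hg
    _ = δ * ((c * Z)⁻¹ * (c * Z)) := by ring
    _ ≤ δ * 1 := by
        gcongr
        exact ENNReal.inv_mul_le_one _
    _ = δ := mul_one δ

theorem prod_gaussianPDF {v : ι → ℝ} (hv : ∀ i, 0 < v i) (m y : ι → ℝ) :
    ∏ i, gaussianPDF (m i) (v i).toNNReal (y i)
      = ENNReal.ofReal (∏ i, (Real.sqrt (2 * Real.pi * v i))⁻¹) *
        ENNReal.ofReal (Real.exp (∑ i, -(y i - m i) ^ 2 / (2 * v i))) := by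
  rw [← ENNReal.ofReal_mul (Finset.prod_nonneg fun i _ => by positivity), Real.exp_sum,
    ← Finset.prod_mul_distrib, ENNReal.ofReal_prod_of_nonneg fun i _ => by positivity]
  refine Finset.prod_congr rfl fun i _ => ?_
  rw [gaussianPDF, gaussianPDFReal, Real.coe_toNNReal _ (hv i).le]

theorem pi_gaussianReal_eq_withDensity {v : ι → ℝ} (hv : ∀ i, 0 < v i) :
    Measure.pi (fun i => gaussianReal 0 (v i).toNNReal)
      = (volume : Measure (ι → ℝ)).withDensity
        fun a => ∏ i, gaussianPDF 0 (v i).toNNReal (a i) := by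
  have h : ∀ i, gaussianReal 0 (v i).toNNReal
      = volume.withDensity fun x => ENNReal.ofReal (gaussianPDFReal 0 (v i).toNNReal x) :=
    fun i => gaussianReal_of_var_ne_zero _ (by simpa using hv i)
  simp only [h]
  exact pi_withDensity_ofReal (fun i x => gaussianPDFReal_nonneg _ _ _)
    (fun i => integrable_gaussianPDFReal _ _)

end Posterior

end SphereMatern

namespace SphereMatern

/-! ### Second and fourth moments of sums of i.i.d. centred vectors. -/

section Moments

/-- Peeling off one observation is how independence enters both moment bounds, each by induction on
the sample size. -/
theorem lintegral_pi_succ {Z : Type*} [MeasurableSpace Z] {ν : Measure Z}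
    [IsProbabilityMeasure ν] {n : ℕ} {F : (Fin (n + 1) → Z) → ℝ≥0∞} (hF : Measurable F) :
    ∫⁻ D, F D ∂(Measure.pi fun _ : Fin (n + 1) => ν)
      = ∫⁻ D, ∫⁻ z, F (Fin.cons z D) ∂ν ∂(Measure.pi fun _ : Fin n => ν) := by
  have h := (measurePreserving_piFinSuccAbove (fun _ : Fin (n + 1) => ν) 0).symm
  have hm : Measurable fun a =>
      F ((MeasurableEquiv.piFinSuccAbove (fun _ : Fin (n + 1) => Z) 0).symm a) :=
    hF.comp (MeasurableEquiv.measurable _)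
  rw [← h.lintegral_comp hF, lintegral_prod_symm _ hm.aemeasurable]
  refine lintegral_congr fun D => lintegral_congr fun z => ?_
  rw [← Fin.insertNth_zero']
  rfl

variable {Z ι : Type*}

/-- The coordinates of `∑ i, ξ (D i)`. -/
def partialSum (ξ : Z → ι → ℝ) {n : ℕ} (D : Fin n → Z) (j : ι) : ℝ := ∑ i, ξ (D i) j

theorem partialSum_cons (ξ : Z → ι → ℝ) {n : ℕ} (z : Z) (D : Fin n → Z) (j : ι) :
    partialSum ξ (Fin.cons z D : Fin (n + 1) → Z) j = partialSum ξ D j + ξ z j := by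
  simp [partialSum, Fin.sum_univ_succ, add_comm]

variable [MeasurableSpace Z]

theorem measurable_partialSum {ξ : Z → ι → ℝ} (hξ : ∀ j, Measurable fun z => ξ z j) {n : ℕ}
    (j : ι) : Measurable fun D : Fin n → Z => partialSum ξ D j := by
  unfold partialSum
  exact Finset.measurable_sum _ fun i _ => (hξ j).comp (measurable_pi_apply i)

variable [Fintype ι] {ν : Measure Z}

theorem integrable_sum_sq {ξ : Z → ι → ℝ} (h2 : ∀ j, MemLp (fun z => ξ z j) 2 ν) :
    Integrable (fun z => ∑ j, ξ z j ^ 2) ν :=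
  integrable_finsetSum _ fun j _ => (h2 j).integrable_sq

theorem memLp_linear {ξ : Z → ι → ℝ} (h2 : ∀ j, MemLp (fun z => ξ z j) 2 ν) (s : ι → ℝ) :
    MemLp (fun z => ∑ j, s j * ξ z j) 2 ν :=
  memLp_finsetSum _ fun j _ => (h2 j).const_mul (s j)

variable [IsProbabilityMeasure ν]

theorem integral_linear_eq_zero {ξ : Z → ι → ℝ} (h2 : ∀ j, MemLp (fun z => ξ z j) 2 ν)
    (h0 : ∀ j, ∫ z, ξ z j ∂ν = 0) (s : ι → ℝ) : ∫ z, ∑ j, s j * ξ z j ∂ν = 0 := by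
  rw [integral_finsetSum _ fun j _ => ((h2 j).integrable (by norm_num)).const_mul (s j)]
  simp [integral_const_mul, h0]

theorem sum_add_sq {ι : Type*} [Fintype ι] (s : ι → ℝ) (t : ι → ℝ) :
    ∑ j, (s j + t j) ^ 2 = ∑ j, s j ^ 2 + 2 * ∑ j, s j * t j + ∑ j, t j ^ 2 := by
  rw [Finset.mul_sum, ← Finset.sum_add_distrib, ← Finset.sum_add_distrib]
  exact Finset.sum_congr rfl fun j _ => by ring

/-- The second moment of a sum of independent centred vectors. -/
theorem lintegral_partialSum_sq_le {ξ : Z → ι → ℝ} (hξ : ∀ j, Measurable fun z => ξ z j)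
    (h2 : ∀ j, MemLp (fun z => ξ z j) 2 ν) (h0 : ∀ j, ∫ z, ξ z j ∂ν = 0) (n : ℕ) :
    ∫⁻ D, ENNReal.ofReal (∑ j, partialSum ξ D j ^ 2) ∂(Measure.pi fun _ : Fin n => ν)
      ≤ ENNReal.ofReal (n * ∫ z, ∑ j, ξ z j ^ 2 ∂ν) := by
  have hτ : 0 ≤ ∫ z, ∑ j, ξ z j ^ 2 ∂ν :=
    integral_nonneg fun z => Finset.sum_nonneg fun j _ => sq_nonneg _
  induction n with
  | zero => simp [partialSum]
  | succ n ih =>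
    have hm : ∀ n, Measurable fun D : Fin n → Z => ENNReal.ofReal (∑ j, partialSum ξ D j ^ 2) :=
      fun n => (Finset.measurable_sum _ fun j _ =>
        (measurable_partialSum hξ j).pow_const 2).ennreal_ofReal
    rw [lintegral_pi_succ (hm _)]
    have hin : ∀ D : Fin n → Z, ∫⁻ z, ENNReal.ofReal
          (∑ j, partialSum ξ (Fin.cons z D : Fin (n + 1) → Z) j ^ 2) ∂ν
        = ENNReal.ofReal (∑ j, partialSum ξ D j ^ 2)
          + ENNReal.ofReal (∫ z, ∑ j, ξ z j ^ 2 ∂ν) := by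
      intro D
      have i1 := integrable_const (μ := ν) (∑ j, partialSum ξ D j ^ 2)
      have i2 := ((memLp_linear h2 (partialSum ξ D)).integrable (by norm_num)).const_mul 2
      have i3 := integrable_sum_sq h2
      have i12 : Integrable (fun z => ∑ j, partialSum ξ D j ^ 2
        + 2 * ∑ j, partialSum ξ D j * ξ z j) ν := i1.add i2
      have i123 : Integrable (fun z => ∑ j, partialSum ξ D j ^ 2
        + 2 * ∑ j, partialSum ξ D j * ξ z j + ∑ j, ξ z j ^ 2) ν := i12.add i3
      simp only [partialSum_cons, sum_add_sq]
      rw [← ENNReal.ofReal_add (Finset.sum_nonneg fun j _ => sq_nonneg _) hτ,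
        ← ofReal_integral_eq_lintegral_ofReal i123, integral_add i12 i3,
        integral_add i1 i2, integral_const_mul, integral_linear_eq_zero h2 h0]
      · simp
      · refine ae_of_all _ fun z => ?_
        simp only [Pi.zero_apply]
        rw [← sum_add_sq]
        exact Finset.sum_nonneg fun j _ => sq_nonneg _
    simp only [hin]
    rw [lintegral_add_left (hm n)]
    simp only [lintegral_const, measure_univ, mul_one]
    refine (add_le_add_left ih _).trans_eq ?_
    rw [← ENNReal.ofReal_add (by positivity) hτ]
    congr 1
    push_cast
    ring

/-- The variance of the squared length of a sum of independent centred vectors. -/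
theorem lintegral_partialSum_sq_sub_sq_le {ξ : Z → ι → ℝ}
    (hξ : ∀ j, Measurable fun z => ξ z j)
    (h2 : ∀ j, MemLp (fun z => ξ z j) 2 ν) (h0 : ∀ j, ∫ z, ξ z j ∂ν = 0)
    (h4 : MemLp (fun z => ∑ j, ξ z j ^ 2) 2 ν) {κ : ℝ} (hκ0 : 0 ≤ κ)
    (hκ : ∀ s : ι → ℝ, ∫ z, (∑ j, s j * ξ z j) ^ 2 ∂ν ≤ κ * ∑ j, s j ^ 2) (n : ℕ) :
    ∫⁻ D, ENNReal.ofReal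
        ((∑ j, partialSum ξ D j ^ 2 - n * ∫ z, ∑ j, ξ z j ^ 2 ∂ν) ^ 2)
        ∂(Measure.pi fun _ : Fin n => ν)
      ≤ ENNReal.ofReal (4 * n ^ 2 * κ * ∫ z, ∑ j, ξ z j ^ 2 ∂ν
        + 2 * n * ∫ z, (∑ j, ξ z j ^ 2) ^ 2 ∂ν) := by
  set τ := ∫ z, ∑ j, ξ z j ^ 2 ∂ν with hτdef
  set m := ∫ z, (∑ j, ξ z j ^ 2) ^ 2 ∂ν with hmdef
  have hτ : 0 ≤ τ :=
    integral_nonneg fun z => Finset.sum_nonneg fun j _ => sq_nonneg _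
  have hm0 : 0 ≤ m := integral_nonneg fun z => sq_nonneg _
  induction n with
  | zero => simp [partialSum]
  | succ n ih =>
    have hmS : ∀ n, Measurable fun D : Fin n → Z => ∑ j, partialSum ξ D j ^ 2 :=
      fun n => Finset.measurable_sum _ fun j _ => (measurable_partialSum hξ j).pow_const 2
    have hmV : ∀ n (c : ℝ), Measurable fun D : Fin n → Z => ENNReal.ofReal
        ((∑ j, partialSum ξ D j ^ 2 - c) ^ 2) :=
      fun n c => (((hmS n).sub_const c).pow_const 2).ennreal_ofReal
    rw [lintegral_pi_succ (hmV _ _)]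
    -- With `A = |s|² - nτ`, the new centred square is `A + 2⟨s, ξ⟩ + (|ξ|² - τ)`. The terms linear
    -- in `A` integrate to zero, so one more observation costs at most `8κ|s|² + 2m`.
    have hin : ∀ D : Fin n → Z, ∫⁻ z, ENNReal.ofReal
          ((∑ j, partialSum ξ (Fin.cons z D : Fin (n + 1) → Z) j ^ 2 - (n + 1 : ℕ) * τ) ^ 2) ∂ν
        ≤ ENNReal.ofReal ((∑ j, partialSum ξ D j ^ 2 - n * τ) ^ 2)
          + (ENNReal.ofReal (8 * κ) * ENNReal.ofReal (∑ j, partialSum ξ D j ^ 2)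
            + ENNReal.ofReal (2 * m)) := by
      intro D
      set s := partialSum ξ D with hs
      set A := ∑ j, s j ^ 2 - n * τ with hA
      have hs0 : 0 ≤ ∑ j, s j ^ 2 := Finset.sum_nonneg fun j _ => sq_nonneg _
      have hl := memLp_linear h2 s
      have il : Integrable (fun z => ∑ j, s j * ξ z j) ν := hl.integrable (by norm_num)
      have il2 : Integrable (fun z => (∑ j, s j * ξ z j) ^ 2) ν := hl.integrable_sq
      have iw : Integrable (fun z => ∑ j, ξ z j ^ 2) ν := integrable_sum_sq h2
      have iw2 : Integrable (fun z => (∑ j, ξ z j ^ 2) ^ 2) ν := h4.integrable_sq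
      have e1 : Integrable (fun z => A ^ 2 + 4 * A * ∑ j, s j * ξ z j) ν :=
        (integrable_const _).add (il.const_mul _)
      have e2 : Integrable (fun z => A ^ 2 + 4 * A * ∑ j, s j * ξ z j
          + (2 * A - 4 * τ) * ∑ j, ξ z j ^ 2) ν := e1.add (iw.const_mul _)
      have e3 : Integrable (fun z => A ^ 2 + 4 * A * ∑ j, s j * ξ z j
          + (2 * A - 4 * τ) * ∑ j, ξ z j ^ 2 + 8 * (∑ j, s j * ξ z j) ^ 2) ν :=
        e2.add (il2.const_mul _)
      have e4 : Integrable (fun z => A ^ 2 + 4 * A * ∑ j, s j * ξ z j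
          + (2 * A - 4 * τ) * ∑ j, ξ z j ^ 2 + 8 * (∑ j, s j * ξ z j) ^ 2
          + 2 * (∑ j, ξ z j ^ 2) ^ 2) ν := e3.add (iw2.const_mul _)
      have e5 : Integrable (fun z => A ^ 2 + 4 * A * ∑ j, s j * ξ z j
          + (2 * A - 4 * τ) * ∑ j, ξ z j ^ 2 + 8 * (∑ j, s j * ξ z j) ^ 2
          + 2 * (∑ j, ξ z j ^ 2) ^ 2 + (2 * τ ^ 2 - 2 * A * τ)) ν :=
        e4.add (integrable_const _)
      have hpt : ∀ z, (∑ j, partialSum ξ (Fin.cons z D : Fin (n + 1) → Z) j ^ 2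
            - (n + 1 : ℕ) * τ) ^ 2
          ≤ A ^ 2 + 4 * A * ∑ j, s j * ξ z j
          + (2 * A - 4 * τ) * ∑ j, ξ z j ^ 2 + 8 * (∑ j, s j * ξ z j) ^ 2
          + 2 * (∑ j, ξ z j ^ 2) ^ 2 + (2 * τ ^ 2 - 2 * A * τ) := by
        intro z
        simp only [partialSum_cons]
        rw [sum_add_sq]
        push_cast
        have : ∑ j, s j ^ 2 = A + n * τ := by rw [hA]; ring
        rw [← hs, this]
        -- This is `(x + y)² ≤ 2x² + 2y²` with `x = 2⟨s, ξ⟩` and `y = |ξ|² - τ`.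
        nlinarith [sq_nonneg (2 * ∑ j, s j * ξ z j - (∑ j, ξ z j ^ 2 - τ))]
      refine (lintegral_mono fun z => ENNReal.ofReal_le_ofReal (hpt z)).trans ?_
      rw [← ofReal_integral_eq_lintegral_ofReal e5
        (ae_of_all _ fun z => (sq_nonneg _).trans (hpt z)),
        integral_add e4 (integrable_const _), integral_add e3 (iw2.const_mul _),
        integral_add e2 (il2.const_mul _), integral_add e1 (iw.const_mul _),
        integral_add (integrable_const _) (il.const_mul _)]
      simp only [integral_const_mul, integral_linear_eq_zero h2 h0, integral_const,
        probReal_univ, one_smul]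
      rw [← hτdef, ← hmdef, ← ENNReal.ofReal_mul (by positivity),
        ← ENNReal.ofReal_add (by positivity) (by positivity),
        ← ENNReal.ofReal_add (by positivity) (by positivity)]
      refine ENNReal.ofReal_le_ofReal ?_
      have := hκ s
      nlinarith [sq_nonneg τ]
    refine (lintegral_mono hin).trans ?_
    rw [lintegral_add_left (hmV n _), lintegral_add_left ((hmS n).ennreal_ofReal.const_mul _),
      lintegral_const_mul _ (hmS n).ennreal_ofReal]
    simp only [lintegral_const, measure_univ, mul_one]
    have hS := lintegral_partialSum_sq_le hξ h2 h0 n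
    rw [← hτdef] at hS
    refine (add_le_add ih (add_le_add_left (mul_le_mul_right hS _) _)).trans ?_
    rw [← ENNReal.ofReal_mul (by positivity), ← ENNReal.ofReal_add (by positivity) (by positivity),
      ← ENNReal.ofReal_add (by positivity) (by positivity)]
    refine ENNReal.ofReal_le_ofReal ?_
    push_cast
    -- The mean of `|s|²` is at most `nτ`, and `4n² + 8n ≤ 4(n+1)²` closes the induction.
    have : 0 ≤ κ * τ := mul_nonneg hκ0 hτ
    nlinarith

theorem measure_partialSum_sq_gt_le {ξ : Z → ι → ℝ} (hξ : ∀ j, Measurable fun z => ξ z j)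
    (h2 : ∀ j, MemLp (fun z => ξ z j) 2 ν) (h0 : ∀ j, ∫ z, ξ z j ∂ν = 0) (n : ℕ) {t : ℝ}
    (ht : 0 < t) :
    Measure.pi (fun _ : Fin n => ν) {D | t < ∑ j, partialSum ξ D j ^ 2}
      ≤ ENNReal.ofReal (n * (∫ z, ∑ j, ξ z j ^ 2 ∂ν) / t) := by
  have hm : Measurable fun D : Fin n → Z => ENNReal.ofReal (∑ j, partialSum ξ D j ^ 2) :=
    (Finset.measurable_sum _ fun j _ =>
      (measurable_partialSum hξ j).pow_const 2).ennreal_ofReal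
  rw [ENNReal.ofReal_div_of_pos ht]
  refine (measure_mono fun D hD => ?_).trans ((meas_ge_le_lintegral_div hm.aemeasurable
    (ENNReal.ofReal_pos.mpr ht).ne' ENNReal.ofReal_ne_top).trans
    (ENNReal.div_le_div_right (lintegral_partialSum_sq_le hξ h2 h0 n) _))
  exact ENNReal.ofReal_le_ofReal (le_of_lt hD)

theorem measure_partialSum_sq_gt_add_le {ξ : Z → ι → ℝ}
    (hξ : ∀ j, Measurable fun z => ξ z j)
    (h2 : ∀ j, MemLp (fun z => ξ z j) 2 ν) (h0 : ∀ j, ∫ z, ξ z j ∂ν = 0)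
    (h4 : MemLp (fun z => ∑ j, ξ z j ^ 2) 2 ν) {κ : ℝ} (hκ0 : 0 ≤ κ)
    (hκ : ∀ s : ι → ℝ, ∫ z, (∑ j, s j * ξ z j) ^ 2 ∂ν ≤ κ * ∑ j, s j ^ 2) (n : ℕ) {t : ℝ}
    (ht : 0 < t) :
    Measure.pi (fun _ : Fin n => ν)
        {D | n * (∫ z, ∑ j, ξ z j ^ 2 ∂ν) + t < ∑ j, partialSum ξ D j ^ 2}
      ≤ ENNReal.ofReal ((4 * n ^ 2 * κ * ∫ z, ∑ j, ξ z j ^ 2 ∂ν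
        + 2 * n * ∫ z, (∑ j, ξ z j ^ 2) ^ 2 ∂ν) / t ^ 2) := by
  have hm : Measurable fun D : Fin n → Z => ENNReal.ofReal
      ((∑ j, partialSum ξ D j ^ 2 - n * ∫ z, ∑ j, ξ z j ^ 2 ∂ν) ^ 2) :=
    (((Finset.measurable_sum _ fun j _ =>
      (measurable_partialSum hξ j).pow_const 2).sub_const _).pow_const 2).ennreal_ofReal
  have ht2 : 0 < t ^ 2 := by positivity
  rw [ENNReal.ofReal_div_of_pos ht2]
  refine (measure_mono fun D hD => ?_).trans ((meas_ge_le_lintegral_div hm.aemeasurable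
    (ENNReal.ofReal_pos.mpr ht2).ne' ENNReal.ofReal_ne_top).trans
    (ENNReal.div_le_div_right (lintegral_partialSum_sq_sub_sq_le hξ h2 h0 h4 hκ0 hκ n) _))
  have hD' : n * (∫ z, ∑ j, ξ z j ^ 2 ∂ν) + t < ∑ j, partialSum ξ D j ^ 2 := hD
  refine ENNReal.ofReal_le_ofReal (pow_le_pow_left₀ ht.le ?_ 2)
  linarith

end Moments

end SphereMatern

namespace SphereMatern

/-! ### Moments of a single noisy observation. -/

section Observation

variable {d : ℕ}

/-- The law of a design point and an independent noise variable. -/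
noncomputable def obsLaw (d : ℕ) (σ : ℝ) : Measure (Sph d × ℝ) :=
  (unif d).prod (gaussianReal 0 (σ ^ 2).toNNReal)

instance instIsProbabilityMeasureObsLaw (d : ℕ) (σ : ℝ) : IsProbabilityMeasure (obsLaw d σ) := by
  unfold obsLaw
  infer_instance

theorem integral_sub_integral_sq_le {Ω : Type*} [MeasurableSpace Ω] {μ : Measure Ω}
    [IsProbabilityMeasure μ] {X : Ω → ℝ} (hX : MemLp X 2 μ) {c : ℝ} (hc : ∫ ω, X ω ∂μ = c) :
    ∫ ω, (X ω - c) ^ 2 ∂μ ≤ ∫ ω, X ω ^ 2 ∂μ := by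
  have i1 := hX.integrable_sq
  have i2 : Integrable (fun ω => 2 * c * X ω) μ := (hX.integrable (by norm_num)).const_mul _
  have i3 : Integrable (fun ω => X ω ^ 2 - 2 * c * X ω) μ := i1.sub i2
  have h : ∀ ω, (X ω - c) ^ 2 = (X ω ^ 2 - 2 * c * X ω) + c ^ 2 := fun ω => by ring
  simp only [h]
  rw [integral_add i3 (integrable_const _), integral_sub i1 i2, integral_const_mul, hc]
  simp only [integral_const, probReal_univ, one_smul]
  nlinarith [sq_nonneg c]

theorem memLp_noise (σ : ℝ) : MemLp (fun ε : ℝ => ε) 2 (gaussianReal 0 (σ ^ 2).toNNReal) :=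
  memLp_id_gaussianReal 2

theorem integral_noise_sq (σ : ℝ) :
    ∫ ε, ε ^ 2 ∂(gaussianReal 0 (σ ^ 2).toNNReal) = σ ^ 2 := by
  have h := variance_fun_id_gaussianReal (μ := 0) (v := (σ ^ 2).toNNReal)
  rw [variance_eq_sub (memLp_noise σ), integral_id_gaussianReal, Real.coe_toNNReal _ (sq_nonneg σ)] at h
  simpa using h

theorem memLp_noise_sq (σ : ℝ) :
    MemLp (fun ε : ℝ => ε ^ 2) 2 (gaussianReal 0 (σ ^ 2).toNNReal) := by
  rw [memLp_two_iff_integrable_sq (by fun_prop)]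
  have h := (memLp_id_gaussianReal (μ := 0) (v := (σ ^ 2).toNNReal) 4).integrable_norm_pow
    (by norm_num)
  refine h.congr (ae_of_all _ fun ε => ?_)
  change ‖ε‖ ^ 4 = (ε ^ 2) ^ 2
  rw [Real.norm_eq_abs, ← pow_mul, Even.pow_abs (by decide)]

theorem memLp_response {u : Sph d → ℝ} (hu : MemLp u 2 (unif d)) (σ : ℝ) :
    MemLp (fun z : Sph d × ℝ => u z.1 + z.2) 2 (obsLaw d σ) :=
  (hu.comp_fst _).add ((memLp_noise σ).comp_snd _)

theorem memLp_continuous_mul {u : Sph d × ℝ → ℝ} {σ : ℝ} (hu : MemLp u 2 (obsLaw d σ))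
    {F : Sph d → ℝ} (hF : Continuous F) :
    MemLp (fun z => F z.1 * u z) 2 (obsLaw d σ) := by
  obtain ⟨C, hC⟩ := isCompact_univ.exists_bound_of_continuousOn hF.continuousOn
  exact hu.mul (memLp_top_of_bound (hF.comp continuous_fst).aestronglyMeasurable C
    (ae_of_all _ fun z => hC z.1 (Set.mem_univ _)))

theorem integral_obsLaw_fst (σ : ℝ) (F : Sph d → ℝ) :
    ∫ z, F z.1 ∂(obsLaw d σ) = ∫ x, F x ∂(unif d) := by
  rw [obsLaw, integral_fun_fst]
  simp

theorem integral_continuous_mul_response {u : Sph d → ℝ} (hu : MemLp u 2 (unif d)) (σ : ℝ)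
    {F : Sph d → ℝ} (hF : Continuous F) :
    ∫ z, F z.1 * (u z.1 + z.2) ∂(obsLaw d σ) = ∫ x, u x * F x ∂(unif d) := by
  have i1 : Integrable (fun z : Sph d × ℝ => F z.1 * u z.1) (obsLaw d σ) :=
    ((memLp_of_continuous hF 2).integrable_mul hu).comp_fst _
  have i2 : Integrable (fun z : Sph d × ℝ => F z.1 * z.2) (obsLaw d σ) :=
    (integrable_of_continuous hF).mul_prod ((memLp_noise σ).integrable (by norm_num))
  simp only [mul_add]
  rw [integral_add i1 i2, integral_obsLaw_fst σ fun x => F x * u x]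
  have h : ∫ z : Sph d × ℝ, F z.1 * z.2 ∂(obsLaw d σ) = 0 := by
    rw [obsLaw, integral_prod_mul F fun ε : ℝ => ε, integral_id_gaussianReal, mul_zero]
  rw [h, add_zero]
  simp only [mul_comm]

theorem integral_continuous_mul_response_sq {u : Sph d → ℝ} (hu : MemLp u 2 (unif d)) (σ : ℝ)
    {F : Sph d → ℝ} (hF : Continuous F) :
    ∫ z, F z.1 * (u z.1 + z.2) ^ 2 ∂(obsLaw d σ)
      = ∫ x, F x * (u x ^ 2 + σ ^ 2) ∂(unif d) := by
  obtain ⟨C, hC⟩ := isCompact_univ.exists_bound_of_continuousOn hF.continuousOn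
  have i0 : Integrable (fun x => F x * u x ^ 2) (unif d) :=
    hu.integrable_sq.bdd_mul hF.aestronglyMeasurable (ae_of_all _ fun z => hC z (Set.mem_univ _))
  have i0' : Integrable (fun x => F x * σ ^ 2) (unif d) :=
    (integrable_of_continuous hF).mul_const _
  have iu : Integrable (fun x => F x * u x) (unif d) :=
    (memLp_of_continuous hF 2).integrable_mul hu
  have i1 : Integrable (fun z : Sph d × ℝ => F z.1 * u z.1 ^ 2) (obsLaw d σ) := i0.comp_fst _
  have i2 : Integrable (fun z : Sph d × ℝ => (F z.1 * u z.1) * (2 * z.2)) (obsLaw d σ) :=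
    iu.mul_prod (((memLp_noise σ).integrable (by norm_num)).const_mul 2)
  have i3 : Integrable (fun z : Sph d × ℝ => F z.1 * z.2 ^ 2) (obsLaw d σ) :=
    (integrable_of_continuous hF).mul_prod (memLp_noise σ).integrable_sq
  have i12 : Integrable (fun z : Sph d × ℝ => F z.1 * u z.1 ^ 2
    + (F z.1 * u z.1) * (2 * z.2)) (obsLaw d σ) := i1.add i2
  have h : ∀ z : Sph d × ℝ, F z.1 * (u z.1 + z.2) ^ 2
      = F z.1 * u z.1 ^ 2 + (F z.1 * u z.1) * (2 * z.2) + F z.1 * z.2 ^ 2 := fun z => by ring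
  have h2 : ∫ z : Sph d × ℝ, (F z.1 * u z.1) * (2 * z.2) ∂(obsLaw d σ) = 0 := by
    rw [obsLaw, integral_prod_mul (fun x => F x * u x) fun ε : ℝ => 2 * ε, integral_const_mul,
      integral_id_gaussianReal, mul_zero, mul_zero]
  have h3 : ∫ z : Sph d × ℝ, F z.1 * z.2 ^ 2 ∂(obsLaw d σ) = ∫ x, F x * σ ^ 2 ∂(unif d) := by
    rw [obsLaw, integral_prod_mul F fun ε : ℝ => ε ^ 2, integral_noise_sq, integral_mul_const]
  simp only [h]
  rw [integral_add i12 i3, integral_add i1 i2, h2, h3,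
    integral_obsLaw_fst σ fun x => F x * u x ^ 2, add_zero, ← integral_add i0 i0']
  simp only [mul_add]

end Observation

/-! ### Probability bounds for the Gram matrix and the score vector. -/

section Concentration

variable {d : ℕ} (B : HarmonicBasis d) {L : ℕ}

/-- The deviation of the product of two basis functions from its mean. -/
noncomputable def gramDev (L : ℕ) (z : Sph d × ℝ) (jk : Idx d L × Idx d L) : ℝ :=
  B.Y jk.1.1 jk.1.2 z.1 * B.Y jk.2.1 jk.2.2 z.1 - if jk.1 = jk.2 then 1 else 0

/-- The deviation of the product of a basis function and a signal from its mean. -/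
noncomputable def signalDev (u : Sph d → ℝ) (L : ℕ) (z : Sph d × ℝ) (j : Idx d L) : ℝ :=
  B.Y j.1 j.2 z.1 * u z.1 - coeffVec B u L j

/-- The deviation of the product of a basis function and a noisy response from its mean. -/
noncomputable def responseDev (u : Sph d → ℝ) (L : ℕ) (z : Sph d × ℝ) (j : Idx d L) : ℝ :=
  B.Y j.1 j.2 z.1 * (u z.1 + z.2) - coeffVec B u L j

/-- With `∑ Y² = J` the sum is `J² - 2J + J`, at every point of the sphere. -/
theorem sum_gramDev_sq (z : Sph d × ℝ) :
    ∑ jk, gramDev B L z jk ^ 2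
      = (Fintype.card (Idx d L) : ℝ) ^ 2 - Fintype.card (Idx d L) := by
  have h := sum_Y_sq B L z.1
  have h1 : ∀ j k : Idx d L, gramDev B L z (j, k) ^ 2
      = B.Y j.1 j.2 z.1 ^ 2 * B.Y k.1 k.2 z.1 ^ 2
        + if j = k then 1 - 2 * B.Y j.1 j.2 z.1 ^ 2 else 0 := by
    intro j k
    by_cases hjk : j = k
    · subst hjk
      simp [gramDev]
      ring
    · simp [gramDev, hjk]
      ring
  rw [Fintype.sum_prod_type]
  simp only [h1, Finset.sum_add_distrib, Finset.sum_ite_eq, Finset.mem_univ, if_true,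
    ← Finset.mul_sum, ← Finset.sum_mul, Finset.sum_sub_distrib, h]
  simp
  ring

theorem measurable_Y_fst (ℓ : ℕ) (m : Fin (mult d ℓ)) :
    Measurable fun z : Sph d × ℝ => B.Y ℓ m z.1 :=
  (continuous_Y B ℓ m).measurable.comp measurable_fst

theorem measure_gram_gt_le (σ : ℝ) {n : ℕ} (hn : 0 < n) :
    Measure.pi (fun _ : Fin n => obsLaw d σ)
        {D | (n : ℝ) ^ 2 / 4 < ∑ jk, partialSum (gramDev B L) D jk ^ 2}
      ≤ ENNReal.ofReal (4 * (Fintype.card (Idx d L) : ℝ) ^ 2 / n) := by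
  have hn' : (0 : ℝ) < n := by exact_mod_cast hn
  have hc : ∀ jk : Idx d L × Idx d L,
      Continuous fun x => B.Y jk.1.1 jk.1.2 x * B.Y jk.2.1 jk.2.2 x - if jk.1 = jk.2 then 1 else 0 :=
    fun jk => ((continuous_Y B _ _).mul (continuous_Y B _ _)).sub continuous_const
  have h := measure_partialSum_sq_gt_le (ν := obsLaw d σ) (ξ := gramDev B L)
    (fun jk => (hc jk).measurable.comp measurable_fst)
    (fun jk => (memLp_of_continuous (hc jk) 2).comp_fst _)
    (fun jk => by
      simp only [gramDev]
      rw [integral_obsLaw_fst σ fun x => B.Y jk.1.1 jk.1.2 x * B.Y jk.2.1 jk.2.2 x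
        - if jk.1 = jk.2 then 1 else 0, integral_sub (integrable_mul_of_continuous
        (continuous_Y B _ _) (continuous_Y B _ _)) (integrable_const _), integral_Y_mul_Y]
      simp) n (t := (n : ℝ) ^ 2 / 4) (by positivity)
  refine h.trans (ENNReal.ofReal_le_ofReal ?_)
  simp only [sum_gramDev_sq, integral_const, probReal_univ, one_smul]
  rw [div_le_div_iff₀ (by positivity) hn']
  have : (0 : ℝ) ≤ Fintype.card (Idx d L) := Nat.cast_nonneg _
  nlinarith [mul_nonneg this (sq_nonneg (n : ℝ))]

theorem memLp_signalDev {u : Sph d → ℝ} (hu : MemLp u 2 (unif d)) (σ : ℝ) (j : Idx d L) :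
    MemLp (fun z => signalDev B u L z j) 2 (obsLaw d σ) :=
  (memLp_continuous_mul (hu.comp_fst _) (continuous_Y B _ _)).sub (memLp_const _)

theorem memLp_responseDev {u : Sph d → ℝ} (hu : MemLp u 2 (unif d)) (σ : ℝ) (j : Idx d L) :
    MemLp (fun z => responseDev B u L z j) 2 (obsLaw d σ) :=
  (memLp_continuous_mul (memLp_response hu σ) (continuous_Y B _ _)).sub (memLp_const _)

/-- Markov's inequality. The addition theorem gives the factor `J ‖u‖²` for any square-integrable
signal, with no sup norm. -/
theorem measure_signal_gt_le {u : Sph d → ℝ} (hum : Measurable u) (hu : MemLp u 2 (unif d))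
    (σ : ℝ) (n : ℕ) {t : ℝ} (ht : 0 < t) :
    Measure.pi (fun _ : Fin n => obsLaw d σ)
        {D | t < ∑ j : Idx d L, partialSum (signalDev B u L) D j ^ 2}
      ≤ ENNReal.ofReal (n * (Fintype.card (Idx d L) * ∫ x, u x ^ 2 ∂(unif d)) / t) := by
  have hY : ∀ j : Idx d L, MemLp (fun z : Sph d × ℝ => B.Y j.1 j.2 z.1 * u z.1) 2 (obsLaw d σ) :=
    fun j => memLp_continuous_mul (hu.comp_fst _) (continuous_Y B _ _)
  have hmean : ∀ j : Idx d L,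
      ∫ z, B.Y j.1 j.2 z.1 * u z.1 ∂(obsLaw d σ) = coeffVec B u L j := fun j => by
    rw [integral_obsLaw_fst σ fun x => B.Y j.1 j.2 x * u x]
    simp only [coeffVec, coeff, mul_comm]
  have h := measure_partialSum_sq_gt_le (ν := obsLaw d σ) (ξ := signalDev B u L)
    (fun j => ((measurable_Y_fst B _ _).mul (hum.comp measurable_fst)).sub_const _)
    (memLp_signalDev B hu σ)
    (fun j => by
      simp only [signalDev]
      rw [integral_sub ((hY j).integrable (by norm_num)) (integrable_const _), hmean]
      simp) n ht
  refine h.trans (ENNReal.ofReal_le_ofReal ?_)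
  gcongr
  rw [integral_finsetSum _ fun j _ => (memLp_signalDev B hu σ j).integrable_sq]
  refine (Finset.sum_le_sum fun j _ => integral_sub_integral_sq_le (hY j) (hmean j)).trans ?_
  rw [← integral_finsetSum _ fun j _ => (hY j).integrable_sq,
    integral_obsLaw_fst σ fun x => ∑ j : Idx d L, (B.Y j.1 j.2 x * u x) ^ 2]
  simp only [mul_pow, ← Finset.sum_mul, sum_Y_sq, integral_const_mul]
  exact le_rfl

theorem sum_coeffVec_sq_le {u : Sph d → ℝ} (hu : MemLp u 2 (unif d)) :
    ∑ j, coeffVec B u L j ^ 2 ≤ ∫ x, u x ^ 2 ∂(unif d) := by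
  have h := integral_sub_synth_sq B hu (coeffVec B u L)
  have h0 : 0 ≤ ∫ x, (u x - synth B (coeffVec B u L) x) ^ 2 ∂(unif d) :=
    integral_nonneg fun x => sq_nonneg _
  simp only [sub_self, ne_eq, OfNat.ofNat_ne_zero, not_false_eq_true, zero_pow,
    Finset.sum_const_zero, add_zero] at h
  linarith

theorem memLp_mul_response {u : Sph d → ℝ} (hu : MemLp u 2 (unif d)) (σ : ℝ) (j : Idx d L) :
    MemLp (fun z : Sph d × ℝ => B.Y j.1 j.2 z.1 * (u z.1 + z.2)) 2 (obsLaw d σ) :=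
  memLp_continuous_mul (memLp_response hu σ) (continuous_Y B _ _)

theorem integral_mul_response {u : Sph d → ℝ} (hu : MemLp u 2 (unif d)) (σ : ℝ) (j : Idx d L) :
    ∫ z, B.Y j.1 j.2 z.1 * (u z.1 + z.2) ∂(obsLaw d σ) = coeffVec B u L j :=
  integral_continuous_mul_response hu σ (continuous_Y B _ _)

theorem integral_responseDev {u : Sph d → ℝ} (hu : MemLp u 2 (unif d)) (σ : ℝ) (j : Idx d L) :
    ∫ z, responseDev B u L z j ∂(obsLaw d σ) = 0 := by
  simp only [responseDev]
  rw [integral_sub ((memLp_mul_response B hu σ j).integrable (by norm_num)) (integrable_const _),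
    integral_mul_response B hu]
  simp

theorem integral_sum_responseDev_sq_le {u : Sph d → ℝ} (hu : MemLp u 2 (unif d)) (σ : ℝ) :
    ∫ z, ∑ j : Idx d L, responseDev B u L z j ^ 2 ∂(obsLaw d σ)
      ≤ Fintype.card (Idx d L) * (∫ x, u x ^ 2 ∂(unif d) + σ ^ 2) := by
  have hY := memLp_mul_response (L := L) B hu σ
  rw [integral_finsetSum _ fun j _ => (memLp_responseDev B hu σ j).integrable_sq]
  refine (Finset.sum_le_sum fun j _ =>
    integral_sub_integral_sq_le (hY j) (integral_mul_response B hu σ j)).trans ?_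
  rw [← integral_finsetSum _ fun j _ => (hY j).integrable_sq]
  simp only [mul_pow, ← Finset.sum_mul, sum_Y_sq]
  rw [integral_continuous_mul_response_sq hu σ (F := fun _ => (Fintype.card (Idx d L) : ℝ))
    continuous_const, integral_const_mul, integral_add hu.integrable_sq (integrable_const _)]
  simp

/-- A linear form of the score is a centred `f_s(x)(g(x) + ε)` with `‖f_s‖ = |s|`. The covariance
thus has operator norm at most `T² + σ²` whatever the number of modes, which makes the variance of
`|S|²` of order `n² J` instead of `n² J²`. -/
theorem integral_linear_responseDev_sq_le {g : Sph d → ℝ} (hgL : MemLp g 2 (unif d)) {T : ℝ}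
    (hT : ∀ x, g x ^ 2 ≤ T ^ 2) (σ : ℝ) (s : Idx d L → ℝ) :
    ∫ z, (∑ j, s j * responseDev B g L z j) ^ 2 ∂(obsLaw d σ)
      ≤ (T ^ 2 + σ ^ 2) * ∑ j, s j ^ 2 := by
  have hs : ∀ z : Sph d × ℝ, ∑ j, s j * responseDev B g L z j
      = synth B s z.1 * (g z.1 + z.2) - ∑ j, s j * coeffVec B g L j := fun z => by
    simp only [responseDev, synth, Finset.sum_mul, ← Finset.sum_sub_distrib]
    exact Finset.sum_congr rfl fun j _ => by ring
  have hsc := continuous_synth B s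
  simp only [hs]
  refine (integral_sub_integral_sq_le
    (memLp_continuous_mul (memLp_response hgL σ) hsc) ?_).trans ?_
  · rw [integral_continuous_mul_response hgL σ hsc, integral_mul_synth B hgL]
  · simp only [mul_pow]
    rw [integral_continuous_mul_response_sq hgL σ (F := fun x => synth B s x ^ 2) (hsc.pow 2)]
    have hi : Integrable (fun x => (T ^ 2 + σ ^ 2) * (synth B s x * synth B s x)) (unif d) :=
      (integrable_mul_of_continuous hsc hsc).const_mul _
    have hsq : ∑ j, s j ^ 2 = ∫ x, synth B s x * synth B s x ∂(unif d) := by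
      rw [integral_synth_mul_synth]
      simp only [sq]
    rw [hsq, ← integral_const_mul]
    refine integral_mono_of_nonneg (ae_of_all _ fun x => ?_) hi (ae_of_all _ fun x => ?_)
    · simp only [Pi.zero_apply]
      positivity
    · change synth B s x ^ 2 * (g x ^ 2 + σ ^ 2) ≤ (T ^ 2 + σ ^ 2) * (synth B s x * synth B s x)
      rw [← sq, mul_comm]
      exact mul_le_mul_of_nonneg_right (by linarith [hT x]) (sq_nonneg _)

/-- The products contribute `J` times the squared response by the addition theorem, and the
subtracted means are controlled by Bessel. -/
theorem sum_responseDev_sq_le {g : Sph d → ℝ} (hgL : MemLp g 2 (unif d)) {T : ℝ}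
    (hT : ∀ x, g x ^ 2 ≤ T ^ 2) (z : Sph d × ℝ) :
    ∑ j : Idx d L, responseDev B g L z j ^ 2
      ≤ (4 * Fintype.card (Idx d L) + 2) * T ^ 2 + 4 * Fintype.card (Idx d L) * z.2 ^ 2 := by
  have hgT : ∫ x, g x ^ 2 ∂(unif d) ≤ T ^ 2 :=
    (integral_mono hgL.integrable_sq (integrable_const _) hT).trans (by simp)
  have h1 : ∀ j : Idx d L, responseDev B g L z j ^ 2
      ≤ B.Y j.1 j.2 z.1 ^ 2 * (2 * (g z.1 + z.2) ^ 2) + 2 * coeffVec B g L j ^ 2 := fun j => by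
    simp only [responseDev]
    nlinarith [sq_nonneg (B.Y j.1 j.2 z.1 * (g z.1 + z.2) + coeffVec B g L j)]
  refine (Finset.sum_le_sum fun j _ => h1 j).trans ?_
  rw [Finset.sum_add_distrib, ← Finset.sum_mul, sum_Y_sq, ← Finset.mul_sum]
  have h3 := sum_coeffVec_sq_le (L := L) B hgL
  have h4 : (g z.1 + z.2) ^ 2 ≤ 2 * T ^ 2 + 2 * z.2 ^ 2 := by
    nlinarith [hT z.1, sq_nonneg (g z.1 - z.2)]
  have h5 := mul_le_mul_of_nonneg_left h4 (Nat.cast_nonneg (α := ℝ) (Fintype.card (Idx d L)))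
  linarith

theorem measurable_responseDev {g : Sph d → ℝ} (hgm : Measurable g) (j : Idx d L) :
    Measurable fun z => responseDev B g L z j :=
  ((measurable_Y_fst B _ _).mul ((hgm.comp measurable_fst).add measurable_snd)).sub_const _

theorem memLp_sum_responseDev_sq {g : Sph d → ℝ} (hgm : Measurable g)
    (hgL : MemLp g 2 (unif d)) {T : ℝ} (hT : ∀ x, g x ^ 2 ≤ T ^ 2) (σ : ℝ) :
    MemLp (fun z => ∑ j : Idx d L, responseDev B g L z j ^ 2) 2 (obsLaw d σ) := by
  have hdom : ∀ a b : ℝ, MemLp (fun z : Sph d × ℝ => a + b * z.2 ^ 2) 2 (obsLaw d σ) :=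
    fun a b => (memLp_const a).add (((memLp_noise_sq σ).comp_snd _).const_mul b)
  have hw0 : ∀ z : Sph d × ℝ, 0 ≤ ∑ j : Idx d L, responseDev B g L z j ^ 2 := fun z =>
    Finset.sum_nonneg fun j _ => sq_nonneg _
  refine (hdom ((4 * (Fintype.card (Idx d L) : ℝ) + 2) * T ^ 2)
    (4 * (Fintype.card (Idx d L) : ℝ))).mono (Finset.measurable_sum _ fun j _ =>
    (measurable_responseDev B hgm j).pow_const 2).aestronglyMeasurable (ae_of_all _ fun z => ?_)
  have hw := sum_responseDev_sq_le (L := L) B hgL hT z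
  rw [Real.norm_of_nonneg (hw0 z), Real.norm_of_nonneg ((hw0 z).trans hw)]
  exact hw

theorem integral_sum_responseDev_sq_sq_le {g : Sph d → ℝ} (hgm : Measurable g)
    (hgL : MemLp g 2 (unif d)) {T : ℝ} (hT : ∀ x, g x ^ 2 ≤ T ^ 2) (σ : ℝ) :
    ∫ z, (∑ j : Idx d L, responseDev B g L z j ^ 2) ^ 2 ∂(obsLaw d σ)
      ≤ (48 * (T ^ 2) ^ 2 + 48 * ∫ ε, (ε ^ 2) ^ 2 ∂(gaussianReal 0 (σ ^ 2).toNNReal))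
        * ((Fintype.card (Idx d L) : ℝ) ^ 2 + 1) := by
  have hw := sum_responseDev_sq_le (L := L) B hgL hT
  have h4 := memLp_sum_responseDev_sq (L := L) B hgm hgL hT σ
  have he0 : 0 ≤ ∫ ε, (ε ^ 2) ^ 2 ∂(gaussianReal 0 (σ ^ 2).toNNReal) :=
    integral_nonneg fun x => sq_nonneg _
  generalize (Fintype.card (Idx d L) : ℝ) = J at *
  have hpt : ∀ z : Sph d × ℝ, (∑ j : Idx d L, responseDev B g L z j ^ 2) ^ 2
      ≤ 2 * ((4 * J + 2) * T ^ 2) ^ 2 + 32 * J ^ 2 * (z.2 ^ 2) ^ 2 := by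
    intro z
    refine (pow_le_pow_left₀ (Finset.sum_nonneg fun j _ => sq_nonneg _) (hw z) 2).trans ?_
    nlinarith [sq_nonneg ((4 * J + 2) * T ^ 2 - 4 * J * z.2 ^ 2)]
  have hie : Integrable (fun z : Sph d × ℝ => 32 * J ^ 2 * (z.2 ^ 2) ^ 2) (obsLaw d σ) :=
    ((memLp_noise_sq σ).integrable_sq.comp_snd _).const_mul _
  refine (integral_mono h4.integrable_sq ((integrable_const _).add hie) hpt).trans ?_
  simp only [Pi.add_apply]
  rw [integral_add (integrable_const _) hie, integral_const_mul (32 * J ^ 2), obsLaw,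
    integral_fun_snd fun ε : ℝ => (ε ^ 2) ^ 2]
  simp only [integral_const, probReal_univ, one_smul]
  generalize ∫ ε, (ε ^ 2) ^ 2 ∂(gaussianReal 0 (σ ^ 2).toNNReal) = e at *
  have h5 : (4 * J + 2) ^ 2 ≤ 24 * (J ^ 2 + 1) := by nlinarith [sq_nonneg (J - 1)]
  have h6 := mul_le_mul_of_nonneg_right h5 (sq_nonneg (T ^ 2))
  have h7 := mul_nonneg he0 (sq_nonneg J)
  have h8 : ((4 * J + 2) * T ^ 2) ^ 2 = (4 * J + 2) ^ 2 * (T ^ 2) ^ 2 := by ring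
  rw [h8]
  linarith

/-- Chebyshev's inequality for `|S|²`. The constant depends on `T` and `σ` but not on `L`, `n` or
`t`. -/
theorem measure_response_gt_le {g : Sph d → ℝ} (hgm : Measurable g) {T : ℝ}
    (hg : ∀ x, |g x| ≤ T) (σ : ℝ) :
    ∃ C : ℝ, 0 ≤ C ∧ ∀ (L n : ℕ) (t : ℝ), 0 < t →
      Measure.pi (fun _ : Fin n => obsLaw d σ)
        {D | n * (Fintype.card (Idx d L) * (∫ x, g x ^ 2 ∂(unif d) + σ ^ 2)) + t
          < ∑ j : Idx d L, partialSum (responseDev B g L) D j ^ 2}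
      ≤ ENNReal.ofReal (C * (n ^ 2 * Fintype.card (Idx d L)
          + n * ((Fintype.card (Idx d L) : ℝ) ^ 2 + 1)) / t ^ 2) := by
  have hT : ∀ x, g x ^ 2 ≤ T ^ 2 := fun x => sq_le_sq' (by linarith [(abs_le.mp (hg x)).1])
    (abs_le.mp (hg x)).2
  have hgL : MemLp g 2 (unif d) := MemLp.of_bound hgm.aestronglyMeasurable T (ae_of_all _ hg)
  have hgT : ∫ x, g x ^ 2 ∂(unif d) ≤ T ^ 2 :=
    (integral_mono hgL.integrable_sq (integrable_const _) hT).trans (by simp)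
  have he0 : 0 ≤ ∫ ε, (ε ^ 2) ^ 2 ∂(gaussianReal 0 (σ ^ 2).toNNReal) :=
    integral_nonneg fun x => sq_nonneg _
  refine ⟨4 * (T ^ 2 + σ ^ 2) ^ 2
    + 2 * (48 * (T ^ 2) ^ 2 + 48 * ∫ ε, (ε ^ 2) ^ 2 ∂(gaussianReal 0 (σ ^ 2).toNNReal)),
    by positivity, ?_⟩
  intro L n t ht
  have hτ := integral_sum_responseDev_sq_le (L := L) B hgL σ
  have hm4 := integral_sum_responseDev_sq_sq_le (L := L) B hgm hgL hT σ
  have h := measure_partialSum_sq_gt_add_le (measurable_responseDev (L := L) B hgm)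
    (memLp_responseDev B hgL σ) (integral_responseDev B hgL σ)
    (memLp_sum_responseDev_sq B hgm hgL hT σ) (κ := T ^ 2 + σ ^ 2) (by positivity)
    (integral_linear_responseDev_sq_le B hgL hT σ) n ht
  refine (measure_mono fun D hD => ?_).trans (h.trans (ENNReal.ofReal_le_ofReal ?_))
  · have hD' : n * (Fintype.card (Idx d L) * (∫ x, g x ^ 2 ∂(unif d) + σ ^ 2)) + t
        < ∑ j : Idx d L, partialSum (responseDev B g L) D j ^ 2 := hD
    refine lt_of_le_of_lt ?_ hD'
    exact add_le_add_left (mul_le_mul_of_nonneg_left hτ (Nat.cast_nonneg n)) t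
  · refine div_le_div_of_nonneg_right ?_ (sq_nonneg t)
    have hJ0 : (0 : ℝ) ≤ Fintype.card (Idx d L) := Nat.cast_nonneg _
    have hτ' := hτ.trans (mul_le_mul_of_nonneg_left (add_le_add_left hgT (σ ^ 2)) hJ0)
    generalize (Fintype.card (Idx d L) : ℝ) = J at *
    generalize ∫ ε, (ε ^ 2) ^ 2 ∂(gaussianReal 0 (σ ^ 2).toNNReal) = e at *
    have h5 := mul_le_mul_of_nonneg_left hτ'
      (show 0 ≤ 4 * (n : ℝ) ^ 2 * (T ^ 2 + σ ^ 2) by positivity)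
    have h6 := mul_le_mul_of_nonneg_left hm4 (show 0 ≤ 2 * (n : ℝ) by positivity)
    have h7 : 0 ≤ (n : ℝ) ^ 2 * J * (2 * (48 * (T ^ 2) ^ 2 + 48 * e)) := by positivity
    have h8 : 0 ≤ (n : ℝ) * (J ^ 2 + 1) * (4 * (T ^ 2 + σ ^ 2) ^ 2) := by positivity
    refine (add_le_add h5 h6).trans ?_
    linarith

end Concentration

end SphereMatern

namespace SphereMatern

/-! ### Deterministic tail bounds for the two posteriors. -/

section PosteriorTail

theorem bayes_tail_le_of_exponents {ι : Type*} [Fintype ι] {p lik : (ι → ℝ) → ℝ≥0∞}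
    {C₁ C₂ : ℝ≥0∞} {e₁ e₂ : (ι → ℝ) → ℝ} (he₁ : Measurable e₁) (he₂ : Measurable e₂)
    (hp : ∀ a, p a = C₁ * ENNReal.ofReal (Real.exp (e₁ a)))
    (hlik : ∀ a, lik a = C₂ * ENNReal.ofReal (Real.exp (e₂ a)))
    {a₀ : ι → ℝ} {c₀ : ℝ} {q : (ι → ℝ) → ℝ} (hqm : Measurable q)
    (hscale : ∀ (s : ℝ) b, q (s • b) = s ^ 2 * q b) {A r : ℝ} (hA : 0 < A)
    (hqA : ∀ b, A * ∑ j, b j ^ 2 ≤ q b) {g : ι → ℝ} (hg : ∑ j, g j ^ 2 ≤ (A * r / 8) ^ 2)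
    (he : ∀ b, e₁ (a₀ + b) + e₂ (a₀ + b) = c₀ + (-q b / 2 + ∑ j, g j * b j)) :
    bayes (volume.withDensity p) lik {a | r ^ 2 < ∑ j, (a j - a₀ j) ^ 2}
      ≤ ENNReal.ofReal (Real.sqrt 2 ^ Fintype.card ι * Real.exp (-(A * r ^ 2 / 8))) := by
  have hpm : Measurable p := by
    rw [funext hp]
    fun_prop
  have hlm : Measurable lik := by
    rw [funext hlik]
    fun_prop
  refine bayes_tail_le (c := C₁ * C₂ * ENNReal.ofReal (Real.exp c₀)) hpm hlm hqm hscale hA hqA hg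
    fun b => ?_
  have h : ENNReal.ofReal (Real.exp (e₁ (a₀ + b))) * ENNReal.ofReal (Real.exp (e₂ (a₀ + b)))
      = ENNReal.ofReal (Real.exp c₀)
        * ENNReal.ofReal (Real.exp (-q b / 2 + ∑ j, g j * b j)) := by
    rw [← ENNReal.ofReal_mul (Real.exp_pos _).le, ← ENNReal.ofReal_mul (Real.exp_pos _).le,
      ← Real.exp_add, ← Real.exp_add, he]
  rw [hp, hlik, mul_mul_mul_comm, h]
  ring

variable {d : ℕ} (B : HarmonicBasis d) {L : ℕ}

/-- The data generated by the design points and the noise variables. -/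
def dataOf (f : Sph d → ℝ) {n : ℕ} (D : Fin n → Sph d × ℝ) : Data d n :=
  fun i => ((D i).1, f (D i).1 + (D i).2)

/-- The prior variances. -/
noncomputable def priorVar (d : ℕ) (κ α : ℝ) (ℓ : ℕ) : ℝ := (κ ^ 2 + lam d ℓ) ^ (-α)

theorem priorVar_pos (hd : 1 ≤ d) {κ : ℝ} (hκ : 0 < κ) (α : ℝ) (ℓ : ℕ) :
    0 < priorVar d κ α ℓ :=
  Real.rpow_pos_of_pos (by have := lam_nonneg hd ℓ; positivity) _

theorem sum_sub_sq_le {ι : Type*} [Fintype ι] {s t : ι → ℝ} {w : ℝ}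
    (hs : ∑ j, s j ^ 2 ≤ (w / 2) ^ 2) (ht : ∑ j, t j ^ 2 ≤ (w / 2) ^ 2) :
    ∑ j, (s j - t j) ^ 2 ≤ w ^ 2 := by
  have h : ∀ j, (s j - t j) ^ 2 ≤ 2 * s j ^ 2 + 2 * t j ^ 2 := fun j => by
    nlinarith [sq_nonneg (s j + t j)]
  refine (Finset.sum_le_sum fun j _ => h j).trans ?_
  rw [Finset.sum_add_distrib, ← Finset.mul_sum, ← Finset.mul_sum]
  linarith

theorem measurable_synth_left (x : Sph d) : Measurable fun a : Idx d L → ℝ => synth B a x := by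
  unfold synth
  fun_prop

/-- The operator norm of the Gram deviation is at most its Frobenius norm, here at most `n/2`; this
is Cauchy–Schwarz against `b ⊗ b`. -/
theorem sum_synth_sq_ge {n : ℕ} {D : Fin n → Sph d × ℝ}
    (hG : ∑ jk, partialSum (gramDev B L) D jk ^ 2 ≤ (n : ℝ) ^ 2 / 4) (b : Idx d L → ℝ) :
    (n : ℝ) / 2 * ∑ j, b j ^ 2 ≤ ∑ i, synth B b (D i).1 ^ 2 := by
  have h1 : ∑ i, synth B b (D i).1 ^ 2
      = n * ∑ j, b j ^ 2 + ∑ jk : Idx d L × Idx d L,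
        b jk.1 * b jk.2 * partialSum (gramDev B L) D jk := by
    have h2 : ∀ x : Sph d × ℝ, synth B b x.1 ^ 2
        = ∑ j, b j ^ 2 + ∑ jk : Idx d L × Idx d L, b jk.1 * b jk.2 * gramDev B L x jk := by
      intro x
      simp only [gramDev, mul_sub, Finset.sum_sub_distrib, Fintype.sum_prod_type]
      simp only [mul_ite, mul_one, mul_zero, Finset.sum_ite_eq, Finset.mem_univ, if_true, ← sq]
      rw [add_sub_cancel, sq, synth, Finset.sum_mul_sum]
      exact Finset.sum_congr rfl fun j _ => Finset.sum_congr rfl fun k _ => by ring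
    simp only [h2, Finset.sum_add_distrib, Finset.sum_const, Finset.card_univ, Fintype.card_fin,
      nsmul_eq_mul, partialSum, Finset.mul_sum]
    rw [Finset.sum_comm]
  have h3 : (∑ jk : Idx d L × Idx d L, b jk.1 * b jk.2 * partialSum (gramDev B L) D jk) ^ 2
      ≤ ((n : ℝ) / 2 * ∑ j, b j ^ 2) ^ 2 := by
    refine (Finset.sum_mul_sq_le_sq_mul_sq _ _ _).trans ?_
    have h4 : ∑ jk : Idx d L × Idx d L, (b jk.1 * b jk.2) ^ 2 = (∑ j, b j ^ 2) ^ 2 := by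
      rw [Fintype.sum_prod_type, sq (∑ j, b j ^ 2), Finset.sum_mul_sum]
      simp only [mul_pow]
    rw [h4]
    refine (mul_le_mul_of_nonneg_left hG (sq_nonneg _)).trans_eq ?_
    ring
  have h0 : 0 ≤ ∑ j, b j ^ 2 := Finset.sum_nonneg fun j _ => sq_nonneg _
  have h5 := abs_le.mp (abs_le_of_sq_le_sq h3 (by positivity))
  rw [h1]
  linarith [h5.1]

/-- Completing the exponent at `a₀` leaves the residuals `h(x_i) + ε_i`. As `h` has no retained
coefficients, the linear term of the likelihood is exactly the score `S/σ²`. Each of the two parts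
of `g` gets half of `A r / 8 = n r/(16σ²)`, whence the constants `32`. -/
theorem regression_posterior_tail_le (hd : 1 ≤ d) {κ α σ : ℝ} (hκ : 0 < κ) (hσ : 0 < σ)
    {f h : Sph d → ℝ} {a₀ : Idx d L → ℝ} (hf : ∀ x, f x = synth B a₀ x + h x)
    (hh : ∀ j : Idx d L, coeffVec B h L j = 0)
    {n : ℕ} (hn : 0 < n) {D : Fin n → Sph d × ℝ} {r : ℝ}
    (hG : ∑ jk, partialSum (gramDev B L) D jk ^ 2 ≤ (n : ℝ) ^ 2 / 4)
    (hS : ∑ j, partialSum (responseDev B h L) D j ^ 2 ≤ (n * r / 32) ^ 2)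
    (hT : ∑ j : Idx d L, (a₀ j / priorVar d κ α j.1) ^ 2 ≤ (n * r / (32 * σ ^ 2)) ^ 2) :
    bayes (maternPrior d κ α L) (regressionLik B σ (dataOf f D))
        {a | r ^ 2 < ∑ j, (a j - a₀ j) ^ 2}
      ≤ ENNReal.ofReal (Real.sqrt 2 ^ Fintype.card (Idx d L)
          * Real.exp (-(n * r ^ 2 / (16 * σ ^ 2)))) := by
  have hn' : (0 : ℝ) < n := by exact_mod_cast hn
  have hv : ∀ j : Idx d L, 0 < priorVar d κ α j.1 := fun j => priorVar_pos hd hκ α _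
  rw [maternPrior]
  change bayes (Measure.pi fun j : Idx d L => gaussianReal 0 (priorVar d κ α j.1).toNNReal) _ _ ≤ _
  rw [pi_gaussianReal_eq_withDensity hv]
  have hexp : (n : ℝ) * r ^ 2 / (16 * σ ^ 2) = (n / (2 * σ ^ 2)) * r ^ 2 / 8 := by
    field_simp
    ring
  rw [hexp]
  refine bayes_tail_le_of_exponents
    (e₁ := fun a => ∑ j, -(a j - 0) ^ 2 / (2 * priorVar d κ α j.1))
    (e₂ := fun a => ∑ i, -((dataOf f D i).2 - synth B a (D i).1) ^ 2 / (2 * σ ^ 2))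
    (q := fun b => ∑ j, b j ^ 2 / priorVar d κ α j.1 + ∑ i, synth B b (D i).1 ^ 2 / σ ^ 2)
    (g := fun j => partialSum (responseDev B h L) D j / σ ^ 2 - a₀ j / priorVar d κ α j.1)
    (c₀ := ∑ j, -(a₀ j) ^ 2 / (2 * priorVar d κ α j.1)
      + ∑ i, -(h (D i).1 + (D i).2) ^ 2 / (2 * σ ^ 2))
    (by fun_prop) ?_ (fun a => prod_gaussianPDF hv (fun _ => 0) a)
    (fun a => prod_gaussianPDF (fun _ => by positivity) (fun i => synth B a (D i).1)
      (fun i => (dataOf f D i).2)) ?_ ?_ (by positivity) ?_ ?_ ?_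
  · have := fun x => measurable_synth_left (L := L) B x
    fun_prop
  · have := fun x => measurable_synth_left (L := L) B x
    fun_prop
  · intro s b
    simp only [synth_smul, Pi.smul_apply, smul_eq_mul, mul_pow, mul_add, Finset.mul_sum, mul_div_assoc]
  · intro b
    have h1 := sum_synth_sq_ge B hG b
    have h2 : 0 ≤ ∑ j : Idx d L, b j ^ 2 / priorVar d κ α j.1 :=
      Finset.sum_nonneg fun j _ => div_nonneg (sq_nonneg _) (hv j).le
    rw [← Finset.sum_div]
    have h3 : n / (2 * σ ^ 2) * ∑ j, b j ^ 2 = ((n : ℝ) / 2 * ∑ j, b j ^ 2) / σ ^ 2 := by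
      field_simp
    rw [h3]
    have := div_le_div_of_nonneg_right h1 (sq_nonneg σ)
    linarith
  · refine sum_sub_sq_le ?_ ?_
    · simp only [div_pow]
      rw [← Finset.sum_div]
      refine (div_le_div_of_nonneg_right hS (by positivity)).trans_eq ?_
      field_simp
      ring
    · refine hT.trans_eq ?_
      field_simp
      ring
  · intro b
    have hS' : ∑ j, partialSum (responseDev B h L) D j / σ ^ 2 * b j
        = ∑ i, (h (D i).1 + (D i).2) * synth B b (D i).1 / σ ^ 2 := by
      simp only [partialSum, responseDev, hh, sub_zero, synth, Finset.sum_mul, Finset.mul_sum,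
        Finset.sum_div]
      rw [Finset.sum_comm]
      exact Finset.sum_congr rfl fun i _ => Finset.sum_congr rfl fun j _ => by ring
    simp only [sub_mul, Finset.sum_sub_distrib]
    rw [hS', neg_div, add_div, Finset.sum_div, Finset.sum_div]
    have h1 : ∑ j, -((a₀ + b) j - 0) ^ 2 / (2 * priorVar d κ α j.1)
        = ∑ j, -(a₀ j) ^ 2 / (2 * priorVar d κ α j.1)
          - ∑ j, b j ^ 2 / priorVar d κ α j.1 / 2 - ∑ j, a₀ j / priorVar d κ α j.1 * b j := by
      rw [← Finset.sum_sub_distrib, ← Finset.sum_sub_distrib]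
      refine Finset.sum_congr rfl fun j _ => ?_
      have := (hv j).ne'
      simp only [Pi.add_apply]
      field_simp
      ring
    have h2 : ∑ i, -((dataOf f D i).2 - synth B (a₀ + b) (D i).1) ^ 2 / (2 * σ ^ 2)
        = ∑ i, -(h (D i).1 + (D i).2) ^ 2 / (2 * σ ^ 2)
          - ∑ i, synth B b (D i).1 ^ 2 / σ ^ 2 / 2
          + ∑ i, (h (D i).1 + (D i).2) * synth B b (D i).1 / σ ^ 2 := by
      rw [← Finset.sum_sub_distrib, ← Finset.sum_add_distrib]
      refine Finset.sum_congr rfl fun i _ => ?_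
      simp only [dataOf, synth_add, hf]
      field_simp
      ring
    rw [h1, h2]
    ring

/-- The likelihood is already quadratic with curvature `n/σ²`, so no Gram event is needed; half of
the curvature is given away to get the same bound as in regression. The score now contains the
sampling fluctuation of the whole signal. -/
theorem harmonic_posterior_tail_le (hd : 1 ≤ d) {κ α σ : ℝ} (hκ : 0 < κ) (hσ : 0 < σ)
    {f : Sph d → ℝ} {n : ℕ} (hn : 0 < n) {D : Fin n → Sph d × ℝ} {r : ℝ}
    (hS : ∑ j, partialSum (responseDev B f L) D j ^ 2 ≤ (n * r / 32) ^ 2)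
    (hT : ∑ j : Idx d L, (coeffVec B f L j / priorVar d κ α j.1) ^ 2
      ≤ (n * r / (32 * σ ^ 2)) ^ 2) :
    bayes (maternPrior d κ α L) (harmonicLik B σ (dataOf f D))
        {a | r ^ 2 < ∑ j, (a j - coeffVec B f L j) ^ 2}
      ≤ ENNReal.ofReal (Real.sqrt 2 ^ Fintype.card (Idx d L)
          * Real.exp (-(n * r ^ 2 / (16 * σ ^ 2)))) := by
  have hn' : (0 : ℝ) < n := by exact_mod_cast hn
  have hv : ∀ j : Idx d L, 0 < priorVar d κ α j.1 := fun j => priorVar_pos hd hκ α _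
  rw [maternPrior]
  change bayes (Measure.pi fun j : Idx d L => gaussianReal 0 (priorVar d κ α j.1).toNNReal) _ _ ≤ _
  rw [pi_gaussianReal_eq_withDensity hv]
  have hexp : (n : ℝ) * r ^ 2 / (16 * σ ^ 2) = (n / (2 * σ ^ 2)) * r ^ 2 / 8 := by
    field_simp
    ring
  rw [hexp]
  have hemp : ∀ j : Idx d L, empCoeff B (dataOf f D) j.1 j.2
      = coeffVec B f L j + partialSum (responseDev B f L) D j / n := by
    intro j
    simp only [empCoeff, dataOf, partialSum, responseDev, Finset.sum_sub_distrib, Finset.sum_const,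
      Finset.card_univ, Fintype.card_fin, nsmul_eq_mul, mul_comm (B.Y _ _ _)]
    field_simp
    ring
  set a₀ := coeffVec B f L with ha₀
  refine bayes_tail_le_of_exponents
    (e₁ := fun a => ∑ j, -(a j - 0) ^ 2 / (2 * priorVar d κ α j.1))
    (e₂ := fun a => ∑ j : Idx d L,
      -(empCoeff B (dataOf f D) j.1 j.2 - a j) ^ 2 / (2 * (σ ^ 2 / n)))
    (q := fun b => ∑ j, b j ^ 2 / priorVar d κ α j.1 + n / σ ^ 2 * ∑ j, b j ^ 2)
    (g := fun j => partialSum (responseDev B f L) D j / σ ^ 2 - a₀ j / priorVar d κ α j.1)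
    (c₀ := ∑ j, -(a₀ j) ^ 2 / (2 * priorVar d κ α j.1)
      + ∑ j, -(partialSum (responseDev B f L) D j / n) ^ 2 / (2 * (σ ^ 2 / n)))
    (by fun_prop) (by fun_prop) (fun a => prod_gaussianPDF hv (fun _ => 0) a)
    (fun a => prod_gaussianPDF (fun _ => by positivity) a
      (fun j => empCoeff B (dataOf f D) j.1 j.2)) (by fun_prop) ?_ (by positivity) ?_ ?_ ?_
  · intro s b
    simp only [Pi.smul_apply, smul_eq_mul, mul_pow, mul_add, Finset.mul_sum, mul_div_assoc]
    congr 1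
    exact Finset.sum_congr rfl fun j _ => by ring
  · intro b
    have h2 : 0 ≤ ∑ j : Idx d L, b j ^ 2 / priorVar d κ α j.1 :=
      Finset.sum_nonneg fun j _ => div_nonneg (sq_nonneg _) (hv j).le
    have h0 : 0 ≤ ∑ j, b j ^ 2 := Finset.sum_nonneg fun j _ => sq_nonneg _
    have h3 : n / (2 * σ ^ 2) * ∑ j, b j ^ 2 = (n / σ ^ 2 * ∑ j, b j ^ 2) / 2 := by
      field_simp
    have h4 : 0 ≤ n / σ ^ 2 * ∑ j, b j ^ 2 := by positivity
    rw [h3]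
    linarith
  · refine sum_sub_sq_le ?_ ?_
    · simp only [div_pow]
      rw [← Finset.sum_div]
      refine (div_le_div_of_nonneg_right hS (by positivity)).trans_eq ?_
      field_simp
      ring
    · refine hT.trans_eq ?_
      field_simp
      ring
  · intro b
    simp only [sub_mul, Finset.sum_sub_distrib]
    rw [neg_div, add_div, Finset.sum_div]
    have h1 : ∑ j, -((a₀ + b) j - 0) ^ 2 / (2 * priorVar d κ α j.1)
        = ∑ j, -(a₀ j) ^ 2 / (2 * priorVar d κ α j.1)
          - ∑ j, b j ^ 2 / priorVar d κ α j.1 / 2 - ∑ j, a₀ j / priorVar d κ α j.1 * b j := by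
      rw [← Finset.sum_sub_distrib, ← Finset.sum_sub_distrib]
      refine Finset.sum_congr rfl fun j _ => ?_
      have := (hv j).ne'
      simp only [Pi.add_apply]
      field_simp
      ring
    have h2 : ∑ j : Idx d L,
          -(empCoeff B (dataOf f D) j.1 j.2 - (a₀ + b) j) ^ 2 / (2 * (σ ^ 2 / n))
        = ∑ j, -(partialSum (responseDev B f L) D j / n) ^ 2 / (2 * (σ ^ 2 / n))
          - n / σ ^ 2 * (∑ j, b j ^ 2) / 2
          + ∑ j, partialSum (responseDev B f L) D j / σ ^ 2 * b j := by
      rw [Finset.mul_sum, Finset.sum_div, ← Finset.sum_sub_distrib, ← Finset.sum_add_distrib]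
      refine Finset.sum_congr rfl fun j _ => ?_
      simp only [hemp, Pi.add_apply]
      field_simp
      ring
    rw [h1, h2]
    ring

theorem coeffVec_sub_synth {f : Sph d → ℝ} (hf : MemLp f 2 (unif d)) (j : Idx d L) :
    coeffVec B (fun x => f x - synth B (coeffVec B f L) x) L j = 0 := by
  have i1 : Integrable (fun x => f x * B.Y j.1 j.2 x) (unif d) :=
    hf.integrable_mul (memLp_of_continuous (continuous_Y B _ _) 2)
  have i2 := integrable_mul_of_continuous (continuous_synth B (coeffVec B f L))
    (continuous_Y B j.1 j.2)
  have hY : synth B (Pi.single j 1) = B.Y j.1 j.2 := by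
    ext x
    rw [synth, Finset.sum_eq_single j]
    · simp
    · intro k _ hk
      rw [Pi.single_eq_of_ne hk, zero_mul]
    · simp
  simp only [coeffVec, coeff, sub_mul]
  rw [integral_sub i1 i2]
  have h := integral_synth_mul_synth B (coeffVec B f L) (Pi.single j 1)
  rw [hY] at h
  change coeffVec B f L j - _ = 0
  rw [h]
  simp [Pi.single_apply]

/-- By Pythagoras, truncation and coefficient errors of at most `r²` each keep the total below
`(2r)²`. -/
theorem farSet_subset {f : Sph d → ℝ} (hf : MemLp f 2 (unif d)) {r : ℝ} (hr : 0 ≤ r)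
    (hh : ∫ x, (f x - synth B (coeffVec B f L) x) ^ 2 ∂(unif d) ≤ r ^ 2) :
    farSet B f L (2 * r) ⊆ {a | r ^ 2 < ∑ j, (a j - coeffVec B f L j) ^ 2} := by
  intro a ha
  by_contra hna
  simp only [Set.mem_ofPred_eq, not_lt] at hna
  have hfar : ENNReal.ofReal (2 * r) < eLpNorm (fun x => synth B a x - f x) 2 (unif d) := ha
  refine absurd hfar (not_lt.mpr ?_)
  have hm : MemLp (fun x => synth B a x - f x) 2 (unif d) :=
    (memLp_of_continuous (continuous_synth B a) 2).sub hf
  rw [eLpNorm_two_le_iff hm (by positivity)]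
  have h1 := integral_sub_synth_sq B hf a
  have h2 := integral_sub_synth_sq B hf (coeffVec B f L)
  simp only [sub_self, ne_eq, OfNat.ofNat_ne_zero, not_false_eq_true, zero_pow,
    Finset.sum_const_zero, add_zero] at h2
  have h3 : ∀ x, (synth B a x - f x) ^ 2 = (f x - synth B a x) ^ 2 := fun x => by ring
  simp only [h3]
  rw [h1, ← h2]
  nlinarith [sq_nonneg r]

end PosteriorTail

end SphereMatern

namespace SphereMatern

/-! ### Comparison of the powers of `n`. -/

section Rates

theorem tendsto_zero_of_forall_eventually_le {f : ℕ → ℝ≥0∞}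
    (h : ∀ e : ℝ, 0 < e → ∀ᶠ n in atTop, f n ≤ ENNReal.ofReal e) : Tendsto f atTop (𝓝 0) := by
  rw [ENNReal.tendsto_nhds_zero]
  intro ε hε
  obtain ⟨e, he, heε⟩ := ENNReal.lt_iff_exists_real_btwn.mp hε
  have he0 : 0 < e := ENNReal.ofReal_pos.mp heε.1
  exact (h e he0).mono fun n hn => hn.trans heε.2.le

theorem eventually_le_ofReal {g : ℕ → ℝ} (hg : Tendsto g atTop (𝓝 0)) {e : ℝ} (he : 0 < e) :
    ∀ᶠ n in atTop, ENNReal.ofReal (g n) ≤ ENNReal.ofReal e :=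
  (hg.eventually (ge_mem_nhds he)).mono fun _ hn => ENNReal.ofReal_le_ofReal hn

variable {d : ℕ} {α β : ℝ} {L : ℕ → ℕ}

theorem exists_level_bounds
    (hL : (fun n : ℕ => (L n : ℝ)) =Θ[atTop] (fun n : ℕ => (n : ℝ) ^ (1 / (2 * α + d)))) :
    ∃ c : ℝ, 0 < c ∧ ∀ᶠ n : ℕ in atTop, (L n : ℝ) ≤ c * (n : ℝ) ^ (1 / (2 * α + d)) ∧
      (n : ℝ) ^ (1 / (2 * α + d)) ≤ c * L n := by
  obtain ⟨c₁, h₁, b₁⟩ := hL.1.exists_pos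
  obtain ⟨c₂, h₂, b₂⟩ := hL.2.exists_pos
  refine ⟨max c₁ c₂, lt_max_of_lt_left h₁, ?_⟩
  filter_upwards [b₁.bound, b₂.bound] with n k₁ k₂
  have hp : 0 ≤ (n : ℝ) ^ (1 / (2 * α + d)) := Real.rpow_nonneg n.cast_nonneg _
  rw [Real.norm_of_nonneg (Nat.cast_nonneg _), Real.norm_of_nonneg hp] at k₁
  rw [Real.norm_of_nonneg hp, Real.norm_of_nonneg (Nat.cast_nonneg _)] at k₂
  exact ⟨k₁.trans (mul_le_mul_of_nonneg_right (le_max_left _ _) hp),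
    k₂.trans (mul_le_mul_of_nonneg_right (le_max_right _ _) (Nat.cast_nonneg _))⟩

theorem one_le_rpow_level (hα : 0 < α) {n : ℕ} (hn : 1 ≤ n) :
    1 ≤ (n : ℝ) ^ (1 / (2 * α + d)) :=
  Real.one_le_rpow (by exact_mod_cast hn) (by positivity)

theorem eventually_card_le (B : HarmonicBasis d) (hα : 0 < α) {c : ℝ}
    (hL : ∀ᶠ n : ℕ in atTop, (L n : ℝ) ≤ c * (n : ℝ) ^ (1 / (2 * α + d))) :
    ∀ᶠ n : ℕ in atTop, (Fintype.card (Idx d (L n)) : ℝ)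
      ≤ 2 * (c + 1) ^ d * (n : ℝ) ^ ((d : ℝ) / (2 * α + d)) := by
  filter_upwards [hL, eventually_ge_atTop 1] with n hn hn1
  have h1 := one_le_rpow_level (d := d) hα hn1
  have h2 : (L n : ℝ) + 1 ≤ (c + 1) * (n : ℝ) ^ (1 / (2 * α + d)) := by linarith
  have h3 : (Fintype.card (Idx d (L n)) : ℝ) ≤ 2 * ((L n : ℝ) + 1) ^ d := by
    exact_mod_cast card_Idx_le B (L n)
  refine h3.trans ?_
  rw [mul_assoc]
  refine mul_le_mul_of_nonneg_left ((pow_le_pow_left₀ (by positivity) h2 d).trans_eq ?_) zero_le_two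
  rw [mul_pow, ← Real.rpow_natCast ((n : ℝ) ^ (1 / (2 * α + d))), ← Real.rpow_mul n.cast_nonneg]
  congr 2
  ring

theorem tendsto_dimension_rate (hd : 1 ≤ d) (hα : 0 < α) :
    Tendsto (fun n : ℕ => (n : ℝ) ^ ((d : ℝ) / (2 * α + d))) atTop atTop := by
  have : (0 : ℝ) < d := by exact_mod_cast hd
  exact (tendsto_rpow_atTop (by positivity)).comp tendsto_natCast_atTop_atTop

/-- The exponents compare as `d ≤ 2α + d - 2β`, which is `β ≤ α`. -/
theorem dimension_rate_le (hα : 0 < α) (hβα : β ≤ α) {n : ℕ} (hn : 1 ≤ n) :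
    (n : ℝ) ^ ((d : ℝ) / (2 * α + d)) ≤ n * ((n : ℝ) ^ (-β / (2 * α + d))) ^ 2 := by
  have hn' : (0 : ℝ) < n := by exact_mod_cast hn
  have hδ : 0 < 2 * α + d := by positivity
  rw [← Real.rpow_natCast ((n : ℝ) ^ (-β / (2 * α + d))), ← Real.rpow_mul hn'.le]
  nth_rewrite 2 [← Real.rpow_one (n : ℝ)]
  rw [← Real.rpow_add hn']
  refine Real.rpow_le_rpow_of_exponent_le (by exact_mod_cast hn) ?_
  rw [div_le_iff₀ hδ]
  push_cast
  have : (1 + -β / (2 * α + d) * 2) * (2 * α + d) = 2 * α + d - 2 * β := by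
    field_simp
    ring
  rw [this]
  linarith

/-- The exponent is `(d - 2α)/(2α + d)`, negative exactly because `α > d/2`. -/
theorem tendsto_dimension_rate_sq_div (hα : (d : ℝ) / 2 < α) :
    Tendsto (fun n : ℕ => ((n : ℝ) ^ ((d : ℝ) / (2 * α + d))) ^ 2 / n) atTop (𝓝 0) := by
  have hd0 : (0 : ℝ) ≤ d := d.cast_nonneg
  have hδ : 0 < 2 * α + d := by linarith
  have hexp : 0 < (2 * α - d) / (2 * α + d) := div_pos (by linarith) hδ
  refine ((tendsto_rpow_neg_atTop hexp).comp tendsto_natCast_atTop_atTop).congr' ?_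
  filter_upwards [eventually_ge_atTop 1] with n hn
  have hn' : (0 : ℝ) < n := by exact_mod_cast hn
  simp only [Function.comp]
  rw [← Real.rpow_natCast ((n : ℝ) ^ _), ← Real.rpow_mul hn'.le]
  nth_rewrite 3 [← Real.rpow_one (n : ℝ)]
  rw [← Real.rpow_sub hn']
  congr 1
  field_simp
  push_cast
  ring

theorem eventually_truncation_le (hd : 1 ≤ d) (B : HarmonicBasis d) (hβ : 0 < β)
    {f : Sph d → ℝ} (hf : InSobolev B β f) {c : ℝ} (hc : 0 < c)
    (hL : ∀ᶠ n : ℕ in atTop, (n : ℝ) ^ (1 / (2 * α + d)) ≤ c * L n) :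
    ∀ᶠ n : ℕ in atTop,
      ∫ x, (f x - synth B (coeffVec B f (L n)) x) ^ 2 ∂(unif d)
        ≤ (c ^ 2) ^ β * sobolevSq B β f * ((n : ℝ) ^ (-β / (2 * α + d))) ^ 2 := by
  filter_upwards [hL, eventually_ge_atTop 1] with n hn hn1
  have hn' : (0 : ℝ) < n := by exact_mod_cast hn1
  refine (integral_truncation_sq_le hd B hβ hf (L n)).trans ?_
  have hS := sobolevSq_nonneg hd B β f
  have hp : 0 < (n : ℝ) ^ (1 / (2 * α + d)) := Real.rpow_pos_of_pos hn' _
  have h1 : ((n : ℝ) ^ (1 / (2 * α + d))) ^ 2 / c ^ 2 ≤ ((L n : ℝ) + 1) ^ 2 := by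
    rw [← div_pow]
    refine pow_le_pow_left₀ (by positivity) ?_ 2
    rw [div_le_iff₀ hc]
    nlinarith
  have h2 : (((L n : ℝ) + 1) ^ 2) ^ (-β)
      ≤ (((n : ℝ) ^ (1 / (2 * α + d))) ^ 2 / c ^ 2) ^ (-β) :=
    Real.rpow_le_rpow_of_nonpos (by positivity) h1 (by linarith)
  have h3 : (((n : ℝ) ^ (1 / (2 * α + d))) ^ 2 / c ^ 2) ^ (-β)
      = (c ^ 2) ^ β * ((n : ℝ) ^ (-β / (2 * α + d))) ^ 2 := by
    rw [Real.div_rpow (by positivity) (by positivity), Real.rpow_neg (by positivity : 0 ≤ c ^ 2),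
      div_inv_eq_mul, mul_comm]
    congr 1
    rw [← Real.rpow_natCast, ← Real.rpow_natCast, ← Real.rpow_mul hn'.le, ← Real.rpow_mul hn'.le,
      ← Real.rpow_mul hn'.le]
    congr 1
    push_cast
    ring
  rw [h3] at h2
  refine (mul_le_mul_of_nonneg_right h2 hS).trans_eq ?_
  ring

/-- Dividing by the prior variance multiplies the squared coefficient by about `(1 + λ)^{2α}`. The
Sobolev sum pays for `(1 + λ)^β`, and the positive power `2α - β` left over is largest at the level
`L n`. -/
theorem eventually_prior_bias_le (hd : 1 ≤ d) (B : HarmonicBasis d) (hα : 0 < α) (hβα : β ≤ α)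
    (κ : ℝ) {f : Sph d → ℝ} (hf : InSobolev B β f) {c : ℝ} (hc : 0 < c)
    (hL : ∀ᶠ n : ℕ in atTop, (L n : ℝ) ≤ c * (n : ℝ) ^ (1 / (2 * α + d))) :
    ∃ C : ℝ, 0 ≤ C ∧ ∀ᶠ n : ℕ in atTop,
      ∑ j : Idx d (L n), (coeffVec B f (L n) j / priorVar d κ α j.1) ^ 2
        ≤ C * (n * (n : ℝ) ^ (-β / (2 * α + d))) ^ 2 := by
  have hS := sobolevSq_nonneg hd B β f
  refine ⟨(κ ^ 2 + 1) ^ (2 * α) * ((d + 1) * (c + 1) ^ 2) ^ (2 * α - β) * sobolevSq B β f,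
    by positivity, ?_⟩
  filter_upwards [hL, eventually_ge_atTop 1] with n hn hn1
  have hn' : (0 : ℝ) < n := by exact_mod_cast hn1
  have hn1' : (1 : ℝ) ≤ n := by exact_mod_cast hn1
  have hδ : 0 < 2 * α + d := by positivity
  set p := (n : ℝ) ^ (1 / (2 * α + d)) with hp
  have hp1 : 1 ≤ p := one_le_rpow_level hα hn1
  have hd' : (1 : ℝ) ≤ d := by exact_mod_cast hd
  have hK : 1 + lam d (L n) ≤ ((d + 1) * (c + 1) ^ 2) * p ^ 2 := by
    have h1 : (L n : ℝ) + 1 ≤ (c + 1) * p := by linarith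
    have h2 : 1 + lam d (L n) ≤ (d + 1) * ((L n : ℝ) + 1) ^ 2 := by
      have h0 : (0 : ℝ) ≤ L n := Nat.cast_nonneg _
      rw [lam]
      nlinarith [mul_nonneg h0 (by linarith : (0 : ℝ) ≤ d)]
    have h3 := pow_le_pow_left₀ (by positivity) h1 2
    calc 1 + lam d (L n) ≤ (d + 1) * ((L n : ℝ) + 1) ^ 2 := h2
      _ ≤ (d + 1) * ((c + 1) * p) ^ 2 := by gcongr
      _ = _ := by ring
  have hterm : ∀ j : Idx d (L n), (coeffVec B f (L n) j / priorVar d κ α j.1) ^ 2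
      ≤ (κ ^ 2 + 1) ^ (2 * α) * (((d + 1) * (c + 1) ^ 2) * p ^ 2) ^ (2 * α - β)
        * ((1 + lam d j.1) ^ β * coeffVec B f (L n) j ^ 2) := by
    intro j
    have hl := lam_nonneg hd j.1
    have hjL : lam d j.1 ≤ lam d (L n) := lam_mono hd (by omega)
    have h1 : (coeffVec B f (L n) j / priorVar d κ α j.1) ^ 2
        = (κ ^ 2 + lam d j.1) ^ (2 * α) * coeffVec B f (L n) j ^ 2 := by
      rw [priorVar, Real.rpow_neg (by positivity), div_inv_eq_mul, mul_pow,
        ← Real.rpow_natCast ((κ ^ 2 + lam d j.1) ^ α), ← Real.rpow_mul (by positivity)]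
      push_cast
      rw [mul_comm α 2, mul_comm]
    have h2 : (κ ^ 2 + lam d j.1) ^ (2 * α)
        ≤ (κ ^ 2 + 1) ^ (2 * α) * (1 + lam d j.1) ^ (2 * α) := by
      rw [← Real.mul_rpow (by positivity) (by positivity)]
      refine Real.rpow_le_rpow (by positivity) ?_ (by positivity)
      nlinarith [mul_nonneg (sq_nonneg κ) hl]
    have h3 : (1 + lam d j.1) ^ (2 * α)
        = (1 + lam d j.1) ^ (2 * α - β) * (1 + lam d j.1) ^ β := by
      rw [← Real.rpow_add (by positivity), sub_add_cancel]
    have h4 : (1 + lam d j.1) ^ (2 * α - β)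
        ≤ (((d + 1) * (c + 1) ^ 2) * p ^ 2) ^ (2 * α - β) :=
      Real.rpow_le_rpow (by positivity) (by linarith) (by linarith)
    have h5 : 0 ≤ (1 + lam d j.1) ^ β := Real.rpow_nonneg (by positivity) _
    rw [h1]
    calc (κ ^ 2 + lam d j.1) ^ (2 * α) * coeffVec B f (L n) j ^ 2
        ≤ ((κ ^ 2 + 1) ^ (2 * α) * ((1 + lam d j.1) ^ (2 * α - β) * (1 + lam d j.1) ^ β))
          * coeffVec B f (L n) j ^ 2 := by
          rw [← h3]
          gcongr
      _ ≤ ((κ ^ 2 + 1) ^ (2 * α) * ((((d + 1) * (c + 1) ^ 2) * p ^ 2) ^ (2 * α - β)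
          * (1 + lam d j.1) ^ β)) * coeffVec B f (L n) j ^ 2 := by gcongr
      _ = _ := by ring
  refine (Finset.sum_le_sum fun j _ => hterm j).trans ?_
  rw [← Finset.mul_sum]
  refine (mul_le_mul_of_nonneg_left (sum_weighted_coeffVec_le hd B hf (L n))
    (by positivity)).trans ?_
  rw [Real.mul_rpow (by positivity) (by positivity)]
  have h6 : (p ^ 2) ^ (2 * α - β) ≤ (n * (n : ℝ) ^ (-β / (2 * α + d))) ^ 2 := by
    have e0 : (n : ℝ) * (n : ℝ) ^ (-β / (2 * α + d)) = (n : ℝ) ^ (1 + -β / (2 * α + d)) := by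
      rw [Real.rpow_add hn', Real.rpow_one]
    rw [e0, hp, ← Real.rpow_natCast, ← Real.rpow_natCast, ← Real.rpow_mul hn'.le,
      ← Real.rpow_mul hn'.le, ← Real.rpow_mul hn'.le]
    refine Real.rpow_le_rpow_of_exponent_le hn1' ?_
    push_cast
    have e1 : 1 / (2 * α + d) * 2 * (2 * α - β) = (4 * α - 2 * β) / (2 * α + d) := by ring
    have e2 : (1 + -β / (2 * α + d)) * 2 = (4 * α + 2 * d - 2 * β) / (2 * α + d) := by
      field_simp
      ring
    rw [e1, e2]
    exact div_le_div_of_nonneg_right (by linarith) hδ.le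
  calc _ = ((κ ^ 2 + 1) ^ (2 * α) * ((d + 1) * (c + 1) ^ 2) ^ (2 * α - β) * sobolevSq B β f)
        * (p ^ 2) ^ (2 * α - β) := by ring
    _ ≤ _ := mul_le_mul_of_nonneg_left h6 (by positivity)

end Rates

/-! ### The score is of order `√(n N)` with probability tending to one. -/

section NoiseLimit

variable {d : ℕ} (B : HarmonicBasis d)

/-- All the noise stays with the bounded part `g`; the remainder `u - g` enters without noise. -/
theorem responseDev_eq_add {u g : Sph d → ℝ} (hu : MemLp u 2 (unif d)) (hg : MemLp g 2 (unif d))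
    {L : ℕ} (z : Sph d × ℝ) (j : Idx d L) :
    responseDev B u L z j = responseDev B g L z j + signalDev B (fun x => u x - g x) L z j := by
  have hc : coeffVec B (fun x => u x - g x) L j = coeffVec B u L j - coeffVec B g L j := by
    simp only [coeffVec, coeff, sub_mul]
    exact integral_sub (hu.integrable_mul (memLp_of_continuous (continuous_Y B _ _) 2))
      (hg.integrable_mul (memLp_of_continuous (continuous_Y B _ _) 2))
  simp only [responseDev, signalDev, hc]
  ring

theorem sum_partialSum_response_sq_le {u g : Sph d → ℝ} (hu : MemLp u 2 (unif d))
    (hg : MemLp g 2 (unif d)) {L n : ℕ} (D : Fin n → Sph d × ℝ) :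
    ∑ j, partialSum (responseDev B u L) D j ^ 2
      ≤ 2 * ∑ j, partialSum (responseDev B g L) D j ^ 2
        + 2 * ∑ j, partialSum (signalDev B (fun x => u x - g x) L) D j ^ 2 := by
  rw [Finset.mul_sum, Finset.mul_sum, ← Finset.sum_add_distrib]
  refine Finset.sum_le_sum fun j _ => ?_
  have h : partialSum (responseDev B u L) D j = partialSum (responseDev B g L) D j
      + partialSum (signalDev B (fun x => u x - g x) L) D j := by
    simp only [partialSum, responseDev_eq_add B hu hg, Finset.sum_add_distrib]
  rw [h]
  nlinarith [sq_nonneg (partialSum (responseDev B g L) D j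
    - partialSum (signalDev B (fun x => u x - g x) L) D j)]

/-- For fixed bounded `g`, Chebyshev gives a vanishing probability. The remainder contributes at
most `C ‖u n - g‖²` by Markov, which the choice of `g` makes small. The threshold depends only on
`C`, `C₀` and `σ`, not on `g`, so a fixed `M` suffices. -/
theorem tendsto_measure_response_gt {u : ℕ → Sph d → ℝ} (hum : ∀ n, Measurable (u n))
    (hu : ∀ n, MemLp (u n) 2 (unif d)) (σ : ℝ) {L : ℕ → ℕ} {N : ℕ → ℝ} {C C₀ : ℝ} (hC : 0 ≤ C)
    (hN : Tendsto N atTop atTop)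
    (hJ : ∀ᶠ n in atTop, (Fintype.card (Idx d (L n)) : ℝ) ≤ C * N n)
    (happ : ∀ ε : ℝ, 0 < ε → ∃ (g : Sph d → ℝ) (T : ℝ), Measurable g ∧ (∀ x, |g x| ≤ T) ∧
      ∫ x, g x ^ 2 ∂(unif d) ≤ C₀ ∧ ∀ᶠ n in atTop, ∫ x, (u n x - g x) ^ 2 ∂(unif d) ≤ ε) :
    Tendsto (fun n => Measure.pi (fun _ : Fin n => obsLaw d σ)
      {D | (2 * (C * (C₀ + σ ^ 2)) + 4) * N n * n
        < ∑ j : Idx d (L n), partialSum (responseDev B (u n) (L n)) D j ^ 2}) atTop (𝓝 0) := by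
  refine tendsto_zero_of_forall_eventually_le fun e he => ?_
  obtain ⟨g, T, hgm, hgT, hgC, hug⟩ := happ (e / 2 / (C + 1)) (by positivity)
  have hgL : MemLp g 2 (unif d) := MemLp.of_bound hgm.aestronglyMeasurable T (ae_of_all _ hgT)
  have hg0 : 0 ≤ ∫ x, g x ^ 2 ∂(unif d) := integral_nonneg fun x => sq_nonneg _
  obtain ⟨C', hC', hresp⟩ := measure_response_gt_le B hgm hgT σ
  have hlim : Tendsto (fun n : ℕ => C' * (C / N n + (C ^ 2 + 1) / n)) atTop (𝓝 0) := by
    have h1 : Tendsto (fun n : ℕ => C / N n) atTop (𝓝 0) := hN.const_div_atTop C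
    have h2 : Tendsto (fun n : ℕ => (C ^ 2 + 1) / (n : ℝ)) atTop (𝓝 0) :=
      tendsto_natCast_atTop_atTop.const_div_atTop _
    simpa using (h1.add h2).const_mul C'
  filter_upwards [hJ, hug, hN.eventually_ge_atTop 1, eventually_ge_atTop 1,
    eventually_le_ofReal hlim (half_pos he)] with n hJn hun hNn hn hlimn
  have hn' : (0 : ℝ) < n := by exact_mod_cast hn
  have hN0 : 0 < N n := by linarith
  have hJ0 : (0 : ℝ) ≤ Fintype.card (Idx d (L n)) := Nat.cast_nonneg _
  have ht : 0 < N n * n := by positivity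
  -- From `|S_u|² ≤ 2|S_g|² + 2|S_{u-g}|²`: the mean of `|S_g|²` gives the first term of the
  -- constant, and the two deviations of size `N n * n` give the `4`.
  have hsub : {D : Fin n → Sph d × ℝ | (2 * (C * (C₀ + σ ^ 2)) + 4) * N n * n
        < ∑ j : Idx d (L n), partialSum (responseDev B (u n) (L n)) D j ^ 2}
      ⊆ {D | n * (Fintype.card (Idx d (L n)) * (∫ x, g x ^ 2 ∂(unif d) + σ ^ 2)) + N n * n
          < ∑ j : Idx d (L n), partialSum (responseDev B g (L n)) D j ^ 2}
        ∪ {D | N n * n < ∑ j : Idx d (L n),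
          partialSum (signalDev B (fun x => u n x - g x) (L n)) D j ^ 2} := by
    intro D hD
    by_contra hnot
    simp only [Set.mem_union, Set.mem_ofPred_eq, not_or, not_lt] at hnot
    have hD' : (2 * (C * (C₀ + σ ^ 2)) + 4) * N n * n
      < ∑ j : Idx d (L n), partialSum (responseDev B (u n) (L n)) D j ^ 2 := hD
    have h1 := sum_partialSum_response_sq_le B (hu n) hgL (L := L n) D
    have h2 : n * (Fintype.card (Idx d (L n)) * (∫ x, g x ^ 2 ∂(unif d) + σ ^ 2))
        ≤ n * ((C * N n) * (C₀ + σ ^ 2)) := by gcongr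
    linarith [hnot.1, hnot.2]
  refine (measure_mono hsub).trans ((measure_union_le _ _).trans ?_)
  rw [← add_halves e, ENNReal.ofReal_add (by positivity) (by positivity)]
  refine add_le_add ((hresp (L n) n (N n * n) ht).trans
    ((ENNReal.ofReal_le_ofReal ?_).trans hlimn)) ((measure_signal_gt_le B ((hum n).sub hgm)
      ((hu n).sub hgL) σ n ht).trans (ENNReal.ofReal_le_ofReal ?_))
  · rw [mul_div_assoc]
    refine mul_le_mul_of_nonneg_left ?_ hC'
    calc ((n : ℝ) ^ 2 * Fintype.card (Idx d (L n))
          + n * ((Fintype.card (Idx d (L n)) : ℝ) ^ 2 + 1)) / (N n * n) ^ 2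
        ≤ ((n : ℝ) ^ 2 * (C * N n) + n * ((C * N n) ^ 2 + N n ^ 2)) / (N n * n) ^ 2 := by
          have : (1 : ℝ) ≤ N n ^ 2 := by nlinarith
          gcongr
      _ = C / N n + (C ^ 2 + 1) / n := by
          field_simp
  · simp only [Pi.sub_apply]
    have h0 : 0 ≤ ∫ x, (u n x - g x) ^ 2 ∂(unif d) := integral_nonneg fun x => sq_nonneg _
    rw [div_le_iff₀ ht]
    have h1 : (Fintype.card (Idx d (L n)) : ℝ) * ∫ x, (u n x - g x) ^ 2 ∂(unif d)
        ≤ (C * N n) * (e / 2 / (C + 1)) := mul_le_mul hJn hun h0 (by positivity)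
    have h2 : (C * N n) * (e / 2 / (C + 1)) ≤ e / 2 * N n := by
      rw [mul_div_assoc', div_le_iff₀ (by positivity)]
      have : 0 ≤ e / 2 * N n := by positivity
      linarith
    have h3 := mul_le_mul_of_nonneg_left (h1.trans h2) hn'.le
    linarith

end NoiseLimit

end SphereMatern

namespace SphereMatern

/-! ### Assembly of the contraction theorem. -/

section Contraction

variable {d : ℕ}

theorem dataLaw_eq_map {f : Sph d → ℝ} (hf : Measurable f) (σ : ℝ) (n : ℕ) :
    dataLaw f σ n = (Measure.pi fun _ : Fin n => obsLaw d σ).map (dataOf f) := by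
  let g : Sph d × ℝ → Sph d × ℝ := fun p => (p.1, f p.1 + p.2)
  have hm : Measurable g := measurable_fst.prodMk ((hf.comp measurable_fst).add measurable_snd)
  have hp : IsFiniteMeasure ((obsLaw d σ).map g) := inferInstance
  exact (Measure.pi_map_pi (μ := fun _ : Fin n => obsLaw d σ) (f := fun _ => g)
    (hμ := fun _ => IsFiniteMeasure.toSigmaFinite _) fun _ => hm.aemeasurable).symm

theorem dataLaw_congr {f g : Sph d → ℝ} (h : f =ᵐ[unif d] g) (σ : ℝ) (n : ℕ) :
    dataLaw f σ n = dataLaw g σ n := by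
  have h' : (fun p : Sph d × ℝ => (p.1, f p.1 + p.2))
      =ᵐ[(unif d).prod (gaussianReal 0 (σ ^ 2).toNNReal)] fun p => (p.1, g p.1 + p.2) := by
    filter_upwards [Measure.quasiMeasurePreserving_fst.ae_eq_comp h] with p hp
    have : f p.1 = g p.1 := hp
    rw [this]
  simp only [dataLaw, Measure.map_congr h']

theorem coeff_congr (B : HarmonicBasis d) {f g : Sph d → ℝ} (h : f =ᵐ[unif d] g) (ℓ : ℕ)
    (m : Fin (mult d ℓ)) : coeff B f ℓ m = coeff B g ℓ m :=
  integral_congr_ae (by filter_upwards [h] with x hx; rw [hx])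

theorem inSobolev_congr (B : HarmonicBasis d) {β : ℝ} {f g : Sph d → ℝ} (h : f =ᵐ[unif d] g)
    (hf : InSobolev B β f) : InSobolev B β g := by
  refine ⟨hf.1.ae_eq h, ?_⟩
  have := hf.2
  simpa only [coeff_congr B h] using this

theorem farSet_congr (B : HarmonicBasis d) {f g : Sph d → ℝ} (h : f =ᵐ[unif d] g) (L : ℕ)
    (r : ℝ) : farSet B f L r = farSet B g L r := by
  ext a
  have : eLpNorm (fun x => synth B a x - f x) 2 (unif d)
      = eLpNorm (fun x => synth B a x - g x) 2 (unif d) :=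
    eLpNorm_congr_ae (by filter_upwards [h] with x hx; rw [hx])
  simp only [farSet, Set.mem_ofPred_eq, this]

/-- Only the almost-everywhere class of the signal matters, which permits passing to a measurable
representative. -/
theorem contracts_congr (B : HarmonicBasis d) {f g : Sph d → ℝ} (h : f =ᵐ[unif d] g) {σ : ℝ}
    {L : ℕ → ℕ} {post : (n : ℕ) → Data d n → Measure (Idx d (L n) → ℝ)} {ρ : ℕ → ℝ}
    (hf : Contracts B f σ L post ρ) : Contracts B g σ L post ρ := by
  obtain ⟨M₀, hM₀, hM⟩ := hf
  refine ⟨M₀, hM₀, fun M hMM => ?_⟩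
  simpa only [farSet_congr B h, dataLaw_congr h] using hM M hMM

theorem tendsto_lintegral_posterior {f : Sph d → ℝ} (hf : Measurable f) (σ : ℝ) {L : ℕ → ℕ}
    {post : (n : ℕ) → Data d n → Measure (Idx d (L n) → ℝ)}
    (hpost : ∀ n D s, post n D s ≤ 1) {S : (n : ℕ) → Set (Idx d (L n) → ℝ)}
    {bad : (n : ℕ) → Set (Fin n → Sph d × ℝ)} {δ : ℕ → ℝ≥0∞}
    (hbad : Tendsto (fun n => Measure.pi (fun _ : Fin n => obsLaw d σ) (bad n)) atTop (𝓝 0))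
    (hδ : Tendsto δ atTop (𝓝 0))
    (h : ∀ᶠ n in atTop, ∀ D, D ∉ bad n → post n (dataOf f D) (S n) ≤ δ n) :
    Tendsto (fun n => ∫⁻ D, post n D (S n) ∂(dataLaw f σ n)) atTop (𝓝 0) := by
  refine tendsto_of_tendsto_of_tendsto_of_le_of_le' tendsto_const_nhds
    (by simpa using hbad.add hδ) (Eventually.of_forall fun n => bot_le) ?_
  filter_upwards [h] with n hn
  rw [dataLaw_eq_map hf]
  -- This inequality for push-forwards needs no measurability of the posterior mass as a function of
  -- the data.
  refine (lintegral_map_le _ _).trans ?_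
  refine (lintegral_mono (g := fun D => (bad n).indicator 1 D + δ n) fun D => ?_).trans ?_
  · by_cases hD : D ∈ bad n
    · simp only [Set.indicator_of_mem hD, Pi.one_apply]
      exact (hpost _ _ _).trans le_self_add
    · simp only [Set.indicator_of_notMem hD, zero_add]
      exact hn D hD
  · rw [lintegral_add_right _ measurable_const, lintegral_const, measure_univ, mul_one]
    exact add_le_add_left (lintegral_indicator_one_le _) _

/-- Cut `f` to zero where `|f| > k` and use dominated convergence. The cut does not increase the
`L²` norm, so the bound is uniform in `ε`. -/
theorem exists_bounded_approx {f : Sph d → ℝ} (hfm : Measurable f) (hf : MemLp f 2 (unif d))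
    {ε : ℝ} (hε : 0 < ε) :
    ∃ (g : Sph d → ℝ) (T : ℝ), Measurable g ∧ (∀ x, |g x| ≤ T) ∧
      ∫ x, g x ^ 2 ∂(unif d) ≤ ∫ x, f x ^ 2 ∂(unif d) ∧
      ∫ x, (f x - g x) ^ 2 ∂(unif d) ≤ ε := by
  let A : ℕ → Set (Sph d) := fun k => {x | |f x| ≤ k}
  have hA : ∀ k, MeasurableSet (A k) := fun k => measurableSet_le (by fun_prop) measurable_const
  let g : ℕ → Sph d → ℝ := fun k => (A k).indicator f
  have hgm : ∀ k, Measurable (g k) := fun k => hfm.indicator (hA k)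
  have hlim : Tendsto (fun k => ∫ x, (f x - g k x) ^ 2 ∂(unif d)) atTop
      (𝓝 (∫ _, (0 : ℝ) ∂(unif d))) := by
    refine tendsto_integral_of_dominated_convergence (fun x => f x ^ 2)
      (fun k => ((hfm.sub (hgm k)).pow_const 2).aestronglyMeasurable) hf.integrable_sq
      (fun k => ae_of_all _ fun x => ?_) (ae_of_all _ fun x => ?_)
    · by_cases hx : x ∈ A k
      · simp [g, Set.indicator_of_mem hx, sq_nonneg]
      · simp [g, Set.indicator_of_notMem hx]
    · refine tendsto_const_nhds.congr' ?_
      filter_upwards [eventually_ge_atTop (Nat.ceil |f x|)] with k hk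
      have hx' : |f x| ≤ (k : ℝ) := (Nat.le_ceil |f x|).trans (Nat.cast_le.mpr hk)
      have hx : x ∈ A k := hx'
      simp [g, Set.indicator_of_mem hx]
  rw [integral_zero] at hlim
  obtain ⟨k, hk⟩ := (hlim.eventually (ge_mem_nhds hε)).exists
  refine ⟨g k, k, hgm k, fun x => ?_, ?_, hk⟩
  · by_cases hx : x ∈ A k
    · simp only [g, Set.indicator_of_mem hx]
      exact hx
    · simp [g, Set.indicator_of_notMem hx]
  · refine integral_mono_of_nonneg (ae_of_all _ fun x => sq_nonneg _) hf.integrable_sq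
      (ae_of_all _ fun x => ?_)
    by_cases hx : x ∈ A k
    · simp [g, Set.indicator_of_mem hx]
    · simp [g, Set.indicator_of_notMem hx, sq_nonneg]

/-- Since `√2 ≤ e`, the dimensional factor is at most `exp (C N)`, and one further `N` in the
exponent gives the decay. -/
theorem sqrt_two_pow_mul_exp_le {J : ℕ} {C N a : ℝ} (hJ : (J : ℝ) ≤ C * N)
    (ha : (C + 1) * N ≤ a) : Real.sqrt 2 ^ J * Real.exp (-a) ≤ Real.exp (-N) := by
  have h1 : Real.sqrt 2 ≤ Real.exp 1 := by
    have h2 : Real.sqrt 2 ≤ 2 := Real.sqrt_le_iff.mpr ⟨by norm_num, by norm_num⟩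
    have h3 := Real.add_one_le_exp 1
    linarith
  calc Real.sqrt 2 ^ J * Real.exp (-a) ≤ Real.exp 1 ^ J * Real.exp (-a) := by gcongr
    _ = Real.exp (J - a) := by
        rw [← Real.exp_nat_mul, mul_one, ← Real.exp_add, sub_eq_add_neg]
    _ ≤ Real.exp (-N) := Real.exp_le_exp.mpr (by linarith)

theorem tendsto_measure_gram_gt (B : HarmonicBasis d) (σ : ℝ) {L : ℕ → ℕ} {N : ℕ → ℝ} {C : ℝ}
    (hJ : ∀ᶠ n in atTop, (Fintype.card (Idx d (L n)) : ℝ) ≤ C * N n)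
    (hN : Tendsto (fun n => N n ^ 2 / n) atTop (𝓝 0)) :
    Tendsto (fun n => Measure.pi (fun _ : Fin n => obsLaw d σ)
      {D | (n : ℝ) ^ 2 / 4 < ∑ jk, partialSum (gramDev B (L n)) D jk ^ 2}) atTop (𝓝 0) := by
  refine tendsto_zero_of_forall_eventually_le fun e he => ?_
  have hlim : Tendsto (fun n : ℕ => 4 * C ^ 2 * (N n ^ 2 / n)) atTop (𝓝 0) := by
    simpa using hN.const_mul (4 * C ^ 2)
  filter_upwards [hJ, eventually_gt_atTop 0, eventually_le_ofReal hlim he] with n hJn hn hle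
  refine (measure_gram_gt_le B σ hn).trans ((ENNReal.ofReal_le_ofReal ?_).trans hle)
  have h1 := pow_le_pow_left₀ (Nat.cast_nonneg _) hJn 2
  rw [← mul_div_assoc]
  refine div_le_div_of_nonneg_right ?_ (Nat.cast_nonneg n)
  nlinarith

theorem contraction_of_measurable (hd : 1 ≤ d) (B : HarmonicBasis d) {κ α β σ : ℝ} (hκ : 0 < κ)
    (hσ : 0 < σ) (hα : (d : ℝ) / 2 < α) (hβ : 0 < β) (hβα : β ≤ α) {f : Sph d → ℝ}
    (hfm : Measurable f) (hf : InSobolev B β f) {L : ℕ → ℕ}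
    (hL : (fun n : ℕ => (L n : ℝ)) =Θ[atTop] (fun n : ℕ => (n : ℝ) ^ (1 / (2 * α + d)))) :
    Contracts B f σ L
        (fun n D => bayes (maternPrior d κ α (L n)) (regressionLik B σ D))
        (fun n => (n : ℝ) ^ (-β / (2 * α + d))) ∧
      Contracts B f σ L
        (fun n D => bayes (maternPrior d κ α (L n)) (harmonicLik B σ D))
        (fun n => (n : ℝ) ^ (-β / (2 * α + d))) := by
  have hα0 : 0 < α := by linarith
  have hδ : 0 < 2 * α + d := by positivity
  obtain ⟨c, hc, hLc⟩ := exists_level_bounds hL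
  set ρ : ℕ → ℝ := fun n => (n : ℝ) ^ (-β / (2 * α + d)) with hρ
  set N : ℕ → ℝ := fun n => (n : ℝ) ^ ((d : ℝ) / (2 * α + d)) with hNdef
  have hJ := eventually_card_le B hα0 (hLc.mono fun n h => h.1)
  set C : ℝ := 2 * (c + 1) ^ d with hC
  have hC0 : 0 ≤ C := by positivity
  have hN : Tendsto N atTop atTop := tendsto_dimension_rate hd hα0
  have hNρ : ∀ᶠ n : ℕ in atTop, N n ≤ n * ρ n ^ 2 :=
    (eventually_ge_atTop 1).mono fun n hn => dimension_rate_le hα0 hβα hn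
  have hρ0 : Tendsto ρ atTop (𝓝 0) := by
    have h1 : -β / (2 * α + d) = -(β / (2 * α + d)) := by ring
    simp only [hρ, h1]
    exact (tendsto_rpow_neg_atTop (by positivity)).comp tendsto_natCast_atTop_atTop
  have htr := eventually_truncation_le hd B hβ hf hc (hLc.mono fun n h => h.2)
  have hS0 := sobolevSq_nonneg hd B β f
  set C₁ : ℝ := (c ^ 2) ^ β * sobolevSq B β f with hC₁
  have hC₁0 : 0 ≤ C₁ := by positivity
  obtain ⟨C₂, hC₂, hbias⟩ := eventually_prior_bias_le hd B hα0 hβα κ hf hc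
    (hLc.mono fun n h => h.1)
  set C₀ : ℝ := ∫ x, f x ^ 2 ∂(unif d) with hC₀
  have hC₀0 : 0 ≤ C₀ := integral_nonneg fun x => sq_nonneg _
  set K : ℝ := 2 * (C * (C₀ + σ ^ 2)) + 4 with hK
  have hK0 : 0 ≤ K := by positivity
  set h : ℕ → Sph d → ℝ := fun n x => f x - synth B (coeffVec B f (L n)) x with hh
  have hhm : ∀ n, Measurable (h n) := fun n => hfm.sub (continuous_synth B _).measurable
  have hhL : ∀ n, MemLp (h n) 2 (unif d) := fun n =>
    hf.1.sub (memLp_of_continuous (continuous_synth B _) 2)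
  -- In regression the signal is the truncation residual, whose norm tends to zero, so the
  -- approximation is `g = 0`.
  have hnoise₁ := tendsto_measure_response_gt B hhm hhL σ (C₀ := C₀) hC0 hN hJ fun ε hε => by
    refine ⟨fun _ => 0, 0, measurable_const, by simp, by simpa using hC₀0, ?_⟩
    have hlim : Tendsto (fun n => C₁ * ρ n ^ 2) atTop (𝓝 0) := by
      simpa using (hρ0.pow 2).const_mul C₁
    filter_upwards [htr, hlim.eventually (ge_mem_nhds hε)] with n h1 h2
    simp only [sub_zero]
    exact h1.trans h2
  have hnoise₂ := tendsto_measure_response_gt B (u := fun _ => f) (fun _ => hfm) (fun _ => hf.1) σ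
    (C₀ := C₀) hC0 hN hJ fun ε hε => by
      obtain ⟨g, T, h1, h2, h3, h4⟩ := exists_bounded_approx hfm hf.1 hε
      exact ⟨g, T, h1, h2, h3, Eventually.of_forall fun _ => h4⟩
  have hgram := tendsto_measure_gram_gt B σ hJ (tendsto_dimension_rate_sq_div hα)
  have hexp : Tendsto (fun n => ENNReal.ofReal (Real.exp (-N n))) atTop (𝓝 0) := by
    have h1 : Tendsto (fun n => Real.exp (-N n)) atTop (𝓝 0) :=
      Real.tendsto_exp_neg_atTop_nhds_zero.comp hN
    simpa using ENNReal.tendsto_ofReal h1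
  -- With `r = Mρ/2` the summands handle, in order: `M² ≥ M₀` (from `M ≥ 1`), truncation, noise,
  -- prior bias, and the exponent `n r²/(16σ²) ≥ (C+1) N`. Here `4096 = (2·32)²` and `64 = 4·16`.
  set M₀ : ℝ := 1 + 4 * C₁ + 4096 * K + 4096 * σ ^ 4 * C₂ + 64 * σ ^ 2 * (C + 1) with hM₀
  have hb1 : 0 ≤ 4 * C₁ := by positivity
  have hb2 : 0 ≤ 4096 * K := by positivity
  have hb3 : 0 ≤ 4096 * σ ^ 4 * C₂ := by positivity
  have hb4 : 0 ≤ 64 * σ ^ 2 * (C + 1) := by positivity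
  have hM₀1 : 1 ≤ M₀ := by linarith
  have key : ∀ M, M₀ ≤ M → ∀ᶠ n : ℕ in atTop, 0 < n ∧ 0 ≤ M * ρ n / 2 ∧
      (∫ x, h n x ^ 2 ∂(unif d) ≤ (M * ρ n / 2) ^ 2) ∧
      K * N n * n ≤ (n * (M * ρ n / 2) / 32) ^ 2 ∧
      (∑ j : Idx d (L n), (coeffVec B f (L n) j / priorVar d κ α j.1) ^ 2
        ≤ (n * (M * ρ n / 2) / (32 * σ ^ 2)) ^ 2) ∧
      ENNReal.ofReal (Real.sqrt 2 ^ Fintype.card (Idx d (L n))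
          * Real.exp (-(n * (M * ρ n / 2) ^ 2 / (16 * σ ^ 2))))
        ≤ ENNReal.ofReal (Real.exp (-N n)) := by
    intro M hM
    have hM2 : M₀ ≤ M ^ 2 := by nlinarith
    filter_upwards [hJ, hNρ, htr, hbias, eventually_gt_atTop 0] with n h1 h2 h3 h4 hn
    have hn' : (0 : ℝ) < n := by exact_mod_cast hn
    have hρn : 0 ≤ ρ n := Real.rpow_nonneg n.cast_nonneg _
    have hρ2 : 0 ≤ ρ n ^ 2 := sq_nonneg _
    have hM0 : 0 ≤ M := by linarith
    refine ⟨hn, by positivity, h3.trans ?_, ?_, h4.trans ?_, ENNReal.ofReal_le_ofReal ?_⟩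
    · have : 4 * C₁ ≤ M ^ 2 := by linarith
      nlinarith [mul_le_mul_of_nonneg_right this hρ2]
    · have h5 : 4096 * K ≤ M ^ 2 := by linarith
      have h6 : K * N n * n ≤ K * (n * ρ n ^ 2) * n := by gcongr
      have h7 := mul_le_mul_of_nonneg_right h5 (show 0 ≤ (n : ℝ) ^ 2 * ρ n ^ 2 by positivity)
      refine h6.trans ?_
      linarith
    · have h5 : 4096 * σ ^ 4 * C₂ ≤ M ^ 2 := by linarith
      have h6 := mul_le_mul_of_nonneg_right h5 (show 0 ≤ ((n : ℝ) * ρ n) ^ 2 by positivity)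
      rw [div_pow, le_div_iff₀ (by positivity)]
      linarith
    · refine sqrt_two_pow_mul_exp_le h1 ?_
      have h5 : 64 * σ ^ 2 * (C + 1) ≤ M ^ 2 := by linarith
      rw [le_div_iff₀ (by positivity)]
      have h6 : (C + 1) * N n ≤ (C + 1) * (n * ρ n ^ 2) := by gcongr
      have h7 := mul_le_mul_of_nonneg_right h6 (show 0 ≤ 16 * σ ^ 2 by positivity)
      have h8 := mul_le_mul_of_nonneg_right h5 (show 0 ≤ (n : ℝ) * ρ n ^ 2 by positivity)
      linarith
  have hprob : ∀ n, SFinite (maternPrior d κ α (L n)) := fun n => by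
    unfold maternPrior
    infer_instance
  have hfar : ∀ (M : ℝ) n, 0 ≤ M * ρ n / 2 →
      ∫ x, h n x ^ 2 ∂(unif d) ≤ (M * ρ n / 2) ^ 2 →
      farSet B f (L n) (M * ρ n)
        ⊆ {a | (M * ρ n / 2) ^ 2 < ∑ j, (a j - coeffVec B f (L n) j) ^ 2} := by
    intro M n h1 h2
    have h3 := farSet_subset B hf.1 h1 h2
    rwa [mul_div_cancel₀ _ two_ne_zero] at h3
  refine ⟨⟨M₀, by linarith, fun M hM => ?_⟩, ⟨M₀, by linarith, fun M hM => ?_⟩⟩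
  · refine tendsto_lintegral_posterior hfm σ (fun n D s => bayes_apply_le_one _ _ _)
      (bad := fun n => {D | (n : ℝ) ^ 2 / 4 < ∑ jk, partialSum (gramDev B (L n)) D jk ^ 2}
        ∪ {D | K * N n * n < ∑ j, partialSum (responseDev B (h n) (L n)) D j ^ 2}) ?_ hexp ?_
    · refine tendsto_of_tendsto_of_tendsto_of_le_of_le tendsto_const_nhds
        (by simpa using hgram.add hnoise₁) (fun n => bot_le) (fun n => measure_union_le _ _)
    · filter_upwards [key M hM] with n hn D hD
      obtain ⟨hn0, hr, h1, h2, h3, h4⟩ := hn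
      simp only [Set.mem_union, Set.mem_ofPred_eq, not_or, not_lt] at hD
      refine (measure_mono (hfar M n hr h1)).trans (le_trans ?_ h4)
      exact regression_posterior_tail_le B hd hκ hσ (h := h n) (fun x => by simp [hh])
        (fun j => coeffVec_sub_synth B hf.1 j) hn0 hD.1 (hD.2.trans h2) h3
  · refine tendsto_lintegral_posterior hfm σ (fun n D s => bayes_apply_le_one _ _ _)
      (bad := fun n => {D | K * N n * n < ∑ j, partialSum (responseDev B f (L n)) D j ^ 2})
      hnoise₂ hexp ?_
    filter_upwards [key M hM] with n hn D hD
    obtain ⟨hn0, hr, h1, h2, h3, h4⟩ := hn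
    simp only [not_lt] at hD
    refine (measure_mono (hfar M n hr h1)).trans (le_trans ?_ h4)
    exact harmonic_posterior_tail_le B hd hκ hσ hn0 (hD.trans h2) h3

end Contraction

end SphereMatern

theorem corollary3p3 (d : ℕ) (hd : 1 ≤ d) (B : SphereMatern.HarmonicBasis d)
    (κ α β σ : ℝ) (hκ : 0 < κ) (hσ : 0 < σ) (hα : (d : ℝ) / 2 < α) (hβ : 0 < β) (hβα : β ≤ α)
    (f₀ : SphereMatern.Sph d → ℝ) (hf₀ : SphereMatern.InSobolev B β f₀)
    (L : ℕ → ℕ)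
    (hL : (fun n : ℕ => (L n : ℝ)) =Θ[atTop] (fun n : ℕ => (n : ℝ) ^ (1 / (2 * α + d)))) :
    SphereMatern.Contracts B f₀ σ L
        (fun n D => SphereMatern.bayes (SphereMatern.maternPrior d κ α (L n))
          (SphereMatern.regressionLik B σ D))
        (fun n => (n : ℝ) ^ (-β / (2 * α + d))) ∧
      SphereMatern.Contracts B f₀ σ L
        (fun n D => SphereMatern.bayes (SphereMatern.maternPrior d κ α (L n))
          (SphereMatern.harmonicLik B σ D))
        (fun n => (n : ℝ) ^ (-β / (2 * α + d))) := by
  -- Membership in `L²` gives only almost-everywhere measurability, so the result is proved for a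
  -- measurable version and carried back.
  have h := hf₀.1.1.ae_eq_mk
  have hc := SphereMatern.contraction_of_measurable hd B hκ hσ hα hβ hβα
    hf₀.1.1.stronglyMeasurable_mk.measurable (SphereMatern.inSobolev_congr B h hf₀) hL
  exact ⟨SphereMatern.contracts_congr B h.symm hc.1, SphereMatern.contracts_congr B h.symm hc.2⟩
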